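/- **Proposition 2 (Thermal state duality).** Consider $N$ bosonic and $N$ fermionic modes with quadratures $\hat\xi_{\mathrm b}=(\hat q_1,\dots,\hat q_N,\hat p_1,\dots,\hat p_N)$ and Majorana operators $\hat\xi_{\mathrm f}=(\hat\gamma_1,\dots,\hat\gamma_N,\hat\eta_1,\dots,\hat\eta_N)$ on the tensor product of the two Fock spaces, $[\hat\xi_{\mathrm b}^a,\hat\xi_{\mathrm b}^b]=\mathrm i\Omega^{ab}$, $\{\hat\xi_{\mathrm f}^\alpha,\hat\xi_{\mathrm f}^\beta\}=G^{\alpha\beta}$, where $\Omega=\begin{pmatrix}0&\mathbb 1\\-\mathbb 1&0\end{pmatrix}$ and $G=\mathbb 1$. Let $R$ be an invertible real $2N\times 2N$ matrix, $\hat{\mathcal Q}=R_{\alpha a}\hat\xi_{\mathrm f}^\alpha\hat\xi_{\mathrm b}^a$ (summation convention), $\hat H=\hat{\mathcal Q}^2$, and $\beta>0$. Then $\hat H=\hat H_{\mathrm b}+\hat H_{\mathrm f}$ with $\hat H_{\mathrm b}=\tfrac12h^{\mathrm b}_{ab}\hat\xi^a_{\mathrm b}\hat\xi^b_{\mathrm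 b}$, $\hat H_{\mathrm f}=\tfrac{\mathrm i}2h^{\mathrm f}_{\alpha\beta}\hat\xi^\alpha_{\mathrm f}\hat\xi^\beta_{\mathrm f}$, $h^{\mathrm b}=R^{\intercal}GR$, $h^{\mathrm f}=R\Omega R^{\intercal}$. Put $K_{\mathrm b}=\Omega h^{\mathrm b}$, $K_{\mathrm f}=Gh^{\mathrm f}$. For a diagonalizable matrix $M=UDU^{-1}$ and a function $f$ write $f(M)=Uf(D)U^{-1}$. The real matrices $L_1=|K_{\mathrm f}^{-1}|^{1/2}GR$ and $L_2=|K_{\mathrm b}^{-1}|^{1/2}\Omega R^{\intercal}$ are invertible, and $L=L_1$ and $L=L_2^{-1}$ identify the bosonic with the fermionic phase space: $LK_{\mathrm b}L^{-1}=K_{\mathrm f}$, and $L$ carries the Kähler structure $(G_{\mathrm b},\Omega,J^0_{\mathrm b})$, $J^0_{\mathrm b}=|K_{\mathrm b}^{-1}|K_{\mathrm b}$, $G_{\mathrm b}=-J^0_{\mathrm b}\Omega$, to $(G,\Omega_{\mathrm f},J^0_{\mathrm f})$, $J^0_{\mathrm f}=|K_{\mathrm f}^{-1}|K_{\mathrm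 f}$, $\Omega_{\mathrm f}=J^0_{\mathrm f}G$. The thermal state $\rho=\frac1Ze^{-\beta\hat H}$, $Z=\operatorname{Tr}e^{-\beta\hat H}$, exists (i.e. $e^{-\beta\hat H}$ has finite trace) and is unique, and it is a tensor product $\rho=\rho_{\mathrm b}\otimes\rho_{\mathrm f}$ of the thermal states of $\hat H_{\mathrm b}$ and $\hat H_{\mathrm f}$. These are mixed Gaussian states with zero mean, i.e. $\rho_{\mathrm b}=e^{-(q_{ab}\hat\xi^a_{\mathrm b}\hat\xi^b_{\mathrm b}+c)}$ and $\rho_{\mathrm f}=e^{-(\mathrm iq'_{\alpha\beta}\hat\xi^\alpha_{\mathrm f}\hat\xi^\beta_{\mathrm f}+c')}$ with $q$ real symmetric, $q'$ real antisymmetric and $c,c'$ real. Their restricted complex structures $J_{\mathrm b}$, $J_{\mathrm f}$, defined by $$\operatorname{Tr}\rho_{\mathrm b}\{\hat\xi^a_{\mathrm b},\hat\xi^b_{\mathrm b}\}=-(J_{\mathrm b}\Omega)^{ab},\qquad -\mathrm i\operatorname{Tr}\rho_{\mathrm f}[\hat\xi^\alpha_{\mathrm f},\hat\xi^\beta_{\mathrm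 f}]=(J_{\mathrm f}G)^{\alpha\beta},$$ satisfy $$J_{\mathrm b}=-\cot(\beta K_{\mathrm b}/2),\qquad J_{\mathrm f}=\tan(\beta K_{\mathrm f}/2).$$ $J_{\mathrm f}$ is invertible, and $J_{\mathrm b}=-(J_{\mathrm f})^{-1}$ when the two phase spaces are identified so that $\beta K_{\mathrm b}$ and $\beta K_{\mathrm f}$ become a common generator $K$: for every invertible real $L$ with $LK_{\mathrm b}=K_{\mathrm f}L$, in particular for $L=L_1$ and $L=L_2^{-1}$, $LJ_{\mathrm b}L^{-1}=-(J_{\mathrm f})^{-1}$. Consequently the eigenvalues, with multiplicity, of $J_{\mathrm b}$ and $J_{\mathrm f}$ are $\pm\mathrm i\lambda^{\mathrm b}_i$ and $\pm\mathrm i\lambda^{\mathrm f}_i$, $i=1,\dots,N$, with $\lambda^{\mathrm f}_i>0$ and $\lambda^{\mathrm b}_i=1/\lambda^{\mathrm f}_i$. -/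

import Mathlib

namespace SUSY

noncomputable section

/-! ### Fock spaces

`S` labels the occupation number basis; a vector is its sequence of coefficients. -/

/-- The Hilbert space with orthonormal basis labelled by `S`. -/
abbrev Hilb (S : Type) : Type := lp (fun _ : S => ℂ) 2

/-- Linear maps on *all* coefficient sequences. Every polynomial in ladder operators is of this
kind: each coefficient of the image is a finite combination of coefficients of the argument.
It represents the (possibly unbounded) Hilbert space operator with the maximal domain
`{ψ ∈ ℓ² : A ψ ∈ ℓ²}`. For the quadratic Hermitian expressions used below this is the closure of
the operator on finite combinations of basis vectors, i.e. the usual self-adjoint operator. -/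
abbrev Op (S : Type) : Type := Module.End ℂ (S → ℂ)

/-- The occupation number basis vector `|s⟩`. -/
def ket {S : Type} [DecidableEq S] (s : S) : Hilb S := lp.single 2 s (1 : ℂ)

/-- Bosonic occupation numbers of `N` modes. -/
abbrev OccB (N : ℕ) : Type := Fin N → ℕ

/-- Fermionic occupation numbers of `N` modes (`true` means occupied). -/
abbrev OccF (N : ℕ) : Type := Fin N → Bool

/-- Occupation numbers of `N` bosonic and `N` fermionic modes; `Hilb (Occ N)` is the Hilbert space
tensor product of `Hilb (OccB N)` and `Hilb (OccF N)`, with `|n⟩ ⊗ |m⟩ = |n, m⟩`. -/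
abbrev Occ (N : ℕ) : Type := OccB N × OccF N

/-- Bosonic annihilation operator: `b_i |n⟩ = √n_i |n - e_i⟩`. -/
def bAnn {N : ℕ} (i : Fin N) : Op (OccB N) where
  toFun f := fun n => (Real.sqrt (n i + 1) : ℂ) * f (Function.update n i (n i + 1))
  map_add' f g := by funext n; simp [mul_add]
  map_smul' c f := by funext n; simp [mul_left_comm]

/-- Bosonic creation operator: `b_i† |n⟩ = √(n_i + 1) |n + e_i⟩`. (At `n i = 0` the coefficient
`√(n i)` vanishes.) -/
def bCre {N : ℕ} (i : Fin N) : Op (OccB N) where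
  toFun f := fun n => (Real.sqrt (n i) : ℂ) * f (Function.update n i (n i - 1))
  map_add' f g := by funext n; simp [mul_add]
  map_smul' c f := by funext n; simp [mul_left_comm]

/-- The sign `(-1)^(∑_{j < i} m_j)` from anticommuting past the modes before `i`. -/
def fSign {N : ℕ} (i : Fin N) (m : OccF N) : ℂ :=
  ∏ j : Fin N, if j < i ∧ m j = true then -1 else 1

/-- Fermionic annihilation operator on `|m⟩ = ∏_i (c_i†)^(m_i) |0⟩`. -/
def cAnn {N : ℕ} (i : Fin N) : Op (OccF N) where
  toFun f := fun m => if m i = false then fSign i m * f (Function.update m i true) else 0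
  map_add' f g := by funext m; by_cases h : m i = false <;> simp [h, mul_add]
  map_smul' c f := by funext m; by_cases h : m i = false <;> simp [h, mul_left_comm]

/-- Fermionic creation operator on `|m⟩ = ∏_i (c_i†)^(m_i) |0⟩`. -/
def cCre {N : ℕ} (i : Fin N) : Op (OccF N) where
  toFun f := fun m => if m i = true then fSign i m * f (Function.update m i false) else 0
  map_add' f g := by funext m; by_cases h : m i = true <;> simp [h, mul_add]
  map_smul' c f := by funext m; by_cases h : m i = true <;> simp [h, mul_left_comm]

/-- Labels of the `2N` Hermitian operators, `inl` for the first `N` and `inr` for the last `N`. -/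
abbrev Idx (N : ℕ) : Type := Fin N ⊕ Fin N

/-- Real `2N × 2N` matrices. -/
abbrev RMat (N : ℕ) : Type := Matrix (Idx N) (Idx N) ℝ

/-- Complex `2N × 2N` matrices. -/
abbrev CMat (N : ℕ) : Type := Matrix (Idx N) (Idx N) ℂ

/-- Complexification of a real matrix. -/
def cx {N : ℕ} (A : RMat N) : CMat N := A.map Complex.ofReal

/-- Quadratures `ξ_b = (q_1, …, q_N, p_1, …, p_N)`. -/
def xiB {N : ℕ} : Idx N → Op (OccB N)
  | Sum.inl i => ((1 / Real.sqrt 2 : ℝ) : ℂ) • (bCre i + bAnn i)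
  | Sum.inr i => (Complex.I * ((1 / Real.sqrt 2 : ℝ) : ℂ)) • (bCre i - bAnn i)

/-- Majorana operators `ξ_f = (γ_1, …, γ_N, η_1, …, η_N)`. -/
def xiF {N : ℕ} : Idx N → Op (OccF N)
  | Sum.inl i => ((1 / Real.sqrt 2 : ℝ) : ℂ) • (cCre i + cAnn i)
  | Sum.inr i => (Complex.I * ((1 / Real.sqrt 2 : ℝ) : ℂ)) • (cCre i - cAnn i)

/-- The symplectic form: `[ξ_b^a, ξ_b^b] = i Ω^{ab}`. -/
def Omega (N : ℕ) : RMat N := Matrix.fromBlocks 0 1 (-1) 0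

/-- The metric: `{ξ_f^α, ξ_f^β} = G^{αβ}`. -/
def metric (N : ℕ) : RMat N := 1

/-- The quadratic expression `∑ q_{ab} ξ^a ξ^b`. -/
def quad {N : ℕ} {S : Type} (xi : Idx N → Op S) (q : RMat N) : Op S :=
  ∑ a, ∑ b, (q a b : ℂ) • (xi a * xi b)

/-- `A ⊗ 1`. -/
def onB {N : ℕ} (A : Op (OccB N)) : Op (Occ N) where
  toFun f := fun s => A (fun n => f (n, s.2)) s.1
  map_add' f g := by
    funext s
    exact congrFun (A.map_add (fun n => f (n, s.2)) (fun n => g (n, s.2))) s.1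
  map_smul' c f := by
    funext s
    exact congrFun (A.map_smul c (fun n => f (n, s.2))) s.1

/-- `1 ⊗ A`. -/
def onF {N : ℕ} (A : Op (OccF N)) : Op (Occ N) where
  toFun f := fun s => A (fun m => f (s.1, m)) s.2
  map_add' f g := by
    funext s
    exact congrFun (A.map_add (fun m => f (s.1, m)) (fun m => g (s.1, m))) s.2
  map_smul' c f := by
    funext s
    exact congrFun (A.map_smul c (fun m => f (s.1, m))) s.2

/-! ### The supersymmetric Hamiltonian -/

/-- The supercharge `R_{αa} ξ_f^α ξ_b^a`. -/
def supercharge {N : ℕ} (R : RMat N) : Op (Occ N) :=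
  ∑ α, ∑ a, (R α a : ℂ) • (onF (xiF α) * onB (xiB a))

/-- The supersymmetric Hamiltonian, the square of the supercharge. -/
def hamiltonian {N : ℕ} (R : RMat N) : Op (Occ N) := supercharge R * supercharge R

/-- The bosonic Hamiltonian form `h^b = Rᵀ G R`. -/
def hB {N : ℕ} (R : RMat N) : RMat N := R.transpose * metric N * R

/-- The fermionic Hamiltonian form `h^f = R Ω Rᵀ`. -/
def hF {N : ℕ} (R : RMat N) : RMat N := R * Omega N * R.transpose

/-- The bosonic Hamiltonian `½ h^b_{ab} ξ_b^a ξ_b^b`. -/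
def hamB {N : ℕ} (R : RMat N) : Op (OccB N) := (1 / 2 : ℂ) • quad xiB (hB R)

/-- The fermionic Hamiltonian `(i/2) h^f_{αβ} ξ_f^α ξ_f^β`. -/
def hamF {N : ℕ} (R : RMat N) : Op (OccF N) := (Complex.I / 2) • quad xiF (hF R)

/-- The map `T₁ = G R` from the bosonic to the fermionic phase space. -/
def T1 {N : ℕ} (R : RMat N) : RMat N := metric N * R

/-- The map `T₂ = Ω Rᵀ` from the fermionic to the bosonic phase space. -/
def T2 {N : ℕ} (R : RMat N) : RMat N := Omega N * R.transpose

/-- The bosonic Lie generator `K_b = Ω h^b`, equal to `T₂ T₁`. -/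
def Kb {N : ℕ} (R : RMat N) : RMat N := Omega N * hB R

/-- The fermionic Lie generator `K_f = G h^f`, equal to `T₁ T₂`. -/
def Kf {N : ℕ} (R : RMat N) : RMat N := metric N * hF R

/-- `B = f(A)` for a diagonalizable `A`: if `A = U D U⁻¹` with `D` diagonal then
`B = U f(D) U⁻¹`. -/
def IsMatFun {N : ℕ} (f : ℂ → ℂ) (A B : CMat N) : Prop :=
  ∃ (U : CMat N) (d : Idx N → ℂ), IsUnit U.det ∧
    A = U * Matrix.diagonal d * U⁻¹ ∧ B = U * Matrix.diagonal (fun a => f (d a)) * U⁻¹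

/-- `L = |K_f⁻¹|^{1/2} T₁`. -/
def IsL1 {N : ℕ} (R L : RMat N) : Prop :=
  ∃ M : CMat N, IsMatFun (fun z => ((‖z⁻¹‖ ^ (1 / 2 : ℝ) : ℝ) : ℂ)) (cx (Kf R)) M ∧
    cx L = M * cx (T1 R)

/-- `L = |K_b⁻¹|^{1/2} T₂`. -/
def IsL2 {N : ℕ} (R L : RMat N) : Prop :=
  ∃ M : CMat N, IsMatFun (fun z => ((‖z⁻¹‖ ^ (1 / 2 : ℝ) : ℝ) : ℂ)) (cx (Kb R)) M ∧
    cx L = M * cx (T2 R)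

/-- `L` identifies the bosonic with the fermionic phase space in such a way that the two Lie
generators become one and the same generator. -/
def IsIdentification {N : ℕ} (R L : RMat N) : Prop :=
  IsUnit L.det ∧ L * Kb R = Kf R * L

/-- `L` identifies the two phase spaces as spaces with Kähler structure `(G, Ω, J)`: each phase
space carries its own form (`Ω` for bosons, `G` for fermions), the complex structure
`J = |K⁻¹| K` of the ground state, and the remaining form, fixed by `Ω = J G`, `G = -J Ω`. -/
def PreservesKahler {N : ℕ} (R L : RMat N) : Prop :=
  ∃ Jb Jf : RMat N,
    IsMatFun (fun z => (‖z⁻¹‖ : ℂ) * z) (cx (Kb R)) (cx Jb) ∧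
    IsMatFun (fun z => (‖z⁻¹‖ : ℂ) * z) (cx (Kf R)) (cx Jf) ∧
    L * Jb = Jf * L ∧
    L * Omega N * L.transpose = Jf * metric N ∧
    L * (-(Jb * Omega N)) * L.transpose = metric N

/-! ### States -/

/-- `T = e^{-A}`, for a self-adjoint operator `A` with an orthonormal basis of eigenvectors (as is
the case whenever `e^{-A}` has finite trace). -/
def IsExpNeg {S : Type} (A : Op S) (T : Hilb S →L[ℂ] Hilb S) : Prop :=
  ∃ (ι : Type) (ψ : HilbertBasis ι ℂ (Hilb S)) (E : ι → ℝ), ∀ k,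
    A (ψ k : S → ℂ) = (E k : ℂ) • (ψ k : S → ℂ) ∧
    T (ψ k) = (Real.exp (-E k) : ℂ) • ψ k

/-- `Tr(A ρ) = c`: the sum of the diagonal elements `⟨s|Aρ|s⟩` converges absolutely to `c`. -/
def HasTrace {S : Type} [DecidableEq S] (A : Op S) (ρ : Hilb S →L[ℂ] Hilb S) (c : ℂ) : Prop :=
  HasSum (fun s => A (ρ (ket s) : S → ℂ) s) c

/-- Density operators. -/
structure IsDensity {S : Type} [DecidableEq S] (ρ : Hilb S →L[ℂ] Hilb S) : Prop where
  pos : ρ.IsPositive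
  trace_one : HasTrace 1 ρ 1

/-- `ρ = e^{-βH} / Z` with `Z = Tr e^{-βH}`. -/
def IsThermal {S : Type} [DecidableEq S] (β : ℝ) (H : Op S) (ρ : Hilb S →L[ℂ] Hilb S) : Prop :=
  IsDensity ρ ∧ ∃ Z : ℝ, 0 < Z ∧ IsExpNeg ((β : ℂ) • H) ((Z : ℂ) • ρ)

/-- `ρ = ρb ⊗ ρf`, in matrix elements. -/
def IsTensor {N : ℕ} (ρ : Hilb (Occ N) →L[ℂ] Hilb (Occ N))
    (ρb : Hilb (OccB N) →L[ℂ] Hilb (OccB N)) (ρf : Hilb (OccF N) →L[ℂ] Hilb (OccF N)) : Prop :=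
  ∀ (n n' : OccB N) (m m' : OccF N),
    (ρ (ket (n, m)) : Occ N → ℂ) (n', m') =
      (ρb (ket n) : OccB N → ℂ) n' * (ρf (ket m) : OccF N → ℂ) m'

/-- `ρ` is a (mixed, centred) bosonic Gaussian state with restricted complex structure `J`:
it is the exponential of a quadratic expression, and `J` is read off from its covariance matrix
`Γ^{ab} = Tr ρ {ξ^a, ξ^b}` by `Γ = - J Ω`. -/
structure IsGaussianB {N : ℕ} (ρ : Hilb (OccB N) →L[ℂ] Hilb (OccB N)) (J : RMat N) : Prop where
  density : IsDensity ρ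
  exp_quad : ∃ (q : RMat N) (c : ℝ), q.IsSymm ∧ IsExpNeg (quad xiB q + (c : ℂ) • 1) ρ
  mean : ∀ a, HasTrace (xiB a) ρ 0
  covariance : ∀ a b, HasTrace (xiB a * xiB b + xiB b * xiB a) ρ
    ((-(J * Omega N) : RMat N) a b : ℂ)

/-- `ρ` is a (mixed) fermionic Gaussian state with restricted complex structure `J`:
it is the exponential of a quadratic expression, and `J` is read off from its covariance matrix
`Γ^{ab} = -i Tr ρ [ξ^a, ξ^b]` by `Γ = J G`. -/
structure IsGaussianF {N : ℕ} (ρ : Hilb (OccF N) →L[ℂ] Hilb (OccF N)) (J : RMat N) : Prop where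
  density : IsDensity ρ
  exp_quad : ∃ (q : RMat N) (c : ℝ), q.transpose = -q ∧
    IsExpNeg (Complex.I • quad xiF q + (c : ℂ) • 1) ρ
  mean : ∀ a, HasTrace (xiF a) ρ 0
  covariance : ∀ a b, HasTrace (-Complex.I • (xiF a * xiF b - xiF b * xiF a)) ρ
    ((J * metric N : RMat N) a b : ℂ)

/-- The eigenvalues of `J`, with multiplicity, are `± i λ_1, …, ± i λ_N`. -/
def HasEigenPairs {N : ℕ} (J : RMat N) (lam : Fin N → ℝ) : Prop :=
  (cx J).charpoly = ∏ i, (Polynomial.X - Polynomial.C (Complex.I * (lam i : ℂ))) *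
    (Polynomial.X - Polynomial.C (-(Complex.I * (lam i : ℂ))))

end

end SUSY

namespace SUSY

noncomputable section

open Matrix Complex Filter Topology

/-! ### Functions of diagonalizable matrices -/

section MatFun

variable {N : ℕ}

/-! For both kinds of modes the commutator with the Hamiltonian is linear, [ξ^a, H] = i K^a_d ξ^d.
An eigenvector u of Kᵀ with eigenvalue -iω thus gives an operator A = u_i ξ^i that lowers the energy
by ω (`commutator_of_eigenvector`), and in a Gibbs state this yields the Kubo-Martin-Schwinger
relation Tr ρ ξ^i A = e^{-βω} Tr ρ A ξ^i (`exists_moments`). The canonical commutation relations fix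
the antisymmetric part of the matrix of second moments, the anticommutation relations its symmetric
part, and the KMS relation on a basis of eigenvectors determines the rest. One scalar equation per
eigenvector produces -cot(βK_b/2) and tan(βK_f/2) (`boson_covariance`, `fermion_covariance`).

K_f is real, antisymmetric and invertible, hence diagonalizable with spectrum ±iμ_i, and K_b = R⁻¹
K_f R. Functional calculus respects intertwiners (`IsMatFun.intertwine`), so the duality under any
identification reduces to tan · (-cot) = -1 on the spectrum. The eigenvalues are i tanh(βω/2) and i
/ tanh(βω/2).

The analysis lies in making traces and uniqueness legitimate for unbounded bosonic operators, which
act on all coefficient sequences. `exists_eigenbasis_hamB` realizes (2H_b + 1)⁻¹ as a compact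
symmetric operator and bounds the mean occupation number of an eigenvector by its energy. Jensen's
inequality turns this bound into a finite partition function (`summable_exp_of_weight`), and it also
puts ρ^{1/2} in the form domain of the quadratures, as the moments require. Uniqueness and the
energy shift both need that any square-summable formal eigenvectors of distinct energies are
orthogonal. `eigenOrtho_hamB` proves this with a slowly varying cutoff, and `eigenOrtho_hamiltonian`
extends it to the full system by contraction with fermionic eigenvectors. The fermionic side is
finite-dimensional. -/

theorem cx_mul (A B : RMat N) : cx (A * B) = cx A * cx B :=
  map_mul (Complex.ofRealHom.mapMatrix (m := Idx N)) A B

theorem cx_one : cx (1 : RMat N) = 1 := map_one (Complex.ofRealHom.mapMatrix (m := Idx N))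

theorem cx_neg (A : RMat N) : cx (-A) = -cx A :=
  map_neg (Complex.ofRealHom.mapMatrix (m := Idx N)) A

theorem cx_transpose (A : RMat N) : cx A.transpose = (cx A).transpose := rfl

theorem cx_injective : Function.Injective (cx (N := N)) :=
  Matrix.map_injective Complex.ofReal_injective

theorem cx_smul (c : ℝ) (A : RMat N) : cx (c • A) = (c : ℂ) • cx A := by
  ext i j; simp [cx]

theorem cx_det (A : RMat N) : (cx A).det = (A.det : ℂ) :=
  (RingHom.map_det Complex.ofRealHom A).symm

theorem isUnit_cx_det {A : RMat N} (h : IsUnit A.det) : IsUnit (cx A).det := by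
  rw [cx_det]; exact h.map Complex.ofRealHom

theorem cx_inv {A : RMat N} (h : IsUnit A.det) : cx A⁻¹ = (cx A)⁻¹ := by
  symm
  apply Matrix.inv_eq_right_inv
  rw [← cx_mul, Matrix.mul_nonsing_inv _ h, cx_one]

theorem isMatFun_of_diag {f : ℂ → ℂ} {A U : CMat N} {d : Idx N → ℂ} (hU : IsUnit U.det)
    (hA : A = U * diagonal d * U⁻¹) :
    IsMatFun f A (U * diagonal (fun a => f (d a)) * U⁻¹) :=
  ⟨U, d, hU, hA, rfl⟩

/-- Functional calculus respects intertwiners. -/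
theorem IsMatFun.intertwine {f : ℂ → ℂ} {A A' B B' X : CMat N} (h : IsMatFun f A B)
    (h' : IsMatFun f A' B') (hX : X * A = A' * X) : X * B = B' * X := by
  obtain ⟨U, d, hU, rfl, rfl⟩ := h
  obtain ⟨V, e, hV, rfl, rfl⟩ := h'
  have hVV : V⁻¹ * V = 1 := Matrix.nonsing_inv_mul _ hV
  have hUU : U⁻¹ * U = 1 := Matrix.nonsing_inv_mul _ hU
  have hVV' : V * V⁻¹ = 1 := Matrix.mul_nonsing_inv _ hV
  have hUU' : U * U⁻¹ = 1 := Matrix.mul_nonsing_inv _ hU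
  set Y := V⁻¹ * X * U with hY
  have hYX : X = V * Y * U⁻¹ := by
    calc X = (V * V⁻¹) * X * (U * U⁻¹) := by rw [hVV', hUU']; simp
      _ = V * Y * U⁻¹ := by rw [hY]; simp only [Matrix.mul_assoc]
  have h1 : Y * diagonal d = diagonal e * Y := by
    calc Y * diagonal d = V⁻¹ * (X * (U * diagonal d * U⁻¹)) * U := by
          rw [hY]; simp only [Matrix.mul_assoc, hUU, Matrix.mul_one]
      _ = (V⁻¹ * V) * diagonal e * Y := by
          rw [hX, hY]; simp only [Matrix.mul_assoc]
      _ = _ := by rw [hVV, Matrix.one_mul]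
  -- In eigencoordinates a non-zero entry of an intertwiner joins equal eigenvalues only, so it
  -- joins equal values of any function f.
  have h2 : Y * diagonal (fun a => f (d a)) = diagonal (fun a => f (e a)) * Y := by
    ext i j
    have := congrFun (congrFun h1 i) j
    rw [mul_diagonal, diagonal_mul] at this ⊢
    by_cases hz : Y i j = 0
    · simp [hz]
    · have : d j = e i := by
        rw [mul_comm (e i)] at this
        exact mul_left_cancel₀ hz this
      rw [this, mul_comm]
  rw [hYX]
  calc V * Y * U⁻¹ * (U * diagonal (fun a => f (d a)) * U⁻¹)
      = V * (Y * ((U⁻¹ * U) * diagonal (fun a => f (d a)))) * U⁻¹ := by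
        simp only [Matrix.mul_assoc]
    _ = V * (Y * diagonal (fun a => f (d a))) * U⁻¹ := by rw [hUU, Matrix.one_mul]
    _ = V * (diagonal (fun a => f (e a)) * ((V⁻¹ * V) * Y)) * U⁻¹ := by
        rw [h2, hVV, Matrix.one_mul]
    _ = _ := by simp only [Matrix.mul_assoc]

/-- The diagonalization in `IsMatFun` is existential; the identity is an intertwiner between any two
of them, so the result does not depend on the choice. -/
theorem IsMatFun.unique {f : ℂ → ℂ} {A B B' : CMat N} (h : IsMatFun f A B)
    (h' : IsMatFun f A B') : B = B' := by
  simpa using h.intertwine h' (X := 1) (by simp)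

/-- Uniqueness moves both functions to one explicit diagonalization, so the product formula is
needed only at the spectral points and not for all complex arguments. -/
theorem IsMatFun.comp_mul {f g k : ℂ → ℂ} {A B C : CMat N} (h : IsMatFun f A B)
    (h' : IsMatFun g A C) {U : CMat N} {d : Idx N → ℂ} (hU : IsUnit U.det)
    (hA : A = U * diagonal d * U⁻¹) (hk : ∀ a, f (d a) * g (d a) = k (d a)) :
    IsMatFun k A (B * C) := by
  refine ⟨U, d, hU, hA, ?_⟩
  rw [h.unique (isMatFun_of_diag hU hA), h'.unique (isMatFun_of_diag hU hA)]
  calc _ = U * (diagonal (fun a => f (d a)) * ((U⁻¹ * U) * diagonal (fun a => g (d a)))) * U⁻¹ := by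
        simp only [Matrix.mul_assoc]
    _ = _ := by
        rw [Matrix.nonsing_inv_mul _ hU, Matrix.one_mul, diagonal_mul_diagonal]
        simp only [hk]

theorem IsMatFun.id_of_diag {A U : CMat N} {d : Idx N → ℂ} (hU : IsUnit U.det)
    (hA : A = U * diagonal d * U⁻¹) : IsMatFun (fun z => z) A A :=
  ⟨U, d, hU, hA, hA⟩

theorem IsMatFun.eq_const {f : ℂ → ℂ} {A B : CMat N} (h : IsMatFun f A B) {U : CMat N}
    {d : Idx N → ℂ} (hU : IsUnit U.det) (hA : A = U * diagonal d * U⁻¹) (c : ℂ)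
    (hc : ∀ a, f (d a) = c) : B = c • (1 : CMat N) := by
  rw [h.unique (isMatFun_of_diag hU hA)]
  simp only [hc]
  rw [show diagonal (fun _ : Idx N => c) = c • (1 : CMat N) by
    rw [← Matrix.diagonal_one, ← Matrix.diagonal_smul]; congr 1; ext; simp]
  rw [Matrix.mul_smul, Matrix.smul_mul, Matrix.mul_one, Matrix.mul_nonsing_inv _ hU]

theorem IsMatFun.transpose {f : ℂ → ℂ} {A B : CMat N} (h : IsMatFun f A B) :
    IsMatFun f A.transpose B.transpose := by
  obtain ⟨U, d, hU, rfl, rfl⟩ := h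
  refine ⟨(U.transpose)⁻¹, d, ?_, ?_, ?_⟩
  · rw [Matrix.det_nonsing_inv, Matrix.det_transpose]
    exact hU.ringInverse
  all_goals
    rw [Matrix.nonsing_inv_nonsing_inv _ (by rwa [Matrix.det_transpose]),
      Matrix.transpose_mul, Matrix.transpose_mul, Matrix.diagonal_transpose,
      Matrix.transpose_nonsing_inv, Matrix.mul_assoc]

/-- Together with `IsMatFun.transpose` this makes even functions of an antisymmetric matrix
symmetric. -/
theorem IsMatFun.neg_even {f : ℂ → ℂ} (hf : ∀ z, f (-z) = f z) {A B : CMat N}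
    (h : IsMatFun f A B) : IsMatFun f (-A) B := by
  obtain ⟨U, d, hU, rfl, rfl⟩ := h
  refine ⟨U, fun a => -d a, hU, ?_, by simp only [hf]⟩
  have : diagonal (fun a => -d a) = -diagonal d := (Matrix.diagonal_neg d).symm
  rw [this, Matrix.mul_neg, Matrix.neg_mul]

theorem IsMatFun.smul_arg {f : ℂ → ℂ} {A B : CMat N} (c : ℂ)
    (h : IsMatFun (fun z => f (c * z)) A B) : IsMatFun f (c • A) B := by
  obtain ⟨U, d, hU, rfl, rfl⟩ := h
  refine ⟨U, fun a => c * d a, hU, ?_, rfl⟩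
  have : diagonal (fun a => c * d a) = c • diagonal d := by
    rw [← Matrix.diagonal_smul]; rfl
  rw [this]; simp

/-- Real functions of real matrices are real. -/
theorem exists_real_matFun {f : ℂ → ℂ} (hf : ∀ z, f ((starRingEnd ℂ) z) = (starRingEnd ℂ) (f z))
    {A : RMat N} {U : CMat N} {d : Idx N → ℂ} (hU : IsUnit U.det)
    (hA : cx A = U * diagonal d * U⁻¹) : ∃ B : RMat N, IsMatFun f (cx A) (cx B) := by
  have h := isMatFun_of_diag (f := f) hU hA
  set B := U * diagonal (fun a => f (d a)) * U⁻¹ with hB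
  set c := (starRingEnd ℂ).mapMatrix (m := Idx N) with hc
  have hcA : c (cx A) = cx A := by
    ext i j; simp [hc, cx]
  have hcU : IsUnit (c U).det := by
    rw [hc, ← RingHom.map_det]; exact hU.map _
  have hcUi : c U⁻¹ = (c U)⁻¹ := by
    symm; apply Matrix.inv_eq_right_inv
    rw [← map_mul, Matrix.mul_nonsing_inv _ hU, map_one]
  have hcd : ∀ e : Idx N → ℂ, c (diagonal e) = diagonal (fun a => (starRingEnd ℂ) (e a)) := by
    intro e; ext i j; by_cases hij : i = j
    · subst hij; simp [hc]
    · simp [hc, hij]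
  -- Conjugating a diagonalization of a real matrix diagonalizes the same matrix, so uniqueness
  -- forces B to equal its conjugate.
  have h' : IsMatFun f (cx A) (c B) := by
    refine ⟨c U, fun a => (starRingEnd ℂ) (d a), hcU, ?_, ?_⟩
    · rw [← hcA, hA, map_mul, map_mul, hcUi, hcd]
    · rw [hB, map_mul, map_mul, hcUi, hcd]; simp only [hf]
  have hBB : c B = B := h'.unique h
  refine ⟨B.map Complex.re, ?_⟩
  have : cx (B.map Complex.re) = B := by
    ext i j
    have := congrFun (congrFun hBB i) j
    simp only [hc, RingHom.mapMatrix_apply, Matrix.map_apply] at this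
    simpa [cx] using Complex.conj_eq_iff_re.1 this
  rw [this]; exact h

end MatFun

/-! ### Spectrum of a real antisymmetric matrix -/

/-- An invertible real antisymmetric matrix is diagonalizable with eigenvalues `i ω_a`, where the
`ω_a` are `± μ_1, …, ± μ_N`. -/
theorem exists_diag_antisymm {N : ℕ} (A : RMat N) (hA : A.transpose = -A) (hdet : IsUnit A.det) :
    ∃ (W : CMat N) (ω : Idx N → ℝ) (μ : Fin N → ℝ), IsUnit W.det ∧
      cx A = W * diagonal (fun a => I * (ω a : ℂ)) * W⁻¹ ∧ (∀ a, ω a ≠ 0) ∧ (∀ i, 0 < μ i) ∧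
      (Finset.univ.val.map ω) =
        Finset.univ.val.map μ + (Finset.univ.val.map μ).map (fun x => -x) := by
  have hH : ((-I) • cx A).IsHermitian := by
    ext i j
    have := congrFun (congrFun hA i) j
    simp only [Matrix.transpose_apply, Matrix.neg_apply] at this
    simp [cx, Matrix.conjTranspose_apply, this]
  set W : CMat N := (hH.eigenvectorUnitary : CMat N) with hW
  set ω := hH.eigenvalues with hω
  have hWW : W * star W = 1 := Unitary.mul_star_self_of_mem hH.eigenvectorUnitary.2
  have hWu : IsUnit W.det := Matrix.isUnit_det_of_right_inverse hWW
  have hWi : W⁻¹ = star W := Matrix.inv_eq_right_inv hWW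
  have hdiag : cx A = W * diagonal (fun a => I * (ω a : ℂ)) * W⁻¹ := by
    have h := hH.spectral_theorem
    rw [Unitary.conjStarAlgAut_apply] at h
    have h2 : cx A = I • ((-I) • cx A) := by rw [smul_smul]; simp
    rw [h2, h, hWi]
    have : diagonal (fun a => I * (ω a : ℂ)) =
        I • diagonal ((fun x : ℝ => (x : ℂ)) ∘ hH.eigenvalues) := by
      rw [← Matrix.diagonal_smul]; rfl
    rw [this]
    simp [hW]
  have hcp : ∀ (V : CMat N) (e : Idx N → ℂ), IsUnit V.det →
      (V * diagonal e * V⁻¹).charpoly = ∏ a, (Polynomial.X - Polynomial.C (e a)) := by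
    intro V e hV
    rw [← Matrix.charpoly_diagonal e, Matrix.mul_assoc, Matrix.charpoly_mul_comm, Matrix.mul_assoc,
      Matrix.nonsing_inv_mul _ hV, Matrix.mul_one]
  have hne : ∀ a, ω a ≠ 0 := by
    have h1 : (cx A).det ≠ 0 := (isUnit_cx_det hdet).ne_zero
    rw [hdiag, Matrix.det_mul, Matrix.det_mul, Matrix.det_diagonal] at h1
    intro a ha
    apply h1
    rw [Finset.prod_eq_zero (Finset.mem_univ a) (by simp [ha])]
    simp
  -- the spectrum is symmetric
  have hsymm : (Finset.univ.val.map ω).map (fun x => -x) = Finset.univ.val.map ω := by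
    -- A matrix and its transpose have the same characteristic polynomial, and here the transpose is
    -- the negative.
    have h1 : (cx A).charpoly = (-(cx A)).charpoly := by
      rw [← cx_neg, ← hA, cx_transpose, Matrix.charpoly_transpose]
    have h2 : -(cx A) = W * diagonal (fun a => -(I * (ω a : ℂ))) * W⁻¹ := by
      have : diagonal (fun a => -(I * (ω a : ℂ))) = -diagonal (fun a => I * (ω a : ℂ)) :=
        (Matrix.diagonal_neg _).symm
      rw [this, hdiag, Matrix.mul_neg, Matrix.neg_mul]
    rw [h2, hdiag, hcp _ _ hWu, hcp _ _ hWu] at h1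
    have h3 := congrArg Polynomial.roots h1
    have key : ∀ e : Idx N → ℂ, (∏ a, (Polynomial.X - Polynomial.C (e a))).roots =
        Finset.univ.val.map e := by
      intro e
      have := Polynomial.roots_multiset_prod_X_sub_C (Finset.univ.val.map e)
      rw [Multiset.map_map] at this
      exact this
    rw [key, key] at h3
    have h4 := congrArg (Multiset.map (fun z : ℂ => z.im)) h3
    simpa [Multiset.map_map, Function.comp_def] using h4.symm
  set s := Finset.univ.val.map ω with hs
  have hsplit : s = s.filter (fun x => 0 < x) + s.filter (fun x => x < 0) := by
    have h1 := Multiset.filter_add_not (fun x : ℝ => 0 < x) s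
    rw [← h1]
    congr 1
    · rw [h1]
    rw [h1]
    apply Multiset.filter_congr
    intro x hx
    rw [hs, Multiset.mem_map] at hx
    obtain ⟨a, _, rfl⟩ := hx
    constructor
    · intro h; exact lt_of_le_of_ne (not_lt.1 h) (hne a)
    · intro h; exact not_lt.2 h.le
  have hneg : s.filter (fun x => x < 0) = (s.filter (fun x => 0 < x)).map (fun x => -x) := by
    conv_lhs => rw [← hsymm]
    rw [Multiset.filter_map]
    congr 1
    apply Multiset.filter_congr
    intro x _
    simp
  set P := s.filter (fun x => 0 < x) with hP
  -- Negation exchanges the positive and negative eigenvalues and none is zero, so exactly half of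
  -- the 2N are positive.
  have hcard : P.card = N := by
    have h1 : s.card = N + N := by simp [hs]
    rw [hsplit, hneg, Multiset.card_add, Multiset.card_map] at h1
    omega
  obtain ⟨μ, hμ⟩ : ∃ μ : Fin N → ℝ, Finset.univ.val.map μ = P := by
    obtain ⟨l, hl⟩ := Quot.exists_rep P
    have hll : l.length = N := by rw [← hcard, ← hl]; rfl
    subst hll
    refine ⟨l.get, ?_⟩
    rw [← hl]
    simp only [Fin.univ_val_map, List.ofFn_get]
    rfl
  refine ⟨W, ω, μ, hWu, hdiag, hne, ?_, ?_⟩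
  · intro i
    have : μ i ∈ P := by rw [← hμ]; exact Multiset.mem_map_of_mem _ (Finset.mem_univ i)
    exact (Multiset.mem_filter.1 this).2
  · rw [hμ, ← hneg]; exact hsplit

/-- The eigenvalues of an odd function of such a matrix. -/
theorem hasEigenPairs_of_diag {N : ℕ} {J : RMat N} {W : CMat N} {ω : Idx N → ℝ} {μ : Fin N → ℝ}
    (hW : IsUnit W.det) (t : ℝ → ℝ) (ht : ∀ x, t (-x) = -t x)
    (hJ : cx J = W * diagonal (fun a => I * (t (ω a) : ℂ)) * W⁻¹)
    (hω : Finset.univ.val.map ω =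
        Finset.univ.val.map μ + (Finset.univ.val.map μ).map (fun x => -x)) :
    HasEigenPairs J (fun i => t (μ i)) := by
  unfold HasEigenPairs
  rw [hJ, Matrix.mul_assoc, Matrix.charpoly_mul_comm, Matrix.mul_assoc,
      Matrix.nonsing_inv_mul _ hW, Matrix.mul_one, Matrix.charpoly_diagonal]
  have h : ∀ (F : ℝ → Polynomial ℂ), ∏ a, F (ω a) = ∏ i, (F (μ i) * F (-μ i)) := by
    intro F
    have := congrArg (fun s => (Multiset.map F s).prod) hω
    simp only [Multiset.map_add, Multiset.prod_add, Multiset.map_map, Function.comp_def] at this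
    rw [Finset.prod_mul_distrib]
    exact this
  rw [h (fun x => Polynomial.X - Polynomial.C (I * (t x : ℂ)))]
  simp [ht]

/-! ### The identification maps -/

section Identification

variable {N : ℕ} {R : RMat N}

theorem Kf_eq (R : RMat N) : Kf R = R * Omega N * R.transpose := by
  simp [Kf, hF, metric]

theorem Kb_eq (R : RMat N) : Kb R = Omega N * R.transpose * R := by
  simp [Kb, hB, metric, Matrix.mul_assoc]

theorem Omega_transpose : (Omega N).transpose = -Omega N := by
  simp [Omega, Matrix.fromBlocks_transpose, Matrix.fromBlocks_neg]

theorem Omega_mul_self : Omega N * Omega N = -1 := by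
  simp [Omega, Matrix.fromBlocks_multiply, ← Matrix.fromBlocks_one, Matrix.fromBlocks_neg]

theorem isUnit_det_Omega : IsUnit (Omega N).det :=
  Matrix.isUnit_det_of_right_inverse (B := -Omega N)
    (by rw [Matrix.mul_neg, Omega_mul_self, neg_neg])

theorem Kf_transpose (R : RMat N) : (Kf R).transpose = -Kf R := by
  simp [Kf_eq, Omega_transpose, Matrix.mul_assoc]

theorem hF_transpose (R : RMat N) : (hF R).transpose = -hF R := by
  simp [hF, Omega_transpose, Matrix.mul_assoc]

theorem hB_isSymm (R : RMat N) : (hB R).IsSymm := by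
  simp [hB, Matrix.IsSymm, metric]

theorem isUnit_det_Kf (hR : IsUnit R.det) : IsUnit (Kf R).det := by
  rw [Kf_eq, Matrix.det_mul, Matrix.det_mul, Matrix.det_transpose]
  exact (hR.mul isUnit_det_Omega).mul hR

/-- With the metric equal to 1, the two generators are the products of R and ΩRᵀ in the two orders,
so R itself intertwines them. -/
theorem R_mul_Kb (R : RMat N) : R * Kb R = Kf R * R := by
  simp only [Kf_eq, Kb_eq, Matrix.mul_assoc]

theorem Kb_eq_conj (hR : IsUnit R.det) : Kb R = R⁻¹ * Kf R * R := by
  rw [Matrix.mul_assoc, ← R_mul_Kb, ← Matrix.mul_assoc, Matrix.nonsing_inv_mul _ hR, Matrix.one_mul]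

theorem diag_Kb (hR : IsUnit R.det) {W : CMat N} {d : Idx N → ℂ} (hW : IsUnit W.det)
    (hK : cx (Kf R) = W * diagonal d * W⁻¹) :
    IsUnit ((cx R)⁻¹ * W).det ∧
      cx (Kb R) = ((cx R)⁻¹ * W) * diagonal d * ((cx R)⁻¹ * W)⁻¹ := by
  have hcR := isUnit_cx_det hR
  refine ⟨?_, ?_⟩
  · rw [Matrix.det_mul, Matrix.det_nonsing_inv]
    exact hcR.ringInverse.mul hW
  · rw [Kb_eq_conj hR, cx_mul, cx_mul, hK, cx_inv hR, Matrix.mul_inv_rev,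
      Matrix.nonsing_inv_nonsing_inv _ hcR]
    simp only [Matrix.mul_assoc]

/-- An intertwiner of the generators also carries J_b to J_f. The only further input is the image of
Ω: the image of the metric is then -J_f J_f = 1. -/
theorem PreservesKahler.mk_of {L Jb Jf : RMat N}
    (hb : IsMatFun (fun z => (‖z⁻¹‖ : ℂ) * z) (cx (Kb R)) (cx Jb))
    (hf : IsMatFun (fun z => (‖z⁻¹‖ : ℂ) * z) (cx (Kf R)) (cx Jf))
    (hL : L * Kb R = Kf R * L) (hLO : L * Omega N * L.transpose = Jf)
    (hJ : Jf * Jf = -1) : PreservesKahler R L := by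
  have hLJ : L * Jb = Jf * L := by
    apply cx_injective
    rw [cx_mul, cx_mul]
    exact hb.intertwine hf (by rw [← cx_mul, hL, cx_mul])
  refine ⟨Jb, Jf, hb, hf, hLJ, by simpa [metric] using hLO, ?_⟩
  rw [Matrix.mul_neg, ← Matrix.mul_assoc, hLJ, Matrix.neg_mul, Matrix.mul_assoc, Matrix.mul_assoc,
    ← Matrix.mul_assoc L, hLO, hJ, neg_neg, metric]

theorem norm_rpow_half_conj (z : ℂ) :
    ((‖((starRingEnd ℂ) z)⁻¹‖ ^ (1 / 2 : ℝ) : ℝ) : ℂ) =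
      (starRingEnd ℂ) ((‖z⁻¹‖ ^ (1 / 2 : ℝ) : ℝ) : ℂ) := by
  rw [Complex.conj_ofReal, norm_inv, norm_inv, Complex.norm_conj]

theorem norm_rpow_half_mul_self (z : ℂ) :
    ((‖z⁻¹‖ ^ (1 / 2 : ℝ) : ℝ) : ℂ) * ((‖z⁻¹‖ ^ (1 / 2 : ℝ) : ℝ) : ℂ) = (‖z⁻¹‖ : ℂ) := by
  rw [← Complex.ofReal_mul, ← Real.sqrt_eq_rpow, Real.mul_self_sqrt (norm_nonneg _)]

/-- Existence and properties of the two supersymmetric identification maps. -/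
theorem exists_identifications (hR : IsUnit R.det) :
    ∃ L₁ L₂ : RMat N, IsL1 R L₁ ∧ IsL2 R L₂ ∧
      IsIdentification R L₁ ∧ PreservesKahler R L₁ ∧
      IsIdentification R L₂⁻¹ ∧ PreservesKahler R L₂⁻¹ := by
  obtain ⟨W, ω, μ, hW, hK, hω, -, -⟩ :=
    exists_diag_antisymm (Kf R) (Kf_transpose R) (isUnit_det_Kf hR)
  set d : Idx N → ℂ := fun a => I * (ω a : ℂ) with hd
  obtain ⟨hV, hKb⟩ := diag_Kb hR hW hK
  set V := (cx R)⁻¹ * W with hVdef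
  have hd0 : ∀ a, d a ≠ 0 := fun a => by simp [hd, hω a]
  set r : ℂ → ℂ := fun z => ((‖z⁻¹‖ ^ (1 / 2 : ℝ) : ℝ) : ℂ) with hr
  obtain ⟨F, hF⟩ := exists_real_matFun (f := r) norm_rpow_half_conj hW hK
  obtain ⟨B, hB⟩ := exists_real_matFun (f := r) norm_rpow_half_conj hV hKb
  have hjc : ∀ z : ℂ, (‖((starRingEnd ℂ) z)⁻¹‖ : ℂ) * (starRingEnd ℂ) z =
      (starRingEnd ℂ) ((‖z⁻¹‖ : ℂ) * z) := by
    intro z; rw [map_mul, Complex.conj_ofReal, norm_inv, norm_inv, Complex.norm_conj]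
  obtain ⟨Jf, hJf⟩ := exists_real_matFun (f := fun z => (‖z⁻¹‖ : ℂ) * z) hjc hW hK
  obtain ⟨Jb, hJb⟩ := exists_real_matFun (f := fun z => (‖z⁻¹‖ : ℂ) * z) hjc hV hKb
  -- the square of the complex structure
  have hJJ : Jf * Jf = -1 := by
    apply cx_injective
    -- At the eigenvalue iω the function takes the value iω/|ω|, whose square is -1.
    have h := (hJf.comp_mul hJf (k := fun z => ((‖z⁻¹‖ : ℂ) * z) * ((‖z⁻¹‖ : ℂ) * z)) hW hK
      (fun a => rfl)).eq_const hW hK (-1) (by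
        intro a
        have h1 : (ω a : ℂ) ≠ 0 := by exact_mod_cast hω a
        have h2 : ((|ω a| : ℝ) : ℂ) ≠ 0 := by exact_mod_cast abs_ne_zero.2 (hω a)
        have h3 : ((|ω a| : ℝ) : ℂ) ^ 2 = (ω a : ℂ) ^ 2 := by exact_mod_cast sq_abs (ω a)
        simp only [hd, norm_inv, norm_mul, Complex.norm_I, one_mul, Complex.norm_real,
          Real.norm_eq_abs, Complex.ofReal_inv]
        field_simp
        rw [h3, Complex.I_sq]; ring)
    rw [cx_mul, h, cx_neg, cx_one]; simp
  have hFu : IsUnit F.det := by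
    have : IsUnit (cx F).det := by
      rw [hF.unique (isMatFun_of_diag hW hK)]
      rw [Matrix.det_mul, Matrix.det_mul, Matrix.det_diagonal]
      refine (hW.mul (isUnit_iff_ne_zero.2 (Finset.prod_ne_zero_iff.2 fun a _ => ?_))).mul
        (by rw [Matrix.det_nonsing_inv]; exact hW.ringInverse)
      have : (0 : ℝ) < ‖(d a)⁻¹‖ := norm_pos_iff.2 (inv_ne_zero (hd0 a))
      exact Complex.ofReal_ne_zero.2 (Real.rpow_pos_of_pos this _).ne'
    rw [cx_det] at this
    exact isUnit_iff_ne_zero.2 (by exact_mod_cast this.ne_zero)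
  have hFF : F * F * Kf R = Jf := by
    apply cx_injective
    rw [cx_mul, cx_mul]
    refine IsMatFun.unique ((hF.comp_mul hF (k := fun z => (‖z⁻¹‖ : ℂ)) hW hK
      (fun a => norm_rpow_half_mul_self _)).comp_mul (IsMatFun.id_of_diag hW hK) hW hK
      (fun a => rfl)) hJf
  have hFK : F * Kf R = Kf R * F := by
    apply cx_injective
    rw [cx_mul, cx_mul]
    exact (hF.intertwine hF (X := cx (Kf R)) rfl).symm
  -- F is an even function of the antisymmetric matrix K_f.
  have hFT : F.transpose = F := by
    apply cx_injective
    have h1 := hF.transpose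
    rw [← cx_transpose, ← cx_transpose, Kf_transpose, cx_neg] at h1
    exact h1.unique (hF.neg_even (fun z => by simp [hr]))
  have hRB : R * B = F * R := by
    apply cx_injective
    rw [cx_mul, cx_mul]
    exact hB.intertwine hF (by rw [← cx_mul, ← cx_mul, R_mul_Kb])
  set L₁ := F * R with hL1
  set L₂ := B * (Omega N * R.transpose) with hL2
  -- R carries |K_b⁻¹|^{1/2} to |K_f⁻¹|^{1/2}, so the product collapses to |K_f⁻¹| K_f. Hence L₂⁻¹ =
  -- -J_f L₁, and the second map inherits its properties from the first.
  have h12 : L₁ * L₂ = Jf := by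
    calc L₁ * L₂ = F * (R * B) * (Omega N * R.transpose) := by
          simp only [hL1, hL2, Matrix.mul_assoc]
      _ = F * F * Kf R := by rw [hRB, Kf_eq]; simp only [hL1, Matrix.mul_assoc]
      _ = Jf := hFF
  have hL2i : L₂⁻¹ = -Jf * L₁ := by
    apply Matrix.inv_eq_left_inv
    rw [Matrix.mul_assoc, h12, Matrix.neg_mul, hJJ, neg_neg]
  have hL1u : IsUnit L₁.det := by rw [hL1, Matrix.det_mul]; exact hFu.mul hR
  have hid1 : L₁ * Kb R = Kf R * L₁ := by
    rw [hL1, Matrix.mul_assoc, R_mul_Kb, ← Matrix.mul_assoc, hFK, Matrix.mul_assoc]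
  have hJK : Jf * Kf R = Kf R * Jf := by
    rw [← hFF]
    simp only [Matrix.mul_assoc]
    rw [← Matrix.mul_assoc F (Kf R), hFK, Matrix.mul_assoc, ← Matrix.mul_assoc F (Kf R), hFK]
    simp only [Matrix.mul_assoc]
  have hO1 : L₁ * Omega N * L₁.transpose = Jf := by
    rw [hL1, Matrix.transpose_mul, hFT]
    calc F * R * Omega N * (R.transpose * F) = F * (Kf R * F) := by
          rw [Kf_eq]; simp only [Matrix.mul_assoc]
      _ = Jf := by rw [← hFK, ← Matrix.mul_assoc, hFF]
  have hJu : IsUnit (-Jf).det := Matrix.isUnit_det_of_right_inverse (B := Jf)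
    (by rw [Matrix.neg_mul, hJJ, neg_neg])
  have hJT : Jf.transpose = -Jf := by
    rw [← hO1]
    simp [Omega_transpose, Matrix.mul_assoc]
  have hid2 : -Jf * L₁ * Kb R = Kf R * (-Jf * L₁) := by
    rw [Matrix.mul_assoc, hid1]
    simp only [Matrix.neg_mul, Matrix.mul_neg]
    rw [← Matrix.mul_assoc, hJK, Matrix.mul_assoc]
  -- J_f is antisymmetric with square -1, so composing with -J_f leaves the image of Ω unchanged.
  have hO2 : (-Jf * L₁) * Omega N * (-Jf * L₁).transpose = Jf := by
    rw [Matrix.transpose_mul, Matrix.transpose_neg, hJT, neg_neg]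
    calc -Jf * L₁ * Omega N * (L₁.transpose * Jf)
        = -Jf * (L₁ * Omega N * L₁.transpose) * Jf := by simp only [Matrix.mul_assoc]
      _ = Jf := by rw [hO1, Matrix.neg_mul, hJJ]; simp
  refine ⟨L₁, L₂, ⟨cx F, hF, ?_⟩, ⟨cx B, hB, ?_⟩, ⟨hL1u, hid1⟩, .mk_of hJb hJf hid1 hO1 hJJ, ?_, ?_⟩
  · rw [hL1, cx_mul, T1, metric, Matrix.one_mul]
  · rw [hL2, cx_mul, T2]
  · rw [hL2i]
    exact ⟨by rw [Matrix.det_mul]; exact hJu.mul hL1u, hid2⟩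
  · rw [hL2i]
    exact .mk_of hJb hJf hid2 hO2 hJJ

end Identification

/-! ### Square-summable sequences -/

section Basic

variable {S : Type}

theorem mem2_iff {f : S → ℂ} : Memℓp f 2 ↔ Summable (fun s => ‖f s‖ ^ 2) := by
  rw [memℓp_gen_iff (by norm_num)]
  simp

theorem hasSum_inner_coe (f g : Hilb S) :
    HasSum (fun s => (starRingEnd ℂ) (f s) * g s) (inner ℂ f g) := by
  have := lp.hasSum_inner (𝕜 := ℂ) f g
  simpa only [RCLike.inner_apply, mul_comm] using this

theorem hasSum_norm_sq (f : Hilb S) : HasSum (fun s => ‖f s‖ ^ 2) (‖f‖ ^ 2) := by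
  have := lp.hasSum_norm (p := 2) (by norm_num) f
  simpa using this

theorem summable_norm_sq (f : Hilb S) : Summable (fun s => ‖f s‖ ^ 2) := (hasSum_norm_sq f).summable

theorem inner_ket_left [DecidableEq S] (s : S) (f : Hilb S) : inner ℂ (ket s) f = f s := by
  rw [ket, lp.inner_single_left]; simp

theorem inner_ket_right [DecidableEq S] (s : S) (f : Hilb S) :
    inner ℂ f (ket s) = (starRingEnd ℂ) (f s) := by
  rw [ket, lp.inner_single_right]; simp

theorem ket_apply [DecidableEq S] (s t : S) : (ket s : S → ℂ) t = if t = s then 1 else 0 := by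
  rw [ket, lp.single_apply]
  by_cases h : t = s
  · subst h; simp
  · simp [h]

/-- Norm convergence implies coordinatewise convergence. Ladder operators are continuous for the
latter although unbounded in norm, and this lets them pass through eigenvector expansions. -/
theorem continuous_coe : Continuous (fun f : Hilb S => (f : S → ℂ)) := by
  classical
  refine continuous_pi fun s => ?_
  have : (fun f : Hilb S => f s) = fun f => inner ℂ (ket s) f := by
    ext f; rw [inner_ket_left]
  rw [this]
  fun_prop

theorem summable_mul_of_sq {X : Type} {f g : X → ℂ} (hf : Summable (fun x => ‖f x‖ ^ 2))
    (hg : Summable (fun x => ‖g x‖ ^ 2)) : Summable (fun x => (starRingEnd ℂ) (f x) * g x) := by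
  refine Summable.of_norm_bounded (g := fun x => ‖f x‖ ^ 2 + ‖g x‖ ^ 2) (hf.add hg) fun x => ?_
  rw [norm_mul, RCLike.norm_conj]
  nlinarith [sq_nonneg (‖f x‖ - ‖g x‖), sq_nonneg (‖f x‖ + ‖g x‖)]

end Basic

/-! ### Operators diagonal in a Hilbert basis -/

section Diagonal

variable {S ι : Type}

/-- Bounded operators given by a formula on all sequences. -/
def BddOp (A : Op S) : Prop := ∃ T : Hilb S →L[ℂ] Hilb S, ∀ f, (T f : S → ℂ) = A f

theorem BddOp.add {A B : Op S} (hA : BddOp A) (hB : BddOp B) : BddOp (A + B) := by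
  obtain ⟨T, hT⟩ := hA
  obtain ⟨U, hU⟩ := hB
  exact ⟨T + U, fun f => by
    rw [_root_.add_apply, lp.coeFn_add, hT, hU, LinearMap.add_apply]⟩

theorem BddOp.smul {A : Op S} (c : ℂ) (hA : BddOp A) : BddOp (c • A) := by
  obtain ⟨T, hT⟩ := hA
  exact ⟨c • T, fun f => by
    rw [_root_.smul_apply, lp.coeFn_smul, hT, LinearMap.smul_apply]⟩

/-- Weighted shifts with bounded weight are bounded. -/
theorem bddOp_of_shift {A : Op S} {m : S → ℂ} {σ : S → S} {C : ℝ}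
    (hA : ∀ f s, A f s = m s * f (σ s)) (hm : ∀ s, ‖m s‖ ≤ C)
    (hσ : Set.InjOn σ {s | m s ≠ 0}) : BddOp A := by
  have hbd : ∀ f : Hilb S, Summable (fun s => ‖A f s‖ ^ 2) ∧
      ∑' s, ‖A f s‖ ^ 2 ≤ C ^ 2 * ‖f‖ ^ 2 := by
    intro f
    -- Injectivity of σ is available only where the weight is non-zero, so the sum is restricted to
    -- that set before it is compared with the norm of f.
    have h1 : Summable (fun x : {s | m s ≠ 0} => ‖f (σ x)‖ ^ 2) :=
      (summable_norm_sq f).comp_injective (i := fun x : {s | m s ≠ 0} => σ x)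
        (fun x y h => Subtype.ext (hσ x.2 y.2 h))
    have h2 : ∑' x : {s | m s ≠ 0}, ‖f (σ x)‖ ^ 2 ≤ ‖f‖ ^ 2 := by
      rw [← (hasSum_norm_sq f).tsum_eq]
      exact tsum_comp_le_tsum_of_inj (summable_norm_sq f) (fun s => sq_nonneg _)
        (i := fun x : {s | m s ≠ 0} => σ x) (fun x y h => Subtype.ext (hσ x.2 y.2 h))
    have h3 := (hasSum_subtype_iff_indicator (f := fun s => ‖f (σ s)‖ ^ 2)
      (s := {s | m s ≠ 0})).1 h1.hasSum
    have h4 : ∀ s, ‖A f s‖ ^ 2 ≤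
        C ^ 2 * Set.indicator {s | m s ≠ 0} (fun s => ‖f (σ s)‖ ^ 2) s := by
      intro s
      rw [hA]
      by_cases hs : m s = 0
      · simp [hs]
      · rw [Set.indicator_of_mem (show s ∈ {s | m s ≠ 0} from hs), norm_mul, mul_pow]
        gcongr
        exact hm s
    have h5 := h3.mul_left (C ^ 2)
    have h6 : Summable (fun s => ‖A f s‖ ^ 2) :=
      Summable.of_nonneg_of_le (fun s => sq_nonneg _) h4 h5.summable
    refine ⟨h6, (h6.tsum_le_tsum h4 h5.summable).trans ?_⟩
    rw [h5.tsum_eq]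
    exact mul_le_mul_of_nonneg_left h2 (sq_nonneg C)
  let L : Hilb S →ₗ[ℂ] Hilb S :=
    { toFun := fun f => ⟨A f, mem2_iff.2 (hbd f).1⟩
      map_add' := fun f g => by ext s; exact congrFun (A.map_add f g) s
      map_smul' := fun c f => by ext s; exact congrFun (A.map_smul c f) s }
  refine ⟨L.mkContinuous |C| fun f => ?_, fun f => rfl⟩
  have h1 := hasSum_norm_sq (L f)
  have h2 : ‖L f‖ ^ 2 ≤ C ^ 2 * ‖f‖ ^ 2 := h1.tsum_eq ▸ (hbd f).2
  refine abs_le_of_sq_le_sq' ?_ (by positivity) |>.2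
  rwa [mul_pow, sq_abs]

/-- Multiplication by a function. -/
def mulOp (p : S → ℂ) : Op S where
  toFun f := fun s => p s * f s
  map_add' f g := by funext s; simp [mul_add]
  map_smul' c f := by funext s; simp [mul_left_comm]

@[simp] theorem mulOp_apply (p f : S → ℂ) (s : S) : mulOp p f s = p s * f s := rfl

theorem bddOp_mulOp {p : S → ℂ} {C : ℝ} (hp : ∀ s, ‖p s‖ ≤ C) : BddOp (mulOp p) :=
  bddOp_of_shift (σ := id) (fun _ _ => rfl) hp (Set.injOn_id _)

theorem exists_diag_op (b : HilbertBasis ι ℂ (Hilb S)) {p : ι → ℝ} {C : ℝ}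
    (hp : ∀ k, |p k| ≤ C) :
    ∃ T : Hilb S →L[ℂ] Hilb S, ∀ k, T (b k) = (p k : ℂ) • b k := by
  classical
  obtain ⟨D, hD⟩ := bddOp_mulOp (p := fun k => (p k : ℂ)) (C := C) (by simpa using hp)
  refine ⟨(b.repr.symm.toContinuousLinearEquiv : lp (fun _ : ι => ℂ) 2 →L[ℂ] Hilb S) ∘L D ∘L
    (b.repr.toContinuousLinearEquiv : Hilb S →L[ℂ] lp (fun _ : ι => ℂ) 2), fun k => ?_⟩
  have h : D (b.repr (b k)) = (p k : ℂ) • b.repr (b k) := by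
    ext l
    rw [hD, lp.coeFn_smul, b.repr_self]
    by_cases hl : l = k
    · subst hl; simp
    · simp [hl]
  change b.repr.symm (D (b.repr (b k))) = _
  rw [h, map_smul, LinearIsometryEquiv.symm_apply_apply]

theorem hasSum_diag_op (b : HilbertBasis ι ℂ (Hilb S)) {p : ι → ℝ} {T : Hilb S →L[ℂ] Hilb S}
    (hT : ∀ k, T (b k) = (p k : ℂ) • b k) (x : Hilb S) :
    HasSum (fun k => ((p k : ℂ) * inner ℂ (b k) x) • b k) (T x) := by
  have := (b.hasSum_repr x).mapL T
  simpa only [map_smul, hT, smul_smul, b.repr_apply_apply, mul_comm] using this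

theorem ext_of_basis (b : HilbertBasis ι ℂ (Hilb S)) {T U : Hilb S →L[ℂ] Hilb S}
    (h : ∀ k, T (b k) = U (b k)) : T = U := by
  ext1 x
  have h1 := (b.hasSum_repr x).mapL T
  have h2 := (b.hasSum_repr x).mapL U
  simp only [map_smul, h] at h1 h2
  exact h1.unique h2

theorem isPositive_diag_op (b : HilbertBasis ι ℂ (Hilb S)) {p : ι → ℝ} (hp : ∀ k, 0 ≤ p k)
    {T : Hilb S →L[ℂ] Hilb S} (hT : ∀ k, T (b k) = (p k : ℂ) • b k) : T.IsPositive := by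
  rw [ContinuousLinearMap.isPositive_iff_complex]
  intro x
  have h1 : HasSum (fun k => ((p k * ‖inner ℂ (b k) x‖ ^ 2 : ℝ) : ℂ)) (inner ℂ (T x) x) := by
    have h := (hasSum_diag_op b hT x).mapL (innerSL ℂ x)
    have h2 := (Complex.hasSum_conj'.2 h)
    simp only [innerSL_apply_apply, inner_smul_right, inner_conj_symm] at h2
    convert h2 using 2 with k
    rw [map_mul, inner_conj_symm, map_mul, inner_conj_symm, Complex.conj_ofReal, mul_assoc,
      ← inner_conj_symm x (b k), Complex.conj_mul']
    push_cast
    ring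
  have h2 : (inner ℂ (T x) x : ℂ) = ((∑' k, p k * ‖inner ℂ (b k) x‖ ^ 2 : ℝ) : ℂ) := by
    rw [← h1.tsum_eq, Complex.ofReal_tsum]
  rw [h2]
  refine ⟨by simp, ?_⟩
  rw [RCLike.re_to_complex, Complex.ofReal_re]
  exact tsum_nonneg fun k => mul_nonneg (hp k) (sq_nonneg _)

variable [DecidableEq S]

/-- Applying an operator that is continuous for coordinatewise convergence. -/
theorem hasSum_op_diag (b : HilbertBasis ι ℂ (Hilb S)) {p : ι → ℝ} {T : Hilb S →L[ℂ] Hilb S}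
    (hT : ∀ k, T (b k) = (p k : ℂ) • b k) {A : Op S} (hA : Continuous A) (s t : S) :
    HasSum (fun k => (p k : ℂ) * ((starRingEnd ℂ) (b k s) * A (b k) t))
      (A (T (ket s) : S → ℂ) t) := by
  have h := hasSum_diag_op b hT (ket s)
  have h1 : HasSum (fun k => ((((p k : ℂ) * inner ℂ (b k) (ket s)) • b k : Hilb S) : S → ℂ))
      (T (ket s) : S → ℂ) := by
    have := h.map (AddMonoidHom.mk' (fun f : Hilb S => (f : S → ℂ)) (fun _ _ => rfl))
      continuous_coe
    exact this
  have h2 := h1.map A.toAddMonoidHom hA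
  have h3 := Pi.hasSum.1 h2 t
  convert h3 using 2 with k
  · change _ = A (((p k : ℂ) * inner ℂ (b k) (ket s)) • (b k : S → ℂ)) t
    rw [map_smul, inner_ket_right, Pi.smul_apply, smul_eq_mul, mul_assoc]
  · rfl

/-- The trace of `A T` for `T` diagonal in the basis `b`. -/
theorem hasTrace_diag_op (b : HilbertBasis ι ℂ (Hilb S)) {p : ι → ℝ} {T : Hilb S →L[ℂ] Hilb S}
    (hT : ∀ k, T (b k) = (p k : ℂ) • b k) {A : Op S} (hA : Continuous A) {c : ℂ}
    (hc : HasSum (fun x : ι × S => (p x.1 : ℂ) * ((starRingEnd ℂ) (b x.1 x.2) * A (b x.1) x.2)) c) :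
    HasTrace A T c := by
  -- Joint summability over eigenvectors and labels permits summing over the eigenvectors first, at
  -- each fixed label.
  have h1 := (Equiv.prodComm S ι).hasSum_iff.2 hc
  exact h1.prod_fiberwise (fun s => hasSum_op_diag b hT hA s s)

end Diagonal

/-! ### Compact self-adjoint operators -/

/-- Eigenspaces of a symmetric operator are mutually orthogonal, and for a compact one they span a
dense subspace. The union of orthonormal bases of all of them, the kernel included, is therefore a
Hilbert basis. -/
theorem exists_eigenbasis {V : Type} [NormedAddCommGroup V] [InnerProductSpace ℂ V]
    [CompleteSpace V] {T : V →L[ℂ] V} (hc : IsCompactOperator T) (hs : T.IsSymmetric) :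
    ∃ (ι : Type) (b : HilbertBasis ι ℂ V) (μ : ι → ℝ), ∀ k, T (b k) = (μ k : ℂ) • b k := by
  have hcl : ∀ μ : ℂ, CompleteSpace (Module.End.eigenspace (T : Module.End ℂ V) μ) := by
    intro μ
    have : IsClosed ((Module.End.eigenspace (T : Module.End ℂ V) μ : Submodule ℂ V) : Set V) := by
      have h : ((Module.End.eigenspace (T : Module.End ℂ V) μ : Submodule ℂ V) : Set V) =
          {x | T x = μ • x} := by
        ext x; simp
      rw [h]
      exact isClosed_eq T.continuous (continuous_const_smul μ)
    exact this.completeSpace_coe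
  have hex : ∀ μ : ℂ, ∃ (w : Set (Module.End.eigenspace (T : Module.End ℂ V) μ))
      (b : HilbertBasis w ℂ (Module.End.eigenspace (T : Module.End ℂ V) μ)),
      ⇑b = ((↑) : w → _) := fun μ => exists_hilbertBasis _ _
  choose w b hb using hex
  have hfam := LinearMap.IsSymmetric.orthogonalFamily_eigenspaces hs
  have hon := hfam.orthonormal_sigma_orthonormal (v_family := fun μ => ⇑(b μ))
    (fun μ => (b μ).orthonormal)
  have hbot : (Submodule.span ℂ (Set.range
      (fun a : Σ μ, w μ => (Module.End.eigenspace (T : Module.End ℂ V) a.1).subtypeₗᵢ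
        (b a.1 a.2))))ᗮ = ⊥ := by
    rw [eq_bot_iff]
    intro x hx
    rw [← ContinuousLinearMap.orthogonalComplement_iSup_eigenspaces_eq_bot hc hs,
      Submodule.mem_orthogonal]
    intro u hu
    have hle : (⨆ μ, Module.End.eigenspace (T : Module.End ℂ V) μ) ≤ (Submodule.span ℂ {x})ᗮ := by
      refine iSup_le fun μ v hv => ?_
      rw [Submodule.mem_orthogonal_singleton_iff_inner_right]
      have h1 := ((b μ).hasSum_repr ⟨v, hv⟩).mapL (Submodule.subtypeL _)
      have h2 := h1.mapL (innerSL ℂ x)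
      have h3 : ∀ i : w μ, inner ℂ x ((b μ i : Module.End.eigenspace (T : Module.End ℂ V) μ) : V)
          = 0 := by
        intro i
        rw [Submodule.mem_orthogonal'] at hx
        exact hx _ (Submodule.subset_span ⟨⟨μ, i⟩, rfl⟩)
      simp only [map_smul, Submodule.subtypeL_apply, innerSL_apply_apply, h3, smul_zero] at h2
      exact h2.unique hasSum_zero
    have := hle hu
    rw [Submodule.mem_orthogonal_singleton_iff_inner_left] at this
    exact this
  let B := HilbertBasis.mkOfOrthogonalEqBot hon hbot
  -- The labels run over all complex μ, but an actual basis vector is non-zero, which makes its μ a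
  -- genuine and hence real eigenvalue.
  refine ⟨_, B, fun a => a.1.re, fun a => ?_⟩
  have hBa : B a = ((b a.1 a.2 : Module.End.eigenspace (T : Module.End ℂ V) a.1) : V) := by
    rw [HilbertBasis.coe_mkOfOrthogonalEqBot]; rfl
  have hmem := Module.End.mem_eigenspace_iff.1 (b a.1 a.2).2
  have hne : ((b a.1 a.2 : Module.End.eigenspace (T : Module.End ℂ V) a.1) : V) ≠ 0 := by
    rw [← hBa]; exact B.orthonormal.ne_zero a
  have hev : Module.End.HasEigenvalue (T : Module.End ℂ V) a.1 :=
    Module.End.hasEigenvalue_of_hasEigenvector ⟨(b a.1 a.2).2, hne⟩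
  have hreal := LinearMap.IsSymmetric.conj_eigenvalue_eq_self hs hev
  have : ((a.1.re : ℝ) : ℂ) = a.1 := (Complex.conj_eq_iff_re.1 hreal)
  rw [hBa, this]
  exact hmem

theorem hasSum_congr {X α : Type} [AddCommMonoid α] [TopologicalSpace α] {f g : X → α} {a : α}
    (h : ∀ x, f x = g x) : HasSum f a ↔ HasSum g a := by
  rw [funext h]

theorem hasSum_parseval {S ι : Type} (b : HilbertBasis ι ℂ (Hilb S)) (x : Hilb S) :
    HasSum (fun l => ‖inner ℂ (b l) x‖ ^ 2) (‖x‖ ^ 2) := by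
  have h := hasSum_norm_sq (S := ι) (b.repr x)
  rw [LinearIsometryEquiv.norm_map] at h
  refine (hasSum_congr fun l => ?_).1 h
  rw [b.repr_apply_apply]

/-! ### Gibbs states -/

section Gibbs

variable {S ι : Type}

/-- Square-summable eigenvectors for different real eigenvalues are orthogonal. -/
def EigenOrtho (H : Op S) : Prop :=
  ∀ (E E' : ℝ) (f g : Hilb S), E ≠ E' → H f = (E : ℂ) • (f : S → ℂ) →
    H g = (E' : ℂ) • (g : S → ℂ) → inner ℂ f g = 0

theorem HasTrace.smul_state [DecidableEq S] {A : Op S} {ρ : Hilb S →L[ℂ] Hilb S} {c : ℂ} (z : ℂ)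
    (h : HasTrace A ρ c) : HasTrace A (z • ρ) (z * c) := by
  have h1 := HasSum.mul_left z h
  refine (hasSum_congr fun s => ?_).1 h1
  exact congrFun (A.map_smul z (ρ (ket s) : S → ℂ)).symm s

/-- Tonelli: each unit vector distributes its weight p_k over the labels. The joint summability is
what allows the trace in the occupation basis to be evaluated in the eigenbasis. -/
theorem hasSum_basis_prod (b : HilbertBasis ι ℂ (Hilb S)) {p : ι → ℝ} {q : ℝ}
    (hp : ∀ k, 0 ≤ p k) (hq : HasSum p q) :
    HasSum (fun x : ι × S => p x.1 * ‖b x.1 x.2‖ ^ 2) q := by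
  have h1 : ∀ k, HasSum (fun s => p k * ‖b k s‖ ^ 2) (p k) := by
    intro k
    have := (hasSum_norm_sq (b k)).mul_left (p k)
    rwa [b.orthonormal.1 k, one_pow, mul_one] at this
  have hs : Summable (fun x : ι × S => p x.1 * ‖b x.1 x.2‖ ^ 2) := by
    rw [summable_prod_of_nonneg (fun x => mul_nonneg (hp _) (sq_nonneg _))]
    refine ⟨fun k => (h1 k).summable, ?_⟩
    simpa only [fun k => (h1 k).tsum_eq] using hq.summable
  have := hs.hasSum.prod_fiberwise h1
  rw [← this.unique hq]
  exact hs.hasSum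

theorem isDensity_diag [DecidableEq S] (b : HilbertBasis ι ℂ (Hilb S)) {p : ι → ℝ}
    (hp : ∀ k, 0 ≤ p k) (hq : HasSum p 1) {T : Hilb S →L[ℂ] Hilb S}
    (hT : ∀ k, T (b k) = (p k : ℂ) • b k) : IsDensity T := by
  refine ⟨isPositive_diag_op b hp hT, hasTrace_diag_op b hT continuous_id ?_⟩
  have := Complex.hasSum_ofReal.2 (hasSum_basis_prod b hp hq)
  convert this using 2 with x
  · rw [Module.End.one_apply, Complex.conj_mul']; push_cast; rfl
  · simp

/-- Existence of the Gibbs state. -/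
theorem exists_gibbs [DecidableEq S] [Nonempty S] (b : HilbertBasis ι ℂ (Hilb S)) {E : ι → ℝ}
    {β : ℝ} (hs : Summable (fun k => Real.exp (-(β * E k)))) :
    ∃ (ρ : Hilb S →L[ℂ] Hilb S) (Z : ℝ), 0 < Z ∧
      HasSum (fun k => Real.exp (-(β * E k)) / Z) 1 ∧
      ∀ k, ρ (b k) = ((Real.exp (-(β * E k)) / Z : ℝ) : ℂ) • b k := by
  -- A basis of a non-zero space is non-empty, so the partition function has a positive term.
  have hne : Nonempty ι := by
    by_contra h
    rw [not_nonempty_iff] at h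
    obtain ⟨s⟩ := ‹Nonempty S›
    have h1 := (b.hasSum_repr (ket s)).unique hasSum_empty
    have h2 := ket_apply s s
    rw [h1] at h2
    simp at h2
  obtain ⟨k₀⟩ := hne
  set Z := ∑' k, Real.exp (-(β * E k)) with hZ
  have hZ0 : 0 < Z := hs.tsum_pos (fun k => (Real.exp_pos _).le) k₀ (Real.exp_pos _)
  have h1 : HasSum (fun k => Real.exp (-(β * E k)) / Z) 1 := by
    have := hs.hasSum.div_const Z
    rwa [← hZ, div_self hZ0.ne'] at this
  obtain ⟨ρ, hρ⟩ := exists_diag_op b (p := fun k => Real.exp (-(β * E k)) / Z) (C := 1) (by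
    intro k
    have h0 : ∀ k, 0 ≤ Real.exp (-(β * E k)) / Z := fun k => by positivity
    rw [abs_of_nonneg (h0 k)]
    exact le_hasSum h1 k (fun j _ => h0 j))
  exact ⟨ρ, Z, hZ0, h1, hρ⟩

theorem isThermal_of_diag [DecidableEq S] (b : HilbertBasis ι ℂ (Hilb S)) {E : ι → ℝ} {H : Op S}
    (hH : ∀ k, H (b k : S → ℂ) = (E k : ℂ) • (b k : S → ℂ)) {β Z : ℝ} (hZ : 0 < Z)
    (h1 : HasSum (fun k => Real.exp (-(β * E k)) / Z) 1) {ρ : Hilb S →L[ℂ] Hilb S}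
    (hρ : ∀ k, ρ (b k) = ((Real.exp (-(β * E k)) / Z : ℝ) : ℂ) • b k) : IsThermal β H ρ := by
  refine ⟨isDensity_diag b (fun k => by positivity) h1 hρ, Z, hZ, ι, b, fun k => β * E k, ?_⟩
  intro k
  constructor
  · rw [LinearMap.smul_apply, hH, smul_smul]; push_cast; rfl
  · rw [_root_.smul_apply, hρ, smul_smul]
    congr 1
    rw [← Complex.ofReal_mul]
    congr 1
    field_simp

/-- The exponential form of a Gibbs state. -/
theorem isExpNeg_of_diag (b : HilbertBasis ι ℂ (Hilb S)) {E : ι → ℝ} {H A : Op S}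
    (hH : ∀ k, H (b k : S → ℂ) = (E k : ℂ) • (b k : S → ℂ)) {β Z : ℝ} (hZ : 0 < Z)
    {ρ : Hilb S →L[ℂ] Hilb S}
    (hρ : ∀ k, ρ (b k) = ((Real.exp (-(β * E k)) / Z : ℝ) : ℂ) • b k)
    (hA : A = (β : ℂ) • H + ((Real.log Z : ℝ) : ℂ) • 1) : IsExpNeg A ρ := by
  refine ⟨ι, b, fun k => β * E k + Real.log Z, fun k => ⟨?_, ?_⟩⟩
  · rw [hA, LinearMap.add_apply, LinearMap.smul_apply, LinearMap.smul_apply, hH, smul_smul,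
      Module.End.one_apply, ← add_smul]
    push_cast; rfl
  · rw [hρ, neg_add, Real.exp_add, Real.exp_neg (Real.log Z), Real.exp_log hZ]
    rfl

/-- The two exponentials may come with different eigenbases. Expanding a vector of one basis in the
other, orthogonality removes all components of different energy, so both exponentials act on it by
the same scalar. The unit traces then equate the normalizations. -/
theorem isThermal_unique [DecidableEq S] {H : Op S} (hO : EigenOrtho H) {β : ℝ} (hβ : 0 < β)
    {ρ ρ' : Hilb S →L[ℂ] Hilb S} (h : IsThermal β H ρ) (h' : IsThermal β H ρ') : ρ = ρ' := by
  obtain ⟨hd, Z, hZ, ι, b, E, hE⟩ := h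
  obtain ⟨hd', Z', hZ', ι', b', E', hE'⟩ := h'
  have hβc : (β : ℂ) ≠ 0 := by exact_mod_cast hβ.ne'
  have hdiv : ∀ {f : S → ℂ} {e : ℝ}, ((β : ℂ) • H) f = (e : ℂ) • f →
      H f = ((e / β : ℝ) : ℂ) • f := by
    intro f e hf
    rw [LinearMap.smul_apply] at hf
    have := congrArg (fun g => (β : ℂ)⁻¹ • g) hf
    simp only [smul_smul, inv_mul_cancel₀ hβc, one_smul] at this
    rw [this]; push_cast; rw [div_eq_inv_mul]
  have heq : (Z : ℂ) • ρ = (Z' : ℂ) • ρ' := by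
    refine ext_of_basis b fun k => ?_
    rw [(hE k).2]
    have h1 := hasSum_diag_op b' (p := fun l => Real.exp (-E' l)) (T := (Z' : ℂ) • ρ')
      (fun l => (hE' l).2) (b k)
    have h2 := (b'.hasSum_repr (b k)).const_smul ((Real.exp (-E k) : ℝ) : ℂ)
    refine h2.unique ((hasSum_congr fun l => ?_).1 h1)
    rw [smul_smul, b'.repr_apply_apply]
    by_cases hl : E k = E' l
    · rw [hl]
    · rw [hO _ _ _ _ (fun h => hl ((div_left_inj' hβ.ne').1 h).symm) (hdiv (hE' l).1)
        (hdiv (hE k).1)]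
      simp
  have h3 := hd.trace_one.smul_state (Z : ℂ)
  rw [heq] at h3
  have h4 := h3.unique (hd'.trace_one.smul_state (Z' : ℂ))
  have hZZ : (Z' : ℂ) ≠ 0 := by exact_mod_cast hZ'.ne'
  rw [mul_one, mul_one] at h4
  rw [h4] at heq
  exact smul_right_injective _ hZZ heq

end Gibbs

/-! ### Second moments of Gibbs states -/

section KMS

variable {S ι : Type}

/-- `B` is the adjoint of `A` on the form domain of the weight `w`. The family index allows for
Hilbert-Schmidt operators in place of vectors. -/
structure FormAdj (w : S → ℝ) (A B : Op S) : Prop where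
  cont : Continuous A
  reg : ∀ {ι : Type} (F : ι → S → ℂ), Summable (fun x : ι × S => w x.2 * ‖F x.1 x.2‖ ^ 2) →
    Summable (fun x : ι × S => ‖B (F x.1) x.2‖ ^ 2)
  adj : ∀ {ι : Type} (F G : ι → S → ℂ), Summable (fun x : ι × S => w x.2 * ‖F x.1 x.2‖ ^ 2) →
    Summable (fun x : ι × S => ‖G x.1 x.2‖ ^ 2) →
    HasSum (fun x : ι × S => (starRingEnd ℂ) (F x.1 x.2) * A (G x.1) x.2)
      (∑' x : ι × S, (starRingEnd ℂ) (B (F x.1) x.2) * G x.1 x.2)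

set_option maxHeartbeats 400000 in
/-- Second moments `Tr ρ ξ^a ξ^b` of a state `ρ = e^{-βH}/Z`, with the Kubo-Martin-Schwinger
condition on every linear combination of the `ξ^a` which shifts the energy. -/
theorem exists_moments [DecidableEq S] {N : ℕ} (b : HilbertBasis ι ℂ (Hilb S)) {E : ι → ℝ}
    {w : S → ℝ} (hw : ∀ s, 1 ≤ w s) {H : Op S}
    (hH : ∀ k, H (b k : S → ℂ) = (E k : ℂ) • (b k : S → ℂ)) (hO : EigenOrtho H)
    {ξ : Idx N → Op S} (hξ : ∀ a, FormAdj w (ξ a) (ξ a)) {β Z : ℝ} (hZ : 0 < Z)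
    (hreg : Summable (fun x : ι × S =>
      Real.exp (-(β * E x.1)) / Z * (w x.2 * ‖b x.1 x.2‖ ^ 2)))
    {ρ : Hilb S →L[ℂ] Hilb S}
    (hρ : ∀ k, ρ (b k) = ((Real.exp (-(β * E k)) / Z : ℝ) : ℂ) • b k) :
    ∃ (M : CMat N) (m : Idx N → ℂ), (∀ i j, HasTrace (ξ i * ξ j) ρ (M i j)) ∧
      (∀ i, HasTrace (ξ i) ρ (m i)) ∧
      ∀ (u : Idx N → ℂ) (c : ℝ),
        H * (∑ i, u i • ξ i) - (∑ i, u i • ξ i) * H = -(c : ℂ) • (∑ i, u i • ξ i) →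
        M *ᵥ u = (Real.exp (-(β * c)) : ℂ) • (M.transpose *ᵥ u) ∧ (c ≠ 0 → ∑ i, u i * m i = 0) := by
  set p : ι → ℝ := fun k => Real.exp (-(β * E k)) / Z with hp
  have hp0 : ∀ k, 0 < p k := fun k => by positivity
  -- regularity of the eigenvectors
  have hwk : ∀ k, Summable (fun s => w s * ‖b k s‖ ^ 2) := by
    intro k
    have h1 : Summable (fun s => p k * (w s * ‖b k s‖ ^ 2)) :=
      hreg.comp_injective (i := fun s : S => ((k, s) : ι × S)) (fun s t h => (Prod.ext_iff.1 h).2)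
    exact (summable_mul_left_iff (hp0 k).ne').1 h1
  have hunit : ∀ {f : S → ℝ}, Summable f → Summable (fun x : Unit × S => f x.2) := by
    intro f hf
    exact (Equiv.punitProd S).summable_iff (f := f) |>.2 hf
  have hmem : ∀ a k, Memℓp (ξ a (b k)) 2 := by
    intro a k
    rw [mem2_iff]
    have := (hξ a).reg (fun _ : Unit => (b k : S → ℂ)) (hunit (hwk k))
    exact (Equiv.punitProd S).summable_iff (f := fun s => ‖ξ a (b k) s‖ ^ 2) |>.1 this
  obtain ⟨η, hηc⟩ : ∃ η : Idx N → ι → Hilb S, ∀ a k, (η a k : S → ℂ) = ξ a (b k) :=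
    ⟨fun a k => ⟨ξ a (b k), hmem a k⟩, fun _ _ => rfl⟩
  obtain ⟨X, hX⟩ : ∃ X : Idx N → ι → ι → ℂ, ∀ a k l, X a k l = inner ℂ (b l) (η a k) :=
    ⟨_, fun _ _ _ => rfl⟩
  have hherm : ∀ a k l, (starRingEnd ℂ) (X a k l) = X a l k := by
    intro a k l
    have h1 := (hξ a).adj (fun _ : Unit => (b k : S → ℂ)) (fun _ : Unit => (b l : S → ℂ))
      (hunit (hwk k)) (hunit (summable_norm_sq (b l)))
    have h2 := (Equiv.punitProd S).hasSum_iff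
      (f := fun s => (starRingEnd ℂ) (b k s) * ξ a (b l) s) |>.1 h1
    have h3 := hasSum_inner_coe (η a k) (b l)
    rw [hηc] at h3
    have h4 : ∑' x : Unit × S, (starRingEnd ℂ) (ξ a (b k) x.2) * b l x.2 =
        inner ℂ (η a k) (b l) := by
      rw [← h3.tsum_eq]
      exact (Equiv.punitProd S).tsum_eq (fun s => (starRingEnd ℂ) (ξ a (b k) s) * b l s)
    rw [h4] at h2
    rw [hX, hX, inner_conj_symm]
    have h5 := hasSum_inner_coe (b k) (η a l)
    rw [hηc] at h5
    exact h2.unique h5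
  -- the Hilbert-Schmidt vector
  set F : ι → S → ℂ := fun k => ((Real.sqrt (p k) : ℝ) : ℂ) • (b k : S → ℂ) with hF
  have hpp : ∀ k, ((Real.sqrt (p k) : ℝ) : ℂ) * ((Real.sqrt (p k) : ℝ) : ℂ) = (p k : ℂ) := by
    intro k; rw [← Complex.ofReal_mul, Real.mul_self_sqrt (hp0 k).le]
  have hFn : ∀ (f : S → ℂ) k s, ‖(((Real.sqrt (p k) : ℝ) : ℂ) • f) s‖ ^ 2 = p k * ‖f s‖ ^ 2 := by
    intro f k s
    rw [Pi.smul_apply, smul_eq_mul, norm_mul, mul_pow, Complex.norm_real, Real.norm_eq_abs, sq_abs,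
      Real.sq_sqrt (hp0 k).le]
  have hFw : Summable (fun x : ι × S => w x.2 * ‖F x.1 x.2‖ ^ 2) := by
    refine (summable_congr fun x => ?_).1 hreg
    rw [hF, hFn]; ring
  have hF2 : Summable (fun x : ι × S => ‖F x.1 x.2‖ ^ 2) := by
    refine Summable.of_nonneg_of_le (fun _ => sq_nonneg _) (fun x => ?_) hFw
    exact le_mul_of_one_le_left (sq_nonneg _) (hw _)
  have hξF : ∀ a, Summable (fun x : ι × S => ‖ξ a (F x.1) x.2‖ ^ 2) := fun a => (hξ a).reg F hFw
  have hξF' : ∀ a k s, ξ a (F k) s = ((Real.sqrt (p k) : ℝ) : ℂ) * η a k s := by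
    intro a k s
    rw [hF, hηc]; simp only [map_smul]; rfl
  have hpη : ∀ a, Summable (fun k => p k * ‖η a k‖ ^ 2) := by
    intro a
    refine (summable_congr fun k => ?_).1 (hξF a).prod
    refine ((hasSum_congr fun s => ?_).1 ((hasSum_norm_sq (η a k)).mul_left (p k))).tsum_eq
    rw [hξF', norm_mul, mul_pow, Complex.norm_real, Real.norm_eq_abs, sq_abs,
      Real.sq_sqrt (hp0 k).le]
  -- This is the squared Hilbert-Schmidt norm of ξ^a ρ^{1/2}, computed in the eigenbasis by
  -- Parseval.
  have hpX : ∀ a, Summable (fun x : ι × ι => p x.1 * ‖X a x.1 x.2‖ ^ 2) := by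
    intro a
    rw [summable_prod_of_nonneg (fun x => mul_nonneg (hp0 _).le (sq_nonneg _))]
    have h1 : ∀ k, HasSum (fun l => ‖X a k l‖ ^ 2) (‖η a k‖ ^ 2) := by
      intro k
      simp only [hX]
      exact hasSum_parseval b (η a k)
    refine ⟨fun k => ((h1 k).mul_left (p k)).summable, ?_⟩
    refine (summable_congr fun k => ?_).1 (hpη a)
    rw [((h1 k).mul_left (p k)).tsum_eq]
  -- the moments
  set M : CMat N := fun i j => ∑' x : ι × S, (starRingEnd ℂ) (ξ i (F x.1) x.2) * ξ j (F x.1) x.2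
    with hM
  set m : Idx N → ℂ := fun i => ∑' x : ι × S, (starRingEnd ℂ) (ξ i (F x.1) x.2) * F x.1 x.2 with hm
  have hF_eq : ∀ (A : Op S) (x : ι × S), (starRingEnd ℂ) (F x.1 x.2) * A (F x.1) x.2 =
      (p x.1 : ℂ) * ((starRingEnd ℂ) (b x.1 x.2) * A (b x.1) x.2) := by
    intro A x
    rw [← hpp, hF]
    simp only [map_smul, Pi.smul_apply, smul_eq_mul, map_mul, Complex.conj_ofReal]
    ring
  -- The moments are defined by sums over occupation labels; inserting the eigenbasis between the
  -- two operators rewrites them through transition amplitudes, where the energy shift is visible.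
  have hMsum : ∀ i j, HasSum (fun x : ι × ι => (p x.1 : ℂ) * (X i x.2 x.1 * X j x.1 x.2))
      (M i j) := by
    intro i j
    have hs : Summable (fun x : ι × ι => (p x.1 : ℂ) * (X i x.2 x.1 * X j x.1 x.2)) := by
      refine Summable.of_norm_bounded ((hpX i).add (hpX j)) fun x => ?_
      rw [norm_mul, norm_mul, ← hherm, RCLike.norm_conj, Complex.norm_real, Real.norm_eq_abs,
        abs_of_pos (hp0 _), ← mul_add]
      refine mul_le_mul_of_nonneg_left ?_ (hp0 _).le
      nlinarith [sq_nonneg (‖X i x.1 x.2‖ - ‖X j x.1 x.2‖),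
        sq_nonneg (‖X i x.1 x.2‖ + ‖X j x.1 x.2‖)]
    have h1 : ∀ k, HasSum (fun l => (p k : ℂ) * (X i l k * X j k l))
        ((p k : ℂ) * inner ℂ (η i k) (η j k)) := by
      intro k
      have h := (b.hasSum_inner_mul_inner (η i k) (η j k)).mul_left (p k : ℂ)
      refine (hasSum_congr fun l => ?_).1 h
      rw [← hherm]
      simp only [hX, inner_conj_symm]
    have h2 := hs.hasSum.prod_fiberwise h1
    have h3 : HasSum (fun k => (p k : ℂ) * inner ℂ (η i k) (η j k)) (M i j) := by
      have h4 := (summable_mul_of_sq (hξF i) (hξF j)).hasSum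
      refine h4.prod_fiberwise fun k => ?_
      have h5 := (hasSum_inner_coe (η i k) (η j k)).mul_left (p k : ℂ)
      refine (hasSum_congr fun s => ?_).1 h5
      rw [hξF', hξF', ← hpp, map_mul, Complex.conj_ofReal]
      ring
    rw [← h2.unique h3]
    exact hs.hasSum
  refine ⟨M, m, fun i j => ?_, fun i => ?_, fun u c hu => ?_⟩
  · have hc : Continuous (ξ i * ξ j) := (hξ i).cont.comp (hξ j).cont
    refine hasTrace_diag_op b hρ hc ?_
    refine (hasSum_congr fun x => hF_eq (ξ i * ξ j) x).1 ?_
    -- The left factor is moved onto ρ^{1/2}, so neither side needs more than the form domain,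
    -- although the product is of second order.
    exact (hξ i).adj F (fun k => ξ j (F k)) hFw (hξF j)
  · refine hasTrace_diag_op b hρ (hξ i).cont ?_
    refine (hasSum_congr fun x => hF_eq (ξ i) x).1 ?_
    exact (hξ i).adj F F hFw hF2
  -- the energy shift
  have hshift : ∀ k l, E k - c ≠ E l → ∑ j, u j * X j k l = 0 := by
    intro k l hkl
    have h1 : ((∑ j, u j • η j k : Hilb S) : S → ℂ) = (∑ i, u i • ξ i) (b k) := by
      rw [LinearMap.sum_apply]
      simp only [LinearMap.smul_apply]
      rw [lp.coeFn_sum]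
      simp only [lp.coeFn_smul, hηc]
    have h2 : H (∑ j, u j • η j k : Hilb S) =
        ((E k - c : ℝ) : ℂ) • ((∑ j, u j • η j k : Hilb S) : S → ℂ) := by
      have h3 := congrArg (fun A : Op S => A (b k)) hu
      simp only [LinearMap.sub_apply, Module.End.mul_apply, LinearMap.smul_apply, hH,
        map_smul] at h3
      rw [h1]
      rw [sub_eq_iff_eq_add] at h3
      rw [h3, ← add_smul]
      congr 1
      push_cast; ring
    -- The shifted vector is known only to be a square-summable formal eigenvector, hence the need
    -- for orthogonality on the maximal domain.
    have h4 := hO _ _ _ _ hkl h2 (hH l)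
    rw [← inner_conj_symm, map_eq_zero, inner_sum] at h4
    simpa only [inner_smul_right, ← hX] using h4
  constructor
  · ext i
    rw [Pi.smul_apply, smul_eq_mul]
    simp only [Matrix.mulVec, dotProduct, Matrix.transpose_apply]
    have h1 : HasSum (fun x : ι × ι => (p x.1 : ℂ) * (X i x.2 x.1 * ∑ j, u j * X j x.1 x.2))
        (∑ j, M i j * u j) := by
      have h := hasSum_sum (s := Finset.univ) fun j _ => (hMsum i j).mul_right (u j)
      refine (hasSum_congr fun x => ?_).1 h
      rw [Finset.mul_sum, Finset.mul_sum]
      exact Finset.sum_congr rfl fun j _ => by ring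
    have h2 : HasSum (fun x : ι × ι => (p x.2 : ℂ) * (X i x.2 x.1 * ∑ j, u j * X j x.1 x.2))
        (∑ j, M j i * u j) := by
      have h := hasSum_sum (s := Finset.univ) fun j _ =>
        ((Equiv.prodComm ι ι).hasSum_iff.2 (hMsum j i)).mul_right (u j)
      refine (hasSum_congr fun x => ?_).1 h
      rw [Finset.mul_sum, Finset.mul_sum]
      exact Finset.sum_congr rfl fun j _ => by
        simp only [Function.comp_apply, Equiv.prodComm_apply, Prod.fst_swap, Prod.snd_swap]
        ring
    refine h1.unique ((hasSum_congr fun x => ?_).1 (h2.mul_left _))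
    -- Only transitions that lower the energy by exactly c contribute, and for those p_k = e^{-βc}
    -- p_l.
    by_cases hx : E x.1 - c = E x.2
    · rw [← mul_assoc, ← mul_assoc, ← mul_assoc, ← Complex.ofReal_mul]
      congr 3
      rw [hp]
      simp only
      rw [← hx, mul_div_assoc', ← Real.exp_add]
      congr 2
      ring
    · rw [hshift _ _ hx]; simp
  · intro hc
    have h1 : ∀ i, HasSum (fun k => (p k : ℂ) * X i k k) (m i) := by
      intro i
      have h4 := (summable_mul_of_sq (hξF i) hF2).hasSum
      refine h4.prod_fiberwise fun k => ?_
      have h5 := (hasSum_inner_coe (η i k) (b k)).mul_left (p k : ℂ)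
      rw [← hherm]
      simp only [hX, inner_conj_symm]
      refine (hasSum_congr fun s => ?_).1 h5
      rw [hξF', ← hpp, map_mul, Complex.conj_ofReal, hF]
      simp only [Pi.smul_apply, smul_eq_mul]
      ring
    have h2 := hasSum_sum (s := Finset.univ) fun i _ => (h1 i).mul_left (u i)
    refine h2.unique ((hasSum_congr fun k => ?_).1 hasSum_zero)
    -- An operator with a non-zero energy shift has no diagonal elements in the eigenbasis, so its
    -- mean vanishes.
    have h3 := hshift k k (by intro h; apply hc; linarith)
    calc (0 : ℂ) = (p k : ℂ) * ∑ j, u j * X j k k := by rw [h3, mul_zero]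
      _ = _ := by
        rw [Finset.mul_sum]
        exact Finset.sum_congr rfl fun j _ => by ring

end KMS

/-! ### Canonical commutation and anticommutation relations -/

section CCR

variable {N : ℕ}

theorem bAnn_apply (i : Fin N) (f : OccB N → ℂ) (n : OccB N) :
    bAnn i f n = (Real.sqrt (n i + 1) : ℂ) * f (Function.update n i (n i + 1)) := rfl

theorem bCre_apply (i : Fin N) (f : OccB N → ℂ) (n : OccB N) :
    bCre i f n = (Real.sqrt (n i) : ℂ) * f (Function.update n i (n i - 1)) := rfl

theorem bAnn_mul_bAnn (i j : Fin N) : bAnn i * bAnn j = bAnn j * bAnn i := by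
  ext f n
  by_cases h : i = j
  · rw [h]
  simp only [Module.End.mul_apply, bAnn_apply, Function.update_of_ne h,
    Function.update_of_ne (Ne.symm h)]
  rw [Function.update_comm h]
  ring

theorem bCre_mul_bCre (i j : Fin N) : bCre i * bCre j = bCre j * bCre i := by
  ext f n
  by_cases h : i = j
  · rw [h]
  simp only [Module.End.mul_apply, bCre_apply, Function.update_of_ne h,
    Function.update_of_ne (Ne.symm h)]
  rw [Function.update_comm h]
  ring

theorem bCre_bAnn_self (i : Fin N) (f : OccB N → ℂ) (n : OccB N) :
    bCre i (bAnn i f) n = (n i : ℂ) * f n := by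
  simp only [bAnn_apply, bCre_apply, Function.update_self, Function.update_idem]
  -- In the vacuum of mode i the truncated subtraction gives a meaningless label, but the
  -- coefficient √0 removes it.
  rcases Nat.eq_zero_or_pos (n i) with h | h
  · simp [h]
  · have h1 : n i - 1 + 1 = n i := by omega
    rw [h1, Function.update_eq_self, ← mul_assoc, ← Complex.ofReal_mul]
    have h2 : ((n i - 1 : ℕ) : ℝ) + 1 = (n i : ℝ) := by exact_mod_cast h1
    rw [h2, Real.mul_self_sqrt (Nat.cast_nonneg _)]
    simp

theorem bAnn_bCre_self (i : Fin N) (f : OccB N → ℂ) (n : OccB N) :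
    bAnn i (bCre i f) n = ((n i : ℂ) + 1) * f n := by
  simp only [bAnn_apply, bCre_apply, Function.update_self, Function.update_idem]
  rw [Nat.add_sub_cancel, Function.update_eq_self, ← mul_assoc, ← Complex.ofReal_mul]
  rw [Nat.cast_add, Nat.cast_one, Real.mul_self_sqrt (by positivity)]
  simp

theorem bAnn_mul_bCre (i j : Fin N) :
    bAnn i * bCre j - bCre j * bAnn i = if i = j then 1 else 0 := by
  ext f n
  by_cases h : i = j
  · subst h
    simp only [LinearMap.sub_apply, Module.End.mul_apply, Pi.sub_apply, bCre_bAnn_self,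
      bAnn_bCre_self, if_true, Module.End.one_apply]
    ring
  · simp only [LinearMap.sub_apply, Module.End.mul_apply, Pi.sub_apply, bAnn_apply, bCre_apply,
      Function.update_of_ne h, Function.update_of_ne (Ne.symm h), if_neg h]
    rw [Function.update_comm h]
    simp only [LinearMap.zero_apply, Pi.zero_apply]
    ring

theorem inv_sqrt_two_mul_self :
    ((1 / Real.sqrt 2 : ℝ) : ℂ) * ((1 / Real.sqrt 2 : ℝ) : ℂ) = 1 / 2 := by
  rw [← Complex.ofReal_mul]
  rw [div_mul_div_comm, Real.mul_self_sqrt (by norm_num)]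
  norm_num

/-- Commutators of quadratures built from ladder operators. -/
theorem xiB_comm (a b : Idx N) :
    xiB a * xiB b - xiB b * xiB a = (I * (Omega N a b : ℂ)) • (1 : Op (OccB N)) := by
  have hrr := inv_sqrt_two_mul_self
  have hc : ∀ i j : Fin N, bAnn i * bCre j = bCre j * bAnn i + (if i = j then 1 else 0) :=
    fun i j => by rw [← bAnn_mul_bCre]; abel
  rcases a with i | i <;> rcases b with j | j <;>
    simp only [xiB, Omega, Matrix.fromBlocks_apply₁₁, Matrix.fromBlocks_apply₁₂,
      Matrix.fromBlocks_apply₂₁, Matrix.fromBlocks_apply₂₂, Matrix.zero_apply, Matrix.neg_apply,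
      Matrix.one_apply, smul_mul_smul_comm] <;>
    generalize ((1 / Real.sqrt 2 : ℝ) : ℂ) = r at hrr ⊢ <;>
    simp only [mul_add, add_mul, mul_sub, sub_mul, hc, bAnn_mul_bAnn j i, bCre_mul_bCre j i,
      eq_comm (a := j) (b := i)] <;>
    by_cases h : i = j <;> simp only [h, if_true, if_false]
  all_goals
    match_scalars <;>
      first | ring1 | linear_combination 2 * I * hrr | linear_combination (-2) * I * hrr

theorem fSign_eq (i : Fin N) (m : OccF N) (j : Fin N) :
    fSign i m = (if j < i ∧ m j = true then -1 else 1) *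
      ∏ k ∈ Finset.univ.erase j, if k < i ∧ m k = true then (-1 : ℂ) else 1 :=
  (Finset.mul_prod_erase _ _ (Finset.mem_univ j)).symm

/-- Flipping mode j is felt only by later modes. For two distinct modes exactly one of the two
orders of application picks up this sign, which is the source of anticommutation. -/
theorem fSign_update (i j : Fin N) (m : OccF N) (x : Bool) :
    fSign i (Function.update m j x) = (if j < i ∧ x ≠ m j then -1 else 1) * fSign i m := by
  rw [fSign_eq i _ j, fSign_eq i m j, ← mul_assoc, Function.update_self]
  congr 1
  · by_cases h : j < i <;> cases x <;> cases m j <;> simp [h]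
  · refine Finset.prod_congr rfl fun k hk => ?_
    rw [Function.update_of_ne (Finset.ne_of_mem_erase hk)]

theorem fSign_mul_self (i : Fin N) (m : OccF N) : fSign i m * fSign i m = 1 := by
  rw [fSign, ← Finset.prod_mul_distrib]
  refine Finset.prod_eq_one fun j _ => ?_
  split_ifs <;> norm_num

theorem cAnn_apply (i : Fin N) (f : OccF N → ℂ) (m : OccF N) :
    cAnn i f m = if m i = false then fSign i m * f (Function.update m i true) else 0 := rfl

theorem cCre_apply (i : Fin N) (f : OccF N → ℂ) (m : OccF N) :
    cCre i f m = if m i = true then fSign i m * f (Function.update m i false) else 0 := rfl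

theorem cAnn_mul_cAnn (i j : Fin N) : cAnn i * cAnn j + cAnn j * cAnn i = 0 := by
  refine LinearMap.ext fun f => funext fun m => ?_
  simp only [LinearMap.add_apply, Module.End.mul_apply, Pi.add_apply, cAnn_apply, fSign_update,
    LinearMap.zero_apply, Pi.zero_apply]
  rcases lt_trichotomy i j with h | h | h
  · rw [Function.update_of_ne h.ne, Function.update_of_ne h.ne', Function.update_comm h.ne]
    cases hi : m i <;> cases hj : m j <;> simp [h, not_lt.2 h.le]
    ring
  · subst h; simp
  · rw [Function.update_of_ne h.ne, Function.update_of_ne h.ne', Function.update_comm h.ne]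
    cases hi : m i <;> cases hj : m j <;> simp [h, not_lt.2 h.le]
    ring

theorem cCre_mul_cCre (i j : Fin N) : cCre i * cCre j + cCre j * cCre i = 0 := by
  refine LinearMap.ext fun f => funext fun m => ?_
  simp only [LinearMap.add_apply, Module.End.mul_apply, Pi.add_apply, cCre_apply, fSign_update,
    LinearMap.zero_apply, Pi.zero_apply]
  rcases lt_trichotomy i j with h | h | h
  · rw [Function.update_of_ne h.ne, Function.update_of_ne h.ne', Function.update_comm h.ne]
    cases hi : m i <;> cases hj : m j <;> simp [h, not_lt.2 h.le]
    ring
  · subst h; simp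
  · rw [Function.update_of_ne h.ne, Function.update_of_ne h.ne', Function.update_comm h.ne]
    cases hi : m i <;> cases hj : m j <;> simp [h, not_lt.2 h.le]
    ring

theorem cAnn_mul_cCre (i j : Fin N) :
    cAnn i * cCre j + cCre j * cAnn i = if i = j then 1 else 0 := by
  refine LinearMap.ext fun f => funext fun m => ?_
  simp only [LinearMap.add_apply, Module.End.mul_apply, Pi.add_apply, cCre_apply, cAnn_apply,
    fSign_update]
  rcases lt_trichotomy i j with h | h | h
  · rw [if_neg h.ne, Function.update_of_ne h.ne, Function.update_of_ne h.ne',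
      Function.update_comm h.ne]
    cases hi : m i <;> cases hj : m j <;> simp [h, not_lt.2 h.le]
    ring
  · subst h
    have hs := fSign_mul_self i m
    rw [if_pos rfl]
    cases hi : m i <;> simp [← mul_assoc, hs, ← hi]
  · rw [if_neg h.ne', Function.update_of_ne h.ne, Function.update_of_ne h.ne',
      Function.update_comm h.ne]
    cases hi : m i <;> cases hj : m j <;> simp [h, not_lt.2 h.le]
    ring

theorem xiF_anticomm (a b : Idx N) :
    xiF a * xiF b + xiF b * xiF a = ((metric N a b : ℝ) : ℂ) • (1 : Op (OccF N)) := by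
  have hrr := inv_sqrt_two_mul_self
  have hI := Complex.I_mul_I
  have hc : ∀ i j : Fin N, cAnn i * cCre j = -(cCre j * cAnn i) + (if i = j then 1 else 0) :=
    fun i j => by rw [← cAnn_mul_cCre]; abel
  have ha : ∀ i j : Fin N, cAnn j * cAnn i = -(cAnn i * cAnn j) :=
    fun i j => eq_neg_of_add_eq_zero_left (cAnn_mul_cAnn j i)
  have hd : ∀ i j : Fin N, cCre j * cCre i = -(cCre i * cCre j) :=
    fun i j => eq_neg_of_add_eq_zero_left (cCre_mul_cCre j i)
  rcases a with i | i <;> rcases b with j | j <;>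
    simp only [xiF, metric, Matrix.one_apply, smul_mul_smul_comm, Sum.inl.injEq, Sum.inr.injEq,
      reduceCtorEq, if_false] <;>
    generalize ((1 / Real.sqrt 2 : ℝ) : ℂ) = r at hrr ⊢ <;>
    simp only [mul_add, add_mul, mul_sub, sub_mul, hc, ha i j, hd i j,
      eq_comm (a := j) (b := i)] <;>
    by_cases h : i = j <;> simp only [h, if_true, if_false]
  all_goals
    match_scalars <;>
      first
      | ring1
      | linear_combination 2 * hrr
      | linear_combination (-2) * r * r * hI + 2 * hrr

end CCR

/-! ### Algebra of the Hamiltonians -/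

section Algebra

variable {N : ℕ} {A : Type*} [Ring A] [Algebra ℂ A]

/-- Two separate coefficient functions are kept so that one computation serves bosons (g' = g) and
fermions (g' = -g). -/
theorem quad_commutator {ξ : Idx N → A} {g g' : Idx N → Idx N → ℂ}
    (h : ∀ a c d, ξ a * (ξ c * ξ d) - ξ c * ξ d * ξ a = g a c • ξ d + g' a d • ξ c)
    (z : ℂ) (q : RMat N) (a : Idx N) :
    ξ a * (z • ∑ c, ∑ d, (q c d : ℂ) • (ξ c * ξ d)) -
      (z • ∑ c, ∑ d, (q c d : ℂ) • (ξ c * ξ d)) * ξ a =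
      ∑ d, (z * ∑ c, (q c d * g a c + q d c * g' a c)) • ξ d := by
  have h1 : ξ a * (∑ c, ∑ d, (q c d : ℂ) • (ξ c * ξ d)) -
      (∑ c, ∑ d, (q c d : ℂ) • (ξ c * ξ d)) * ξ a =
      ∑ d, (∑ c, (q c d * g a c + q d c * g' a c)) • ξ d := by
    calc _ = ∑ c, ∑ d, (q c d : ℂ) • (ξ a * (ξ c * ξ d) - ξ c * ξ d * ξ a) := by
          simp only [Finset.mul_sum, Finset.sum_mul, mul_smul_comm, smul_mul_assoc, smul_sub,
            Finset.sum_sub_distrib]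
      _ = ∑ c, ∑ d, (((q c d : ℂ) * g a c) • ξ d + ((q c d : ℂ) * g' a d) • ξ c) := by
          simp only [h, smul_add, smul_smul]
      _ = _ := by
          simp only [Finset.sum_add_distrib, add_smul, Finset.sum_smul]
          congr 1
          exact Finset.sum_comm
  rw [mul_smul_comm, smul_mul_assoc, ← smul_sub, h1, Finset.smul_sum]
  exact Finset.sum_congr rfl fun d _ => smul_smul _ _ _

theorem ccr_commutator {ξ : Idx N → A} {g : Idx N → Idx N → ℂ}
    (h : ∀ a c, ξ a * ξ c - ξ c * ξ a = g a c • (1 : A)) (a c d : Idx N) :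
    ξ a * (ξ c * ξ d) - ξ c * ξ d * ξ a = g a c • ξ d + g a d • ξ c := by
  calc _ = (ξ a * ξ c - ξ c * ξ a) * ξ d + ξ c * (ξ a * ξ d - ξ d * ξ a) := by noncomm_ring
    _ = _ := by rw [h, h, smul_mul_assoc, mul_smul_comm, one_mul, mul_one]

/-- The identity [a, cd] = {a, c} d - c {a, d} explains why even products of anticommuting
generators still act linearly by commutators. -/
theorem car_commutator {ξ : Idx N → A} {g : Idx N → Idx N → ℂ}
    (h : ∀ a c, ξ a * ξ c + ξ c * ξ a = g a c • (1 : A)) (a c d : Idx N) :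
    ξ a * (ξ c * ξ d) - ξ c * ξ d * ξ a = g a c • ξ d + (-g a d) • ξ c := by
  calc _ = (ξ a * ξ c + ξ c * ξ a) * ξ d - ξ c * (ξ a * ξ d + ξ d * ξ a) := by noncomm_ring
    _ = _ := by
      rw [h, h, smul_mul_assoc, mul_smul_comm, one_mul, mul_one, neg_smul, sub_eq_add_neg]

/-- The commutator with H acts on coefficient vectors u through Kᵀ, so eigenvectors of Kᵀ are
generalized ladder operators. They are the input that `exists_moments` expects. -/
theorem commutator_of_eigenvector {ξ : Idx N → A} {H : A} {K : RMat N}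
    (h : ∀ a, ξ a * H - H * ξ a = ∑ d, (I * (K a d : ℂ)) • ξ d) {u : Idx N → ℂ} {c : ℝ}
    (hu : (cx K).transpose *ᵥ u = (-(I * (c : ℂ))) • u) :
    H * (∑ i, u i • ξ i) - (∑ i, u i • ξ i) * H = -(c : ℂ) • (∑ i, u i • ξ i) := by
  have h1 : H * (∑ i, u i • ξ i) - (∑ i, u i • ξ i) * H =
      -∑ i, u i • (ξ i * H - H * ξ i) := by
    simp only [Finset.mul_sum, Finset.sum_mul, mul_smul_comm, smul_mul_assoc, smul_sub,
      Finset.sum_sub_distrib]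
    abel
  have h2 : ∑ i, u i • (ξ i * H - H * ξ i) = ∑ d, (I * ∑ i, (K i d : ℂ) * u i) • ξ d := by
    simp only [h, Finset.smul_sum, smul_smul]
    rw [Finset.sum_comm]
    refine Finset.sum_congr rfl fun d _ => ?_
    rw [Finset.mul_sum, Finset.sum_smul]
    refine Finset.sum_congr rfl fun i _ => ?_
    congr 1; ring
  have h3 : ∀ d, ∑ i, (K i d : ℂ) * u i = -(I * (c : ℂ)) * u d := fun d => congrFun hu d
  rw [h1, h2, Finset.smul_sum, ← Finset.sum_neg_distrib]
  refine Finset.sum_congr rfl fun d _ => ?_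
  rw [h3, smul_smul, ← neg_smul]
  congr 1
  linear_combination (c : ℂ) * u d * Complex.I_mul_I

/-- The square of the supercharge. -/
theorem supercharge_sq {φ b : Idx N → A} {g w : RMat N} (hbφ : ∀ a α, b a * φ α = φ α * b a)
    (hbb : ∀ a c, b a * b c - b c * b a = (I * (w a c : ℂ)) • (1 : A))
    (hφφ : ∀ a c, φ a * φ c + φ c * φ a = ((g a c : ℝ) : ℂ) • (1 : A)) (hw : w.transpose = -w)
    (R : RMat N) :
    (∑ α, ∑ a, (R α a : ℂ) • (φ α * b a)) * (∑ α, ∑ a, (R α a : ℂ) • (φ α * b a)) =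
      (1 / 2 : ℂ) • ∑ a, ∑ c, ((R.transpose * g * R) a c : ℂ) • (b a * b c) +
      (I / 2 : ℂ) • ∑ α, ∑ γ, ((R * w * R.transpose) α γ : ℂ) • (φ α * φ γ) := by
  -- The symmetrization below leaves the fermionic factors in reversed order; antisymmetry of the
  -- form absorbs this into a sign.
  have hflip : (I / 2 : ℂ) • ∑ α, ∑ γ, ((R * w * R.transpose) α γ : ℂ) • (φ α * φ γ) =
      (-I / 2 : ℂ) • ∑ α, ∑ γ, ((R * w * R.transpose) α γ : ℂ) • (φ γ * φ α) := by
    have hT : (R * w * R.transpose).transpose = -(R * w * R.transpose) := by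
      simp [hw, Matrix.mul_assoc]
    rw [Finset.sum_comm, neg_div, neg_smul, ← smul_neg]
    congr 1
    simp only [← Finset.sum_neg_distrib, ← neg_smul]
    refine Finset.sum_congr rfl fun α _ => Finset.sum_congr rfl fun γ _ => ?_
    have h3 := congrFun (congrFun hT α) γ
    rw [Matrix.transpose_apply, Matrix.neg_apply] at h3
    rw [h3]
    push_cast
    rfl
  rw [hflip]
  set Q := ∑ α, ∑ a, (R α a : ℂ) • (φ α * b a) with hQdef
  have hQ : Q = ∑ x : Idx N × Idx N, (R x.1 x.2 : ℂ) • (φ x.1 * b x.2) := by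
    rw [Fintype.sum_prod_type]
  have h1 : Q * Q = ∑ x : Idx N × Idx N, ∑ y : Idx N × Idx N,
      ((R x.1 x.2 : ℂ) * (R y.1 y.2 : ℂ)) • (φ x.1 * φ y.1 * (b x.2 * b y.2)) := by
    rw [hQ, Finset.sum_mul_sum]
    refine Finset.sum_congr rfl fun x _ => Finset.sum_congr rfl fun y _ => ?_
    rw [smul_mul_smul_comm]
    congr 1
    rw [mul_assoc, ← mul_assoc (b x.2), hbφ, mul_assoc, mul_assoc]
  have h2 := h1
  rw [Finset.sum_comm] at h2
  -- The square is averaged over the exchange of its two index pairs.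
  have h3 : Q * Q = (1 / 2 : ℂ) • (Q * Q + Q * Q) := by module
  -- Each exchanged pair of terms equals {φ, φ'} b b' - φ' φ [b, b'], a purely bosonic plus a purely
  -- fermionic quadratic term.
  have h4 : ∀ x y : Idx N × Idx N, φ x.1 * φ y.1 * (b x.2 * b y.2) +
      φ y.1 * φ x.1 * (b y.2 * b x.2) = ((g x.1 y.1 : ℝ) : ℂ) • (b x.2 * b y.2) -
        (I * (w x.2 y.2 : ℂ)) • (φ y.1 * φ x.1) := by
    intro x y
    calc _ = (φ x.1 * φ y.1 + φ y.1 * φ x.1) * (b x.2 * b y.2) -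
        (φ y.1 * φ x.1) * (b x.2 * b y.2 - b y.2 * b x.2) := by noncomm_ring
      _ = _ := by rw [hφφ, hbb, smul_mul_assoc, mul_smul_comm, one_mul, mul_one]
  have hB' : ∑ a, ∑ c, ((R.transpose * g * R) a c : ℂ) • (b a * b c) =
      ∑ x : Idx N × Idx N, ∑ y : Idx N × Idx N,
      ((R x.1 x.2 : ℂ) * (R y.1 y.2 : ℂ)) • ((g x.1 y.1 : ℝ) : ℂ) • (b x.2 * b y.2) := by
    rw [Fintype.sum_prod_type_right]
    simp only [Fintype.sum_prod_type_right]
    refine Finset.sum_congr rfl fun a _ => ?_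
    rw [Finset.sum_comm]
    refine Finset.sum_congr rfl fun c _ => ?_
    simp only [smul_smul, ← Finset.sum_smul]
    congr 1
    simp only [Matrix.mul_apply, Matrix.transpose_apply, Finset.sum_mul, Complex.ofReal_sum]
    rw [Finset.sum_comm]
    refine Finset.sum_congr rfl fun α _ => Finset.sum_congr rfl fun γ _ => ?_
    push_cast; ring
  have hF' : ∑ α, ∑ γ, ((R * w * R.transpose) α γ : ℂ) • (φ γ * φ α) =
      ∑ x : Idx N × Idx N, ∑ y : Idx N × Idx N,
      ((R x.1 x.2 : ℂ) * (R y.1 y.2 : ℂ)) • (w x.2 y.2 : ℂ) • (φ y.1 * φ x.1) := by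
    rw [Fintype.sum_prod_type]
    simp only [Fintype.sum_prod_type]
    refine Finset.sum_congr rfl fun a _ => ?_
    rw [Finset.sum_comm]
    refine Finset.sum_congr rfl fun c _ => ?_
    simp only [smul_smul, ← Finset.sum_smul]
    congr 1
    simp only [Matrix.mul_apply, Matrix.transpose_apply, Finset.sum_mul, Complex.ofReal_sum]
    rw [Finset.sum_comm]
    refine Finset.sum_congr rfl fun α _ => Finset.sum_congr rfl fun γ _ => ?_
    push_cast; ring
  rw [h3, hB', hF', show (-I / 2 : ℂ) = (1 / 2 : ℂ) * (-I) by ring, mul_smul, ← smul_add]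
  congr 1
  conv_lhs => arg 1; rw [h1]
  conv_lhs => arg 2; rw [h2]
  simp only [← Finset.sum_add_distrib, Finset.smul_sum]
  refine Finset.sum_congr rfl fun x _ => Finset.sum_congr rfl fun y _ => ?_
  rw [mul_comm (R y.1 y.2 : ℂ), ← smul_add, h4, smul_sub, sub_eq_add_neg, ← smul_neg]
  congr 1
  rw [smul_comm (-I), ← neg_smul, smul_smul (-I)]
  congr 2
  ring

end Algebra

/-! ### Heisenberg equations of motion and the splitting of the Hamiltonian. -/

section Hamiltonian

variable {N : ℕ}

theorem xiB_commutator_hamB (R : RMat N) (a : Idx N) :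
    xiB a * hamB R - hamB R * xiB a = ∑ d, (I * (Kb R a d : ℂ)) • xiB d := by
  have h := quad_commutator (ccr_commutator xiB_comm) (1 / 2) (hB R) a
  refine h.trans (Finset.sum_congr rfl fun d _ => ?_)
  congr 1
  rw [Kb, Matrix.mul_apply, Complex.ofReal_sum, Finset.mul_sum, Finset.mul_sum]
  refine Finset.sum_congr rfl fun c _ => ?_
  rw [(hB_isSymm R).apply c d]
  push_cast
  ring

theorem xiF_commutator_hamF (R : RMat N) (a : Idx N) :
    xiF a * hamF R - hamF R * xiF a = ∑ d, (I * (Kf R a d : ℂ)) • xiF d := by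
  have h := quad_commutator (car_commutator xiF_anticomm) (I / 2) (hF R) a
  refine h.trans (Finset.sum_congr rfl fun d _ => ?_)
  congr 1
  rw [Kf, Matrix.mul_apply, Complex.ofReal_sum, Finset.mul_sum, Finset.mul_sum]
  refine Finset.sum_congr rfl fun c _ => ?_
  have h3 := congrFun (congrFun (hF_transpose R) c) d
  rw [Matrix.transpose_apply, Matrix.neg_apply] at h3
  rw [h3]
  push_cast
  ring

/-- `A ↦ A ⊗ 1`. -/
def onBHom (N : ℕ) : Op (OccB N) →ₐ[ℂ] Op (Occ N) :=
  AlgHom.ofLinearMap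
    { toFun := onB
      map_add' := fun _ _ => rfl
      map_smul' := fun _ _ => rfl } rfl (fun _ _ => rfl)

/-- `A ↦ 1 ⊗ A`. -/
def onFHom (N : ℕ) : Op (OccF N) →ₐ[ℂ] Op (Occ N) :=
  AlgHom.ofLinearMap
    { toFun := onF
      map_add' := fun _ _ => rfl
      map_smul' := fun _ _ => rfl } rfl (fun _ _ => rfl)

/-- Operators on the finite-dimensional fermionic Fock space are given by finite sums. -/
theorem opF_apply (A : Op (OccF N)) (f : OccF N → ℂ) (m : OccF N) :
    A f m = ∑ m', f m' * A (Pi.single m' 1) m := by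
  conv_lhs => rw [pi_eq_sum_univ' f, map_sum, Finset.sum_apply]
  refine Finset.sum_congr rfl fun m' _ => ?_
  rw [map_smul, Pi.smul_apply, smul_eq_mul]

/-- The bosonic operator is an arbitrary linear map on sequences, with no continuity to rely on.
Finiteness of the fermionic label set makes 1 ⊗ B a finite linear combination, through which
linearity of A suffices. -/
theorem onB_onF_comm (A : Op (OccB N)) (B : Op (OccF N)) : onB A * onF B = onF B * onB A := by
  refine LinearMap.ext fun f => funext fun s => ?_
  change A (fun n => B (fun m => f (n, m)) s.2) s.1 = B (fun m => A (fun n => f (n, m)) s.1) s.2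
  rw [opF_apply B]
  have : (fun n => B (fun m => f (n, m)) s.2) =
      ∑ m', B (Pi.single m' 1) s.2 • (fun n => f (n, m')) := by
    ext n
    rw [opF_apply B, Finset.sum_apply]
    exact Finset.sum_congr rfl fun m' _ => mul_comm _ _
  rw [this, map_sum, Finset.sum_apply]
  refine Finset.sum_congr rfl fun m' _ => ?_
  rw [map_smul, Pi.smul_apply, smul_eq_mul, mul_comm]

theorem hamiltonian_eq (R : RMat N) : hamiltonian R = onB (hamB R) + onF (hamF R) := by
  have hbb : ∀ a c : Idx N, onBHom N (xiB a) * onBHom N (xiB c) -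
      onBHom N (xiB c) * onBHom N (xiB a) = (I * (Omega N a c : ℂ)) • 1 := by
    intro a c
    have := congrArg (onBHom N) (xiB_comm a c)
    rwa [map_sub, map_mul, map_mul, map_smul, map_one] at this
  have hφφ : ∀ a c : Idx N, onFHom N (xiF a) * onFHom N (xiF c) +
      onFHom N (xiF c) * onFHom N (xiF a) = ((metric N a c : ℝ) : ℂ) • 1 := by
    intro a c
    have := congrArg (onFHom N) (xiF_anticomm a c)
    rwa [map_add, map_mul, map_mul, map_smul, map_one] at this
  refine (supercharge_sq (fun a α => onB_onF_comm (xiB a) (xiF α)) hbb hφφ Omega_transpose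
    R).trans ?_
  have h1 : onB (hamB R) = (1 / 2 : ℂ) • ∑ a, ∑ c, ((R.transpose * metric N * R) a c : ℂ) •
      (onBHom N (xiB a) * onBHom N (xiB c)) := by
    change onBHom N (hamB R) = _
    rw [hamB, quad, map_smul, map_sum]
    simp only [map_sum, map_smul, map_mul]
    rfl
  have h2 : onF (hamF R) = (I / 2 : ℂ) • ∑ α, ∑ γ, ((R * Omega N * R.transpose) α γ : ℂ) •
      (onFHom N (xiF α) * onFHom N (xiF γ)) := by
    change onFHom N (hamF R) = _
    rw [hamF, quad, map_smul, map_sum]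
    simp only [map_sum, map_smul, map_mul]
    rfl
  rw [h1, h2]
  rfl

end Hamiltonian

/-! ### Ladder operators on the form domain -/

section Form

variable {S : Type}

theorem FormAdj.add {w : S → ℝ} {A B A' B' : Op S} (h : FormAdj w A B) (h' : FormAdj w A' B') :
    FormAdj w (A + A') (B + B') := by
  refine ⟨h.cont.add h'.cont, fun F hF => ?_, fun F G hF hG => ?_⟩
  · refine Summable.of_nonneg_of_le (fun _ => sq_nonneg _) (fun x => ?_)
      (((h.reg F hF).add (h'.reg F hF)).mul_left 2)
    have h1 := norm_add_le (B (F x.1) x.2) (B' (F x.1) x.2)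
    have h2 : ‖(B + B') (F x.1) x.2‖ ≤ ‖B (F x.1) x.2‖ + ‖B' (F x.1) x.2‖ := h1
    nlinarith [sq_nonneg (‖B (F x.1) x.2‖ - ‖B' (F x.1) x.2‖), norm_nonneg ((B + B') (F x.1) x.2),
      norm_nonneg (B (F x.1) x.2), norm_nonneg (B' (F x.1) x.2)]
  · have h1 := (h.adj F G hF hG).add (h'.adj F G hF hG)
    rw [← (summable_mul_of_sq (h.reg F hF) hG).tsum_add
      (summable_mul_of_sq (h'.reg F hF) hG)] at h1
    convert h1 using 2 with x
    · simp only [LinearMap.add_apply, Pi.add_apply, mul_add]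
    · simp only [LinearMap.add_apply, Pi.add_apply, add_mul, map_add]

theorem FormAdj.smul {w : S → ℝ} {A B : Op S} (z : ℂ) (h : FormAdj w A B) :
    FormAdj w (z • A) ((starRingEnd ℂ) z • B) := by
  refine ⟨h.cont.const_smul z, fun F hF => ?_, fun F G hF hG => ?_⟩
  · refine (summable_congr fun x => ?_).1 ((h.reg F hF).mul_left (‖z‖ ^ 2))
    rw [LinearMap.smul_apply, Pi.smul_apply, smul_eq_mul, norm_mul, mul_pow, RCLike.norm_conj]
  · have h1 := (h.adj F G hF hG).mul_left z
    rw [← tsum_mul_left] at h1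
    have h2 : ∀ x : _ × S, (starRingEnd ℂ) (((starRingEnd ℂ) z • B) (F x.1) x.2) * G x.1 x.2 =
        z * ((starRingEnd ℂ) (B (F x.1) x.2) * G x.1 x.2) := by
      intro x
      rw [LinearMap.smul_apply, Pi.smul_apply, smul_eq_mul, map_mul, Complex.conj_conj, mul_assoc]
    rw [tsum_congr h2]
    refine (hasSum_congr fun x => ?_).1 h1
    rw [LinearMap.smul_apply, Pi.smul_apply, smul_eq_mul]
    ring

theorem FormAdj.zero (w : S → ℝ) : FormAdj w (0 : Op S) 0 := by
  refine ⟨continuous_const, fun F _ => ?_, fun F G _ _ => ?_⟩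
  · simp
  · simp

theorem FormAdj.sum {w : S → ℝ} {κ : Type} (s : Finset κ) {A B : κ → Op S}
    (h : ∀ k, FormAdj w (A k) (B k)) : FormAdj w (∑ k ∈ s, A k) (∑ k ∈ s, B k) := by
  classical
  induction s using Finset.induction_on with
  | empty => exact FormAdj.zero w
  | insert k s hk ih => rw [Finset.sum_insert hk, Finset.sum_insert hk]; exact (h k).add ih

end Form

/-! ### Bosonic ladder operators and the number-operator weight. -/

section Ladder

variable {N : ℕ}

/-- The total occupation number. -/
def deg (n : OccB N) : ℝ := ∑ i, (n i : ℝ)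

theorem deg_nonneg (n : OccB N) : 0 ≤ deg n := Finset.sum_nonneg fun _ _ => Nat.cast_nonneg _

theorem le_deg (n : OccB N) (i : Fin N) : (n i : ℝ) ≤ deg n :=
  Finset.single_le_sum (f := fun i => (n i : ℝ)) (fun _ _ => Nat.cast_nonneg _) (Finset.mem_univ i)

/-- The weight of the form domain. -/
def wt (n : OccB N) : ℝ := deg n + 1

theorem one_le_wt (n : OccB N) : 1 ≤ wt n := by
  have := deg_nonneg n; unfold wt; linarith

theorem deg_update (n : OccB N) (i : Fin N) (x : ℕ) :
    deg (Function.update n i x) = deg n + x - n i := by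
  have h1 : deg n = n i + ∑ k ∈ Finset.univ.erase i, (n k : ℝ) :=
    (Finset.add_sum_erase _ (fun k => (n k : ℝ)) (Finset.mem_univ i)).symm
  have h2 : deg (Function.update n i x) =
      (Function.update n i x i : ℕ) + ∑ k ∈ Finset.univ.erase i, (Function.update n i x k : ℝ) :=
    (Finset.add_sum_erase _ (fun k => (Function.update n i x k : ℝ)) (Finset.mem_univ i)).symm
  have h3 : ∑ k ∈ Finset.univ.erase i, ((Function.update n i x k : ℕ) : ℝ) =
      ∑ k ∈ Finset.univ.erase i, (n k : ℝ) :=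
    Finset.sum_congr rfl fun k hk => by rw [Function.update_of_ne (Finset.ne_of_mem_erase hk)]
  rw [h2, h1, h3, Function.update_self]
  ring

/-- Raising the occupation number of mode `i`. -/
def up (i : Fin N) (n : OccB N) : OccB N := Function.update n i (n i + 1)

/-- Lowering the occupation number of mode `i`. -/
def down (i : Fin N) (n : OccB N) : OccB N := Function.update n i (n i - 1)

theorem down_up (i : Fin N) (n : OccB N) : down i (up i n) = n := by
  simp [down, up]

theorem up_down {i : Fin N} {n : OccB N} (h : n i ≠ 0) : up i (down i n) = n := by
  have : n i - 1 + 1 = n i := by omega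
  simp [down, up, this]

theorem up_self (i : Fin N) (n : OccB N) : up i n i = n i + 1 := by simp [up]

theorem up_injective (i : Fin N) : Function.Injective (up i) :=
  Function.LeftInverse.injective (down_up i)

theorem deg_up (i : Fin N) (n : OccB N) : deg (up i n) = deg n + 1 := by
  rw [up, deg_update]; push_cast; ring

theorem deg_down {i : Fin N} {n : OccB N} (h : n i ≠ 0) : deg (down i n) = deg n - 1 := by
  have := deg_up i (down i n)
  rw [up_down h] at this
  linarith

theorem bAnn_up (i : Fin N) (f : OccB N → ℂ) (n : OccB N) :
    bAnn i f n = (Real.sqrt (n i + 1) : ℂ) * f (up i n) := rfl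

theorem bCre_up (i : Fin N) (f : OccB N → ℂ) (n : OccB N) :
    bCre i f (up i n) = (Real.sqrt (n i + 1) : ℂ) * f n := by
  rw [bCre_apply, up_self, Nat.add_sub_cancel]
  congr 2
  · push_cast; rfl
  · simp [up]

theorem bCre_eq_zero {i : Fin N} (f : OccB N → ℂ) {n : OccB N} (h : n i = 0) :
    bCre i f n = 0 := by
  rw [bCre_apply, h]; simp

/-- Reindexing a sum over occupation numbers along `up`. -/
theorem hasSum_up_iff {ι α : Type} [AddCommMonoid α] [TopologicalSpace α] (i : Fin N)
    {f : ι × OccB N → α} (hf : ∀ x, x.2 i = 0 → f x = 0) {a : α} :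
    HasSum (fun x : ι × OccB N => f (x.1, up i x.2)) a ↔ HasSum f a := by
  have hinj : Function.Injective (fun x : ι × OccB N => (x.1, up i x.2)) := by
    rintro ⟨a, b⟩ ⟨c, d⟩ h
    simp only [Prod.mk.injEq] at h ⊢
    exact ⟨h.1, up_injective i h.2⟩
  refine hinj.hasSum_iff (f := f) fun x hx => hf x ?_
  by_contra h
  exact hx ⟨(x.1, down i x.2), by simp [up_down h]⟩

theorem summable_up_iff {ι α : Type} [AddCommMonoid α] [TopologicalSpace α] (i : Fin N)
    {f : ι × OccB N → α} (hf : ∀ x, x.2 i = 0 → f x = 0) :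
    Summable (fun x : ι × OccB N => f (x.1, up i x.2)) ↔ Summable f :=
  ⟨fun ⟨a, ha⟩ => ⟨a, (hasSum_up_iff i hf).1 ha⟩, fun ⟨a, ha⟩ => ⟨a, (hasSum_up_iff i hf).2 ha⟩⟩

theorem summable_occ {ι : Type} {F : ι → OccB N → ℂ}
    (hF : Summable (fun x : ι × OccB N => wt x.2 * ‖F x.1 x.2‖ ^ 2)) (i : Fin N) :
    Summable (fun x : ι × OccB N => (x.2 i : ℝ) * ‖F x.1 x.2‖ ^ 2) ∧
    Summable (fun x : ι × OccB N => ((x.2 i : ℝ) + 1) * ‖F x.1 x.2‖ ^ 2) := by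
  constructor
  · refine Summable.of_nonneg_of_le (fun _ => by positivity) (fun x => ?_) hF
    have := le_deg x.2 i
    exact mul_le_mul_of_nonneg_right (by unfold wt; linarith) (sq_nonneg _)
  · refine Summable.of_nonneg_of_le (fun _ => by positivity) (fun x => ?_) hF
    have := le_deg x.2 i
    exact mul_le_mul_of_nonneg_right (by unfold wt; linarith) (sq_nonneg _)

theorem norm_bAnn_sq (i : Fin N) (f : OccB N → ℂ) (n : OccB N) :
    ‖bAnn i f n‖ ^ 2 = ((up i n i : ℕ) : ℝ) * ‖f (up i n)‖ ^ 2 := by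
  rw [bAnn_up, norm_mul, mul_pow, Complex.norm_real, Real.norm_eq_abs, sq_abs,
    Real.sq_sqrt (by positivity), up_self]
  push_cast; rfl

theorem norm_bCre_sq (i : Fin N) (f : OccB N → ℂ) (n : OccB N) :
    ‖bCre i f (up i n)‖ ^ 2 = ((n i : ℝ) + 1) * ‖f n‖ ^ 2 := by
  rw [bCre_up, norm_mul, mul_pow, Complex.norm_real, Real.norm_eq_abs, sq_abs,
    Real.sq_sqrt (by positivity)]

theorem summable_bAnn {ι : Type} {F : ι → OccB N → ℂ}
    (hF : Summable (fun x : ι × OccB N => wt x.2 * ‖F x.1 x.2‖ ^ 2)) (i : Fin N) :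
    Summable (fun x : ι × OccB N => ‖bAnn i (F x.1) x.2‖ ^ 2) := by
  simp only [norm_bAnn_sq]
  exact (summable_up_iff i (f := fun x : ι × OccB N => (x.2 i : ℝ) * ‖F x.1 x.2‖ ^ 2)
    (fun x hx => by simp [hx])).2 (summable_occ hF i).1

theorem summable_bCre {ι : Type} {F : ι → OccB N → ℂ}
    (hF : Summable (fun x : ι × OccB N => wt x.2 * ‖F x.1 x.2‖ ^ 2)) (i : Fin N) :
    Summable (fun x : ι × OccB N => ‖bCre i (F x.1) x.2‖ ^ 2) := by
  refine (summable_up_iff i (fun x hx => by simp [bCre_eq_zero _ hx])).1 ?_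
  simp only [norm_bCre_sq]
  exact (summable_occ hF i).2

/-- After reindexing by n ↦ n + e_i the two sums agree term by term. Absolute convergence is read
off from the side where the ladder operator acts on F, the only argument assumed to lie in the form
domain. -/
theorem formAdj_bAnn (i : Fin N) : FormAdj wt (bAnn i) (bCre i) := by
  refine ⟨continuous_pi fun n => ?_, fun F hF => summable_bCre hF i, fun F G hF hG => ?_⟩
  · simp only [bAnn_apply]; fun_prop
  · have h := (summable_mul_of_sq (summable_bCre hF i) hG).hasSum
    refine (hasSum_congr fun x => ?_).1 ((hasSum_up_iff i
      (fun x hx => by simp [bCre_eq_zero _ hx])).2 h)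
    rw [bCre_up, bAnn_up, map_mul, Complex.conj_ofReal]
    ring

theorem formAdj_bCre (i : Fin N) : FormAdj wt (bCre i) (bAnn i) := by
  refine ⟨continuous_pi fun n => ?_, fun F hF => summable_bAnn hF i, fun F G hF hG => ?_⟩
  · simp only [bCre_apply]; fun_prop
  · have h := (summable_mul_of_sq (summable_bAnn hF i) hG).hasSum
    refine (hasSum_up_iff i (fun x hx => by simp [bCre_eq_zero _ hx])).1
      ((hasSum_congr fun x => ?_).1 h)
    rw [bCre_up, bAnn_up, map_mul, Complex.conj_ofReal]
    ring

theorem formAdj_xiB (a : Idx N) : FormAdj wt (xiB a) (xiB a) := by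
  rcases a with i | i
  · have h := ((formAdj_bCre i).add (formAdj_bAnn i)).smul ((1 / Real.sqrt 2 : ℝ) : ℂ)
    rw [Complex.conj_ofReal, add_comm (bAnn i)] at h
    exact h
  · have h := ((formAdj_bCre i).add ((formAdj_bAnn i).smul (-1))).smul
      (Complex.I * ((1 / Real.sqrt 2 : ℝ) : ℂ))
    have h1 : (Complex.I * ((1 / Real.sqrt 2 : ℝ) : ℂ)) • (bCre i + (-1 : ℂ) • bAnn i) =
        xiB (Sum.inr i) := by
      rw [xiB]; module
    have h2 : (starRingEnd ℂ) (Complex.I * ((1 / Real.sqrt 2 : ℝ) : ℂ)) •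
        (bAnn i + (starRingEnd ℂ) (-1) • bCre i) = xiB (Sum.inr i) := by
      rw [xiB, map_mul, Complex.conj_ofReal, Complex.conj_I, map_neg, map_one]; module
    rwa [h1, h2] at h

/-- The sum of the squares of all quadratures is `2 N̂ + N`. -/
theorem sum_norm_xiB_sq (f : OccB N → ℂ) (n : OccB N) :
    ∑ a, ‖xiB a f n‖ ^ 2 = ∑ i, (‖bAnn i f n‖ ^ 2 + ‖bCre i f n‖ ^ 2) := by
  rw [Fintype.sum_sum_type, ← Finset.sum_add_distrib]
  refine Finset.sum_congr rfl fun i _ => ?_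
  have h1 : xiB (Sum.inl i) f n = ((1 / Real.sqrt 2 : ℝ) : ℂ) * (bCre i f n + bAnn i f n) := rfl
  have h2 : xiB (Sum.inr i) f n =
      (I * ((1 / Real.sqrt 2 : ℝ) : ℂ)) * (bCre i f n - bAnn i f n) := rfl
  have h3 : ‖((1 / Real.sqrt 2 : ℝ) : ℂ)‖ ^ 2 = 1 / 2 := by
    rw [Complex.norm_real, Real.norm_eq_abs, sq_abs, div_pow, Real.sq_sqrt (by norm_num)]
    norm_num
  have h4 := parallelogram_law_with_norm ℝ (bCre i f n) (bAnn i f n)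
  rw [h1, h2, norm_mul, norm_mul, norm_mul, Complex.norm_I, one_mul, mul_pow, mul_pow, h3]
  nlinarith [h4]

theorem summable_punit_iff {S : Type} (g : S → ℝ) :
    Summable (fun x : Unit × S => g x.2) ↔ Summable g :=
  (Equiv.punitProd S).summable_iff (f := g)

theorem summable_occ_single {f : OccB N → ℂ} (hf : Summable (fun n => wt n * ‖f n‖ ^ 2))
    (i : Fin N) : Summable (fun n : OccB N => (n i : ℝ) * ‖f n‖ ^ 2) := by
  have h := (summable_punit_iff (fun n => wt n * ‖f n‖ ^ 2)).2 hf
  exact (summable_punit_iff (fun n : OccB N => (n i : ℝ) * ‖f n‖ ^ 2)).1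
    (summable_occ (F := fun _ : Unit => f) h i).1

theorem summable_bCre_single {f : OccB N → ℂ} (hf : Summable (fun n => wt n * ‖f n‖ ^ 2))
    (i : Fin N) : Summable (fun n : OccB N => ‖bCre i f n‖ ^ 2) := by
  have h := (summable_punit_iff (fun n => wt n * ‖f n‖ ^ 2)).2 hf
  exact (summable_punit_iff (fun n : OccB N => ‖bCre i f n‖ ^ 2)).1
    (summable_bCre (F := fun _ : Unit => f) h i)

theorem hasSum_bAnn_single {f : OccB N → ℂ} (hf : Summable (fun n => wt n * ‖f n‖ ^ 2))
    (i : Fin N) :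
    HasSum (fun n : OccB N => ‖bAnn i f n‖ ^ 2) (∑' n : OccB N, (n i : ℝ) * ‖f n‖ ^ 2) := by
  simp only [norm_bAnn_sq]
  refine ((up_injective i).hasSum_iff (f := fun n : OccB N => (n i : ℝ) * ‖f n‖ ^ 2)
    fun x hx => ?_).2 (summable_occ_single hf i).hasSum
  have : x i = 0 := by
    by_contra h
    exact hx ⟨down i x, up_down h⟩
  simp [this]

theorem hasSum_deg {f : OccB N → ℂ} (hf : Summable (fun n => wt n * ‖f n‖ ^ 2)) :
    HasSum (fun n => deg n * ‖f n‖ ^ 2) (∑ i, ∑' n : OccB N, (n i : ℝ) * ‖f n‖ ^ 2) := by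
  have := hasSum_sum (s := Finset.univ) fun i _ => (summable_occ_single hf i).hasSum
  refine (hasSum_congr fun n => ?_).1 this
  rw [deg, Finset.sum_mul]

theorem hasSum_xiB_sq {f : OccB N → ℂ} (hf : Summable (fun n => wt n * ‖f n‖ ^ 2)) :
    HasSum (fun n => ∑ a, ‖xiB a f n‖ ^ 2)
      (∑ i, (∑' n : OccB N, (n i : ℝ) * ‖f n‖ ^ 2 + ∑' n, ‖bCre i f n‖ ^ 2)) := by
  refine (hasSum_congr fun n => (sum_norm_xiB_sq f n).symm).1 ?_
  exact hasSum_sum fun i _ => (hasSum_bAnn_single hf i).add (summable_bCre_single hf i).hasSum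

/-- The annihilation parts of the quadratures already add up to the mean occupation number; the
creation parts are dropped. This is the origin of the coercivity of the bosonic Hamiltonian. -/
theorem sum_deg_le {f : OccB N → ℂ} (hf : Summable (fun n => wt n * ‖f n‖ ^ 2)) :
    ∑' n, deg n * ‖f n‖ ^ 2 ≤ ∑' n, ∑ a, ‖xiB a f n‖ ^ 2 := by
  rw [(hasSum_deg hf).tsum_eq, (hasSum_xiB_sq hf).tsum_eq]
  exact Finset.sum_le_sum fun i _ => le_add_of_nonneg_right (tsum_nonneg fun _ => sq_nonneg _)

end Ladder

/-! ### The bosonic Hamiltonian has an eigenbasis -/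

section Compact

variable {S : Type}

/-- Multiplication by a function vanishing at infinity is compact. -/
theorem isCompactOperator_mul {v : S → ℂ} {D : Hilb S →L[ℂ] Hilb S}
    (hD : ∀ f s, (D f : S → ℂ) s = v s * f s) (hv : ∀ ε : ℝ, 0 < ε → {s | ε ≤ ‖v s‖}.Finite) :
    IsCompactOperator D := by
  classical
  let F : Finset S → Hilb S →L[ℂ] Hilb S := fun s =>
    ∑ t ∈ s, (ContinuousLinearMap.toSpanSingleton ℂ (v t • ket t)) ∘L (innerSL ℂ (ket t))
  have hF : ∀ (s : Finset S) f t, (F s f : S → ℂ) t = if t ∈ s then v t * f t else 0 := by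
    intro s f t
    have h1 : F s f = ∑ r ∈ s, (f r * v r) • ket r := by
      simp only [F, _root_.sum_apply, ContinuousLinearMap.comp_apply,
        innerSL_apply_apply, inner_ket_left, ContinuousLinearMap.toSpanSingleton_apply, smul_smul]
    rw [h1, lp.coeFn_sum, Finset.sum_apply]
    simp only [lp.coeFn_smul, Pi.smul_apply, ket_apply, smul_eq_mul, mul_ite, mul_one, mul_zero]
    rw [Finset.sum_ite_eq]
    split_ifs <;> ring
  have hcomp : ∀ s, IsCompactOperator (F s) := by
    intro s
    induction s using Finset.induction_on with
    | empty => exact isCompactOperator_zero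
    | insert t s ht ih =>
      have : F (insert t s) = (ContinuousLinearMap.toSpanSingleton ℂ (v t • ket t)) ∘L
          (innerSL ℂ (ket t)) + F s := Finset.sum_insert ht
      rw [this]
      refine IsCompactOperator.add ?_ ih
      exact (isCompactOperator_of_locallyCompactSpace_rng
        (ContinuousLinearMap.toSpanSingleton ℂ (v t • ket t))).comp_clm (innerSL ℂ (ket t))
  -- Finite-rank truncations converge in norm, because outside a large enough finite set the
  -- multiplier is below ε/2.
  refine isCompactOperator_of_tendsto (F := F) (l := atTop) ?_ (Eventually.of_forall hcomp)
  rw [Metric.tendsto_nhds]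
  intro ε hε
  filter_upwards [eventually_ge_atTop (hv (ε / 2) (by positivity)).toFinset] with s hs
  have hbd : ‖F s - D‖ ≤ ε / 2 := by
    refine ContinuousLinearMap.opNorm_le_bound _ (by positivity) fun f => ?_
    refine abs_le_of_sq_le_sq' ?_ (by positivity) |>.2
    have h1 := hasSum_norm_sq ((F s - D) f)
    have h2 := (hasSum_norm_sq f).mul_left ((ε / 2) ^ 2)
    rw [mul_pow]
    refine hasSum_le (fun t => ?_) h1 h2
    have h3 : ((F s - D) f : S → ℂ) t = (F s f : S → ℂ) t - (D f : S → ℂ) t := rfl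
    rw [h3, hF, hD]
    split_ifs with ht
    · rw [sub_self, norm_zero, zero_pow two_ne_zero]; positivity
    · rw [zero_sub, norm_neg, norm_mul, mul_pow]
      have : ‖v t‖ ≤ ε / 2 := by
        by_contra hlt
        exact ht (hs ((hv (ε / 2) (by positivity)).mem_toFinset.2 (not_le.1 hlt).le))
      gcongr
  rw [dist_eq_norm]
  linarith

end Compact

/-! ### Rescaling by the weight and the compact resolvent. -/

section Spectral

variable {N : ℕ}

theorem wt_pos (n : OccB N) : 0 < wt n := lt_of_lt_of_le one_pos (one_le_wt n)

/-- The inverse square root of the weight. -/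
def ivw (n : OccB N) : ℂ := ((1 / Real.sqrt (wt n) : ℝ) : ℂ)

theorem norm_ivw_sq (n : OccB N) : ‖ivw n‖ ^ 2 = 1 / wt n := by
  rw [ivw, Complex.norm_real, Real.norm_eq_abs, sq_abs, div_pow, Real.sq_sqrt (wt_pos n).le,
    one_pow]

theorem ivw_ne_zero (n : OccB N) : ivw n ≠ 0 := by
  have := norm_ivw_sq n
  intro h
  rw [h, norm_zero] at this
  have h2 := wt_pos n
  have : (0 : ℝ) < 1 / wt n := by positivity
  linarith [this, ‹0 ^ 2 = 1 / wt n›, zero_pow (two_ne_zero) (M₀ := ℝ)]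

theorem norm_ivw_le (n : OccB N) : ‖ivw n‖ ≤ 1 := by
  refine abs_le_of_sq_le_sq' ?_ zero_le_one |>.2
  rw [norm_ivw_sq, one_pow, div_le_one (wt_pos n)]
  exact one_le_wt n

theorem conj_ivw (n : OccB N) : (starRingEnd ℂ) (ivw n) = ivw n := Complex.conj_ofReal _

/-- The coefficient √(n_i + 1) is dominated by the square root of the weight at the raised label, so
the rescaled operator is a weighted shift with coefficients at most 1. -/
theorem bddOp_bAnn (i : Fin N) : BddOp (bAnn i * mulOp ivw) := by
  refine bddOp_of_shift (m := fun n => (Real.sqrt (n i + 1) : ℂ) * ivw (up i n)) (σ := up i)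
    (C := 1) (fun f n => ?_) (fun n => ?_) (up_injective i).injOn
  · rw [Module.End.mul_apply, bAnn_up, mulOp_apply, mul_assoc]
  · refine abs_le_of_sq_le_sq' ?_ zero_le_one |>.2
    rw [norm_mul, mul_pow, Complex.norm_real, Real.norm_eq_abs, sq_abs,
      Real.sq_sqrt (by positivity), norm_ivw_sq, one_pow, mul_one_div, div_le_one (wt_pos _), wt,
      deg_up]
    linarith [le_deg n i]

theorem bddOp_bCre (i : Fin N) : BddOp (bCre i * mulOp ivw) := by
  refine bddOp_of_shift (m := fun n => (Real.sqrt (n i) : ℂ) * ivw (down i n)) (σ := down i)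
    (C := 1) (fun f n => ?_) (fun n => ?_) ?_
  · rw [Module.End.mul_apply, bCre_apply, mulOp_apply, mul_assoc]; rfl
  · by_cases h : n i = 0
    · simp [h]
    refine abs_le_of_sq_le_sq' ?_ zero_le_one |>.2
    rw [norm_mul, mul_pow, Complex.norm_real, Real.norm_eq_abs, sq_abs,
      Real.sq_sqrt (by positivity), norm_ivw_sq, one_pow, mul_one_div, div_le_one (wt_pos _), wt,
      deg_down h]
    linarith [le_deg n i]
  · intro n hn n' hn' h
    have h1 : n i ≠ 0 := by rintro h0; exact hn (by simp [h0])
    have h2 : n' i ≠ 0 := by rintro h0; exact hn' (by simp [h0])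
    rw [← up_down h1, ← up_down h2, h]

theorem bddOp_xiB (a : Idx N) : BddOp (xiB a * mulOp ivw) := by
  rcases a with i | i
  · have := ((bddOp_bCre i).add (bddOp_bAnn i)).smul ((1 / Real.sqrt 2 : ℝ) : ℂ)
    exact this
  · have := ((bddOp_bCre i).add ((bddOp_bAnn i).smul (-1))).smul
      (Complex.I * ((1 / Real.sqrt 2 : ℝ) : ℂ))
    convert this using 1
    refine LinearMap.ext fun f => funext fun n => ?_
    change (Complex.I * ((1 / Real.sqrt 2 : ℝ) : ℂ)) * (bCre i (mulOp ivw f) n -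
      bAnn i (mulOp ivw f) n) = (Complex.I * ((1 / Real.sqrt 2 : ℝ) : ℂ)) *
      (bCre i (mulOp ivw f) n + (-1) * bAnn i (mulOp ivw f) n)
    ring

theorem finite_deg_le (N : ℕ) (K : ℝ) : {n : OccB N | deg n ≤ K}.Finite := by
  refine (Set.Finite.pi' (t := fun _ : Fin N => Set.Iic ⌊K⌋₊)
    (fun i => Set.finite_Iic _)).subset fun n hn i => ?_
  exact Nat.le_floor ((le_deg n i).trans hn)

/-- The combination `R_{αa} ξ^a` of quadratures. -/
def rotQuad (R : RMat N) (α : Idx N) : Op (OccB N) := ∑ a, (R α a : ℂ) • xiB a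

theorem formAdj_rotQuad (R : RMat N) (α : Idx N) :
    FormAdj wt (rotQuad R α) (rotQuad R α) := by
  refine FormAdj.sum _ fun a => ?_
  have := (formAdj_xiB a).smul (R α a : ℂ)
  rwa [Complex.conj_ofReal] at this

theorem sum_sq_eq_quad {A : Type*} [Ring A] [Algebra ℂ A] (ξ : Idx N → A) (R : RMat N) :
    ∑ α, (∑ a, (R α a : ℂ) • ξ a) * (∑ a, (R α a : ℂ) • ξ a) =
      ∑ a, ∑ b, ((R.transpose * R) a b : ℂ) • (ξ a * ξ b) := by
  simp only [Finset.sum_mul_sum, smul_mul_smul_comm]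
  rw [Finset.sum_comm]
  refine Finset.sum_congr rfl fun a _ => ?_
  rw [Finset.sum_comm]
  refine Finset.sum_congr rfl fun b _ => ?_
  rw [← Finset.sum_smul]
  congr 1
  rw [Matrix.mul_apply, Complex.ofReal_sum]
  exact Finset.sum_congr rfl fun α _ => by rw [Matrix.transpose_apply]; push_cast; rfl

/-- Because the metric is the identity, h^b = RᵀR, so twice the Hamiltonian is a sum of squares of
symmetric operators. -/
theorem hamB_eq (R : RMat N) :
    hamB R = (1 / 2 : ℂ) • ∑ α, rotQuad R α * rotQuad R α := by
  have h := sum_sq_eq_quad (xiB (N := N)) R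
  rw [hamB, quad, hB, metric, Matrix.mul_one]
  exact congrArg _ h.symm

/-- Let D be multiplication by wt^{-1/2}. The bounded operator B below is D(2H + 1)D, defined as a
quadratic form so that no domains enter. It is coercive, hence invertible, and D B⁻¹ D plays the
role of (2H + 1)⁻¹. It is symmetric, and compact because D is, so its eigenvectors form a basis; an
eigenvalue μ corresponds to the energy (1/μ - 1)/2. The final bound, mean weight at most linear in
the energy, feeds all later summability. -/
theorem exists_eigenbasis_hamB {R : RMat N} (hR : IsUnit R.det) :
    ∃ (ι : Type) (b : HilbertBasis ι ℂ (Hilb (OccB N))) (E : ι → ℝ) (C : ℝ), 0 < C ∧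
      (∀ k, hamB R (b k : OccB N → ℂ) = (E k : ℂ) • (b k : OccB N → ℂ)) ∧
      ∀ k, Summable (fun n => wt n * ‖b k n‖ ^ 2) ∧
        ∑' n, wt n * ‖b k n‖ ^ 2 ≤ C * (2 * E k + 1) := by
  choose Ξ hΞ using bddOp_xiB (N := N)
  obtain ⟨D, hD⟩ := bddOp_mulOp (p := ivw (N := N)) norm_ivw_le
  have hDs : ∀ f n, (D f : OccB N → ℂ) n = ivw n * f n := fun f n => by rw [hD]; rfl
  set C : Idx N → Hilb (OccB N) →L[ℂ] Hilb (OccB N) := fun α => ∑ a, (R α a : ℂ) • Ξ a with hC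
  have hCΞ : ∀ α f, (C α f : OccB N → ℂ) = rotQuad R α (D f) := by
    intro α f
    rw [hC, rotQuad, LinearMap.sum_apply]
    simp only [_root_.sum_apply, _root_.smul_apply, LinearMap.smul_apply]
    rw [lp.coeFn_sum]
    simp only [lp.coeFn_smul, hΞ, hD]
    rfl
  -- symmetry of the multiplication operator
  have hDsym : ∀ f g, inner ℂ (D f) g = inner ℂ f (D g) := by
    intro f g
    refine (hasSum_inner_coe (D f) g).unique ((hasSum_congr fun n => ?_).1
      (hasSum_inner_coe f (D g)))
    rw [hDs, hDs, map_mul, conj_ivw]; ring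
  -- regularity of the range of the multiplication operator
  have hwD : ∀ f : Hilb (OccB N), HasSum (fun n => wt n * ‖D f n‖ ^ 2) (‖f‖ ^ 2) := by
    intro f
    refine (hasSum_congr fun n => ?_).1 (hasSum_norm_sq f)
    rw [hDs, norm_mul, mul_pow, norm_ivw_sq]
    have := (wt_pos n).ne'
    field_simp
  -- coercivity
  set Q : RMat N := R⁻¹ with hQ
  -- Invertibility of R enters here: the quadratures are recovered from the rotated ones, at the
  -- cost of the squared Hilbert-Schmidt norm K of R⁻¹.
  have hΞC : ∀ a f, Ξ a f = ∑ α, (Q a α : ℂ) • C α f := by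
    intro a f
    have h1 : ∀ c, ∑ α, (Q a α : ℂ) * (R α c : ℂ) = if a = c then 1 else 0 := by
      intro c
      have h2 := congrFun (congrFun (Matrix.nonsing_inv_mul R hR) a) c
      rw [Matrix.mul_apply, Matrix.one_apply] at h2
      rw [← hQ] at h2
      have h3 := congrArg Complex.ofReal h2
      rw [Complex.ofReal_sum] at h3
      simp only [Complex.ofReal_mul] at h3
      rw [h3]
      split_ifs <;> simp
    simp only [hC, _root_.sum_apply, _root_.smul_apply, Finset.smul_sum, smul_smul]
    rw [Finset.sum_comm]
    simp only [← Finset.sum_smul, h1, ite_smul, one_smul, zero_smul]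
    simp
  set K : ℝ := ∑ a, ∑ α, (Q a α) ^ 2 with hK
  have hK0 : 0 ≤ K := Finset.sum_nonneg fun _ _ => Finset.sum_nonneg fun _ _ => sq_nonneg _
  have hΞle : ∀ f, ∑ a, ‖Ξ a f‖ ^ 2 ≤ K * ∑ α, ‖C α f‖ ^ 2 := by
    intro f
    rw [hK, Finset.sum_mul]
    refine Finset.sum_le_sum fun a _ => ?_
    have h1 : ‖Ξ a f‖ ≤ ∑ α, |Q a α| * ‖C α f‖ := by
      rw [hΞC]
      refine (norm_sum_le _ _).trans (Finset.sum_le_sum fun α _ => ?_)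
      rw [norm_smul, Complex.norm_real, Real.norm_eq_abs]
    calc ‖Ξ a f‖ ^ 2 ≤ (∑ α, |Q a α| * ‖C α f‖) ^ 2 := by gcongr
      _ ≤ (∑ α, |Q a α| ^ 2) * ∑ α, ‖C α f‖ ^ 2 := Finset.sum_mul_sq_le_sq_mul_sq _ _ _
      _ = _ := by simp only [sq_abs]
  -- The norm of f is the weighted norm of D f. The weight is occupation number plus one: the first
  -- is controlled by the quadratures, the second is ‖D f‖².
  have hcoer : ∀ f, ‖f‖ ^ 2 ≤ (K + 1) * (∑ α, ‖C α f‖ ^ 2 + ‖D f‖ ^ 2) := by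
    intro f
    have h1 := sum_deg_le (hwD f).summable
    have h2 : ∑' n, ∑ a, ‖xiB a (D f) n‖ ^ 2 = ∑ a, ‖Ξ a f‖ ^ 2 := by
      refine (hasSum_sum fun a _ => ?_).tsum_eq
      have := hasSum_norm_sq (Ξ a f)
      rw [hΞ] at this
      rw [hD]
      exact this
    have h3 : ‖f‖ ^ 2 = ∑' n, deg n * ‖D f n‖ ^ 2 + ‖D f‖ ^ 2 := by
      refine (hwD f).unique ?_
      refine (hasSum_congr fun n => ?_).1
        ((hasSum_deg (hwD f).summable).summable.hasSum.add (hasSum_norm_sq (D f)))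
      rw [wt]; ring
    have h4 := hΞle f
    rw [h2] at h1
    have h5 : 0 ≤ ∑ α, ‖C α f‖ ^ 2 := Finset.sum_nonneg fun _ _ => sq_nonneg _
    nlinarith [sq_nonneg ‖D f‖, mul_nonneg hK0 (sq_nonneg ‖D f‖)]
  -- the rescaled Hamiltonian
  set B : Hilb (OccB N) →L[ℂ] Hilb (OccB N) :=
    ∑ α, (ContinuousLinearMap.adjoint (C α)) ∘L C α + D ∘L D with hBdef
  have hBin : ∀ f g, inner ℂ f (B g) = ∑ α, inner ℂ (C α f) (C α g) + inner ℂ (D f) (D g) := by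
    intro f g
    rw [hBdef, _root_.add_apply, _root_.sum_apply, inner_add_right,
      inner_sum, hDsym]
    simp only [ContinuousLinearMap.comp_apply, ContinuousLinearMap.adjoint_inner_right]
  have hBsym : ∀ f g, inner ℂ (B f) g = inner ℂ f (B g) := by
    intro f g
    rw [← inner_conj_symm, hBin, hBin, map_add, map_sum]
    simp only [inner_conj_symm]
  have hBpos : ∀ f, inner ℂ f (B f) = ((∑ α, ‖C α f‖ ^ 2 + ‖D f‖ ^ 2 : ℝ) : ℂ) := by
    intro f
    rw [hBin]
    simp only [inner_self_eq_norm_sq_to_K]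
    push_cast; rfl
  have hBunit : IsUnit B := by
    have hc : (0 : ℝ) < (K + 1)⁻¹ := by positivity
    refine ContinuousLinearMap.isUnit_of_forall_le_norm_inner_map B (c := ⟨(K + 1)⁻¹, hc.le⟩) hc
      fun f => ?_
    have h1 := hcoer f
    rw [hBsym, hBpos, Complex.norm_real, Real.norm_eq_abs, abs_of_nonneg (by positivity)]
    change ‖f‖ ^ 2 * (K + 1)⁻¹ ≤ _
    rw [← div_eq_mul_inv, div_le_iff₀ (by positivity)]
    linarith
  obtain ⟨u, hu⟩ := hBunit
  set Bi : Hilb (OccB N) →L[ℂ] Hilb (OccB N) := ((u⁻¹ : (Hilb (OccB N) →L[ℂ] Hilb (OccB N))ˣ) :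
    Hilb (OccB N) →L[ℂ] Hilb (OccB N)) with hBi
  have hBBi : ∀ f, B (Bi f) = f := by
    intro f
    have : B * Bi = 1 := by rw [← hu, hBi]; exact u.mul_inv
    exact congrArg (fun T : Hilb (OccB N) →L[ℂ] Hilb (OccB N) => T f) this
  set T := D ∘L Bi ∘L D with hT
  have hTsym : (T : Hilb (OccB N) →ₗ[ℂ] Hilb (OccB N)).IsSymmetric := by
    intro f g
    calc inner ℂ (D (Bi (D f))) g = inner ℂ (Bi (D f)) (D g) := hDsym _ _
      _ = inner ℂ (Bi (D f)) (B (Bi (D g))) := by rw [hBBi]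
      _ = inner ℂ (B (Bi (D f))) (Bi (D g)) := (hBsym _ _).symm
      _ = inner ℂ (D f) (Bi (D g)) := by rw [hBBi]
      _ = inner ℂ f (D (Bi (D g))) := hDsym _ _
  have hDc : IsCompactOperator D := by
    refine isCompactOperator_mul hDs fun ε hε => ?_
    refine (finite_deg_le N (1 / ε ^ 2)).subset fun n hn => ?_
    have h1 : ε ^ 2 ≤ 1 / wt n := by
      rw [← norm_ivw_sq]
      exact pow_le_pow_left₀ hε.le hn 2
    rw [le_div_iff₀ (wt_pos n)] at h1
    have h2 : wt n ≤ 1 / ε ^ 2 := by rw [le_div_iff₀ (by positivity)]; linarith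
    change deg n ≤ _
    unfold wt at h2
    linarith
  have hTc : IsCompactOperator T := hDc.comp_clm (Bi ∘L D)
  obtain ⟨ι, b, μ, hμ⟩ := exists_eigenbasis hTc hTsym
  have hg : ∀ k, D (Bi (D (b k))) = (μ k : ℂ) • b k := hμ
  have hμ0 : ∀ k, μ k ≠ 0 := by
    intro k h0
    have h1 := hg k
    rw [h0, Complex.ofReal_zero, zero_smul] at h1
    have hDinj : ∀ f, D f = 0 → f = 0 := by
      intro f hf
      ext n
      have h2 := hDs f n
      rw [hf] at h2
      exact (mul_eq_zero.1 h2.symm).resolve_left (ivw_ne_zero n)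
    have h2 := hDinj _ h1
    have h3 := hBBi (D (b k))
    rw [h2, map_zero] at h3
    exact b.orthonormal.ne_zero k (hDinj _ h3.symm)
  -- the eigenvalue equation
  have hpt : ∀ g : Hilb (OccB N), ∀ n, (B g : OccB N → ℂ) n =
      ivw n * ((∑ α, rotQuad R α * rotQuad R α) (D g) n + D g n) := by
    intro g n
    rw [← inner_ket_left, hBin]
    have h1 : ∀ α, inner ℂ (C α (ket n)) (C α g) =
        ivw n * (rotQuad R α * rotQuad R α) (D g) n := by
      intro α
      have h2 := (formAdj_rotQuad R α).adj (fun _ : Unit => (D (ket n) : OccB N → ℂ))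
        (fun _ : Unit => (C α g : OccB N → ℂ))
        ((summable_punit_iff (fun m => wt m * ‖D (ket n) m‖ ^ 2)).2 (hwD _).summable)
        ((summable_punit_iff (fun m => ‖C α g m‖ ^ 2)).2 (summable_norm_sq _))
      have h3 := (Equiv.punitProd (OccB N)).hasSum_iff (f := fun m =>
        (starRingEnd ℂ) (D (ket n) m) * rotQuad R α (C α g) m) |>.1 h2
      have h4 : ∑' x : Unit × OccB N, (starRingEnd ℂ) (rotQuad R α (D (ket n)) x.2) * C α g x.2 =
          inner ℂ (C α (ket n)) (C α g) := by
        rw [← (hasSum_inner_coe (C α (ket n)) (C α g)).tsum_eq, hCΞ α (ket n)]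
        exact (Equiv.punitProd (OccB N)).tsum_eq
          (fun m => (starRingEnd ℂ) (rotQuad R α (D (ket n)) m) * C α g m)
      rw [h4] at h3
      refine h3.unique ?_
      -- Testing the form against D applied to a basis vector leaves one term, which turns the weak
      -- identity into one for each coefficient.
      have h5 := hasSum_single (f := fun m =>
        (starRingEnd ℂ) (D (ket n) m) * rotQuad R α (C α g) m) n (fun m hm => by
          rw [hDs, ket_apply, if_neg hm]; simp)
      rw [hDs, ket_apply, if_pos rfl, mul_one, conj_ivw] at h5
      have h7 : (rotQuad R α * rotQuad R α) (D g) n = rotQuad R α (C α g) n := by rw [hCΞ]; rfl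
      rw [h7]
      exact h5
    have h6 : inner ℂ (D (ket n)) (D g) = ivw n * D g n := by
      rw [hDsym, inner_ket_left, hDs]
    simp only [h1]
    rw [h6, LinearMap.sum_apply, Finset.sum_apply, mul_add, Finset.mul_sum]
  have heig : ∀ k, hamB R (b k : OccB N → ℂ) =
      (((1 / μ k - 1) / 2 : ℝ) : ℂ) • (b k : OccB N → ℂ) := by
    intro k
    ext n
    have h1 := hpt (Bi (D (b k))) n
    rw [hBBi, hDs, hg, lp.coeFn_smul, map_smul] at h1
    have h2 := mul_left_cancel₀ (ivw_ne_zero n) h1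
    have h3 : (μ k : ℂ) ≠ 0 := by exact_mod_cast hμ0 k
    simp only [Pi.smul_apply, smul_eq_mul] at h2
    have h4 : (∑ α, rotQuad R α * rotQuad R α) (b k : OccB N → ℂ) n =
        (1 / (μ k : ℂ) - 1) * b k n := by
      field_simp
      linear_combination -h2
    have h5 : hamB R (b k : OccB N → ℂ) n =
        (1 / 2 : ℂ) * (∑ α, rotQuad R α * rotQuad R α) (b k : OccB N → ℂ) n := by
      rw [hamB_eq]; rfl
    rw [h5, h4, Pi.smul_apply, smul_eq_mul]
    push_cast
    ring
  refine ⟨ι, b, fun k => (1 / μ k - 1) / 2, K + 1, by positivity, heig, fun k => ?_⟩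
  set g := Bi (D (b k)) with hgdef
  have hsum : HasSum (fun n => wt n * ‖b k n‖ ^ 2) (‖g‖ ^ 2 / μ k ^ 2) := by
    refine (hasSum_congr fun n => ?_).1 ((hwD g).div_const (μ k ^ 2))
    rw [hg, lp.coeFn_smul, Pi.smul_apply, smul_eq_mul, norm_mul, mul_pow, Complex.norm_real,
      Real.norm_eq_abs, sq_abs]
    have := hμ0 k
    field_simp
  refine ⟨hsum.summable, ?_⟩
  rw [hsum.tsum_eq]
  -- Since D g = μ b_k, the form of B at g is μ, while the mean weight of b_k is ‖g‖²/μ². Coercivity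
  -- then bounds the mean weight by (K + 1)/μ = (K + 1)(2E + 1).
  have h1 : ∑ α, ‖C α g‖ ^ 2 + ‖D g‖ ^ 2 = μ k := by
    have h2 : inner ℂ g (B g) = (μ k : ℂ) := by
      rw [hBBi, ← hDsym, hg, inner_smul_left, inner_self_eq_norm_sq_to_K, b.orthonormal.1 k]
      simp
    rw [hBpos] at h2
    exact_mod_cast h2
  have h3 := hcoer g
  rw [h1] at h3
  have h4 : 0 ≤ μ k := by rw [← h1]; positivity
  have h5 : 0 < μ k := lt_of_le_of_ne h4 (Ne.symm (hμ0 k))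
  rw [div_le_iff₀ (by positivity)]
  calc ‖g‖ ^ 2 ≤ (K + 1) * μ k := h3
    _ = _ := by field_simp; ring

end Spectral

/-! ### Eigenvectors of the bosonic Hamiltonian in its maximal domain -/

section Ortho

variable {N : ℕ}

/-- `B` is the formal adjoint of `A` on finite linear combinations of basis vectors. -/
def FinAdj {S : Type} (A B : Op S) : Prop :=
  ∀ g f : S → ℂ, g.support.Finite → (B g).support.Finite ∧
    ∑' s, (starRingEnd ℂ) (g s) * A f s = ∑' s, (starRingEnd ℂ) (B g s) * f s

section

variable {S : Type} {A B A' B' : Op S}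

theorem summable_conj_mul_of_finite {g : S → ℂ} (hg : g.support.Finite) (f : S → ℂ) :
    Summable (fun s => (starRingEnd ℂ) (g s) * f s) := by
  refine summable_of_hasFiniteSupport (hg.subset fun s hs => ?_)
  intro h
  exact hs (by simp [h])

theorem FinAdj.mul (h : FinAdj A B) (h' : FinAdj A' B') : FinAdj (A * A') (B' * B) := by
  intro g f hg
  obtain ⟨h1, h2⟩ := h g (A' f) hg
  obtain ⟨h3, h4⟩ := h' (B g) f h1
  exact ⟨h3, h2.trans h4⟩

theorem FinAdj.add (h : FinAdj A B) (h' : FinAdj A' B') : FinAdj (A + A') (B + B') := by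
  intro g f hg
  obtain ⟨h1, h2⟩ := h g f hg
  obtain ⟨h3, h4⟩ := h' g f hg
  refine ⟨(h1.union h3).subset (Function.support_add _ _), ?_⟩
  simp only [LinearMap.add_apply, Pi.add_apply, map_add, mul_add, add_mul]
  rw [(summable_conj_mul_of_finite hg _).tsum_add (summable_conj_mul_of_finite hg _),
    (summable_conj_mul_of_finite h1 _).tsum_add (summable_conj_mul_of_finite h3 _), h2, h4]

theorem FinAdj.smul (z : ℂ) (h : FinAdj A B) : FinAdj (z • A) ((starRingEnd ℂ) z • B) := by
  intro g f hg
  obtain ⟨h1, h2⟩ := h g f hg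
  refine ⟨h1.subset fun s hs h => hs ?_, ?_⟩
  · rw [LinearMap.smul_apply, Pi.smul_apply, h, smul_zero]
  simp only [LinearMap.smul_apply, Pi.smul_apply, smul_eq_mul, map_mul, Complex.conj_conj,
    mul_assoc, mul_left_comm _ z]
  rw [tsum_mul_left, tsum_mul_left, h2]

theorem FinAdj.sum {κ : Type} (s : Finset κ) {A B : κ → Op S} (h : ∀ k, FinAdj (A k) (B k)) :
    FinAdj (∑ k ∈ s, A k) (∑ k ∈ s, B k) := by
  classical
  induction s using Finset.induction_on with
  | empty => intro g f _; simp
  | insert k s hk ih => rw [Finset.sum_insert hk, Finset.sum_insert hk]; exact (h k).add ih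

end

theorem tsum_up {i : Fin N} {f : OccB N → ℂ} (hf : ∀ n, n i = 0 → f n = 0) :
    ∑' n, f (up i n) = ∑' n, f n := by
  refine (up_injective i).tsum_eq fun n hn => ?_
  have : n i ≠ 0 := fun h => hn (hf n h)
  exact ⟨down i n, up_down this⟩

theorem finAdj_bAnn (i : Fin N) : FinAdj (bAnn i) (bCre i) := by
  intro g f hg
  constructor
  · refine (hg.image (up i)).subset fun n hn => ?_
    have h0 : n i ≠ 0 := fun h => hn (bCre_eq_zero g h)
    refine ⟨down i n, fun h => hn ?_, up_down h0⟩
    rw [← up_down h0, bCre_up, h, mul_zero]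
  · rw [← tsum_up (i := i) (f := fun n => (starRingEnd ℂ) (bCre i g n) * f n)
      (fun n hn => by simp [bCre_eq_zero g hn])]
    refine tsum_congr fun n => ?_
    rw [bCre_up, bAnn_up, map_mul, Complex.conj_ofReal]
    ring

theorem finAdj_bCre (i : Fin N) : FinAdj (bCre i) (bAnn i) := by
  intro g f hg
  constructor
  · refine (hg.preimage (f := up i) (up_injective i).injOn).subset fun n hn h => hn ?_
    rw [bAnn_up, h, mul_zero]
  · rw [← tsum_up (i := i) (f := fun n => (starRingEnd ℂ) (g n) * bCre i f n)
      (fun n hn => by simp [bCre_eq_zero f hn])]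
    refine tsum_congr fun n => ?_
    rw [bCre_up, bAnn_up, map_mul, Complex.conj_ofReal]
    ring

theorem finAdj_xiB (a : Idx N) : FinAdj (xiB a) (xiB a) := by
  rcases a with i | i
  · have h := ((finAdj_bCre i).add (finAdj_bAnn i)).smul ((1 / Real.sqrt 2 : ℝ) : ℂ)
    rw [Complex.conj_ofReal, add_comm (bAnn i)] at h
    exact h
  · have h := ((finAdj_bCre i).add ((finAdj_bAnn i).smul (-1))).smul
      (Complex.I * ((1 / Real.sqrt 2 : ℝ) : ℂ))
    have h1 : (Complex.I * ((1 / Real.sqrt 2 : ℝ) : ℂ)) • (bCre i + (-1 : ℂ) • bAnn i) =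
        xiB (Sum.inr i) := by
      rw [xiB]; module
    have h2 : (starRingEnd ℂ) (Complex.I * ((1 / Real.sqrt 2 : ℝ) : ℂ)) •
        (bAnn i + (starRingEnd ℂ) (-1) • bCre i) = xiB (Sum.inr i) := by
      rw [xiB, map_mul, Complex.conj_ofReal, Complex.conj_I, map_neg, map_one]; module
    rwa [h1, h2] at h

theorem finAdj_hamB (R : RMat N) : FinAdj (hamB R) (hamB R) := by
  rw [hamB_eq]
  have h1 : ∀ α, FinAdj (rotQuad R α) (rotQuad R α) := by
    intro α
    refine FinAdj.sum _ fun a => ?_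
    have := (finAdj_xiB a).smul (R α a : ℂ)
    rwa [Complex.conj_ofReal] at this
  have h2 := (FinAdj.sum Finset.univ fun α => (h1 α).mul (h1 α)).smul (1 / 2 : ℂ)
  have h3 : (starRingEnd ℂ) (1 / 2 : ℂ) = 1 / 2 := by
    rw [map_div₀, map_one, map_ofNat]
  rwa [h3] at h2

/-- The cutoff function. -/
def cut (M : ℕ) (n : OccB N) : ℝ := max 0 (1 - deg n / (M + 1))

theorem cut_nonneg (M : ℕ) (n : OccB N) : 0 ≤ cut M n := le_max_left _ _

theorem cut_le_one (M : ℕ) (n : OccB N) : cut M n ≤ 1 := by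
  refine max_le zero_le_one ?_
  have := deg_nonneg n
  have : 0 ≤ deg n / ((M : ℝ) + 1) := by positivity
  linarith

theorem cut_eq_zero {M : ℕ} {n : OccB N} (h : (M : ℝ) + 1 ≤ deg n) : cut M n = 0 := by
  refine max_eq_left ?_
  have : 1 ≤ deg n / ((M : ℝ) + 1) := by rwa [one_le_div (by positivity)]
  linarith

theorem abs_cut_sub_le (M : ℕ) (n n' : OccB N) :
    |cut M n - cut M n'| ≤ |deg n - deg n'| / (M + 1) := by
  have hM : (0 : ℝ) < (M : ℝ) + 1 := by positivity
  refine (abs_max_sub_max_le_max _ _ _ _).trans (max_le ?_ ?_)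
  · rw [sub_self, abs_zero]
    positivity
  · rw [sub_sub_sub_cancel_left, ← sub_div, abs_div, abs_of_pos hM, abs_sub_comm]

theorem tendsto_cut (n : OccB N) : Tendsto (fun M => cut M n) atTop (𝓝 1) := by
  have h1 : Tendsto (fun M : ℕ => 1 - deg n / ((M : ℝ) + 1)) atTop (𝓝 (1 - 0)) := by
    refine tendsto_const_nhds.sub ?_
    exact tendsto_const_nhds.div_atTop (tendsto_atTop_add_const_right _ _
      tendsto_natCast_atTop_atTop)
  have h2 := (tendsto_const_nhds (x := (0 : ℝ)) (f := (atTop : Filter ℕ))).max h1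
  simpa [cut] using h2

/-- The commutator of `A` with the cutoff. -/
def cutComm (A : Op (OccB N)) (M : ℕ) (g : OccB N → ℂ) (n : OccB N) : ℂ :=
  A (fun n => (cut M n : ℂ) * g n) n - (cut M n : ℂ) * A g n

/-- The operators whose commutator with the cutoff tends weakly to zero. -/
def cutSub (N : ℕ) : Submodule ℂ (Op (OccB N)) where
  carrier := {A | ∀ g f : Hilb (OccB N),
    (∀ M, Summable (fun n => (starRingEnd ℂ) (cutComm A M g n) * f n)) ∧
    Tendsto (fun M => ∑' n, (starRingEnd ℂ) (cutComm A M g n) * f n) atTop (𝓝 0)}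
  zero_mem' := by
    intro g f
    have : ∀ M n, cutComm (0 : Op (OccB N)) M g n = 0 := fun M n => by
      change (0 : ℂ) - (cut M n : ℂ) * 0 = 0
      ring
    simp [this]
  add_mem' := by
    intro A B hA hB g f
    have h : ∀ M n, (starRingEnd ℂ) (cutComm (A + B) M g n) * f n =
        (starRingEnd ℂ) (cutComm A M g n) * f n + (starRingEnd ℂ) (cutComm B M g n) * f n := by
      intro M n
      rw [← add_mul, ← map_add]
      congr 2
      simp only [cutComm, LinearMap.add_apply, Pi.add_apply]
      ring
    simp only [h]
    refine ⟨fun M => ((hA g f).1 M).add ((hB g f).1 M), ?_⟩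
    simp only [fun M => ((hA g f).1 M).tsum_add ((hB g f).1 M)]
    simpa using (hA g f).2.add (hB g f).2
  smul_mem' := by
    intro c A hA g f
    have h : ∀ M n, (starRingEnd ℂ) (cutComm (c • A) M g n) * f n =
        (starRingEnd ℂ) c * ((starRingEnd ℂ) (cutComm A M g n) * f n) := by
      intro M n
      rw [← mul_assoc, ← map_mul]
      congr 2
      simp only [cutComm, LinearMap.smul_apply, Pi.smul_apply, smul_eq_mul]
      ring
    simp only [h]
    refine ⟨fun M => ((hA g f).1 M).mul_left _, ?_⟩
    simp only [tsum_mul_left]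
    simpa using (hA g f).2.const_mul ((starRingEnd ℂ) c)

/-- Weighted shifts changing the degree by at most one. -/
def IsLadder (A : Op (OccB N)) : Prop :=
  ∃ (m : OccB N → ℂ) (σ : OccB N → OccB N), (∀ f n, A f n = m n * f (σ n)) ∧
    (∀ n, ‖m n‖ ^ 2 ≤ wt n) ∧ Set.InjOn σ {n | m n ≠ 0} ∧
    ∀ n, m n ≠ 0 → |deg (σ n) - deg n| ≤ 1

theorem isLadder_bAnn (i : Fin N) : IsLadder (bAnn i) := by
  refine ⟨fun n => (Real.sqrt (n i + 1) : ℂ), up i, fun f n => rfl, fun n => ?_,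
    (up_injective i).injOn, fun n _ => by rw [deg_up]; simp⟩
  rw [Complex.norm_real, Real.norm_eq_abs, sq_abs, Real.sq_sqrt (by positivity), wt]
  linarith [le_deg n i]

theorem isLadder_bCre (i : Fin N) : IsLadder (bCre i) := by
  refine ⟨fun n => (Real.sqrt (n i) : ℂ), down i, fun f n => rfl, fun n => ?_, ?_, fun n hn => ?_⟩
  · rw [Complex.norm_real, Real.norm_eq_abs, sq_abs, Real.sq_sqrt (by positivity), wt]
    linarith [le_deg n i]
  · intro n hn n' hn' h
    have h1 : n i ≠ 0 := by rintro h0; exact hn (by simp [h0])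
    have h2 : n' i ≠ 0 := by rintro h0; exact hn' (by simp [h0])
    rw [← up_down h1, ← up_down h2, h]
  · rw [deg_down (by rintro h0; exact hn (by simp [h0]))]; simp

/-- The coefficients of a product of two ladder operators grow linearly in the degree, while the
cutoff has slope 1/(M + 1) and vanishes beyond degree M + 1. The commutator is thus bounded
uniformly in M and tends to zero pointwise, so dominated convergence applies. -/
theorem IsLadder.mul_mem_cutSub {A B : Op (OccB N)} (hA : IsLadder A) (hB : IsLadder B) :
    A * B ∈ cutSub N := by
  obtain ⟨m, σ, hA1, hA2, hA3, hA4⟩ := hA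
  obtain ⟨m', σ', hB1, hB2, hB3, hB4⟩ := hB
  intro g f
  set p : OccB N → ℂ := fun n => m n * m' (σ n) with hp
  set τ : OccB N → OccB N := fun n => σ' (σ n) with hτ
  have hAB : ∀ h n, (A * B) h n = p n * h (τ n) := by
    intro h n
    rw [Module.End.mul_apply, hA1, hB1, hp, hτ, mul_assoc]
  have hp0 : ∀ n, p n ≠ 0 → m n ≠ 0 ∧ m' (σ n) ≠ 0 := fun n hn =>
    ⟨left_ne_zero_of_mul hn, right_ne_zero_of_mul hn⟩
  have hinj : Set.InjOn τ {n | p n ≠ 0} := by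
    intro n hn n' hn' h
    exact hA3 (hp0 n hn).1 (hp0 n' hn').1 (hB3 (hp0 n hn).2 (hp0 n' hn').2 h)
  have hdeg : ∀ n, p n ≠ 0 → |deg (τ n) - deg n| ≤ 2 := by
    intro n hn
    have h1 := hA4 n (hp0 n hn).1
    have h2 := hB4 (σ n) (hp0 n hn).2
    have h3 : deg (τ n) - deg n = (deg (σ' (σ n)) - deg (σ n)) + (deg (σ n) - deg n) := by
      rw [hτ]; ring
    rw [h3]
    exact (abs_add_le _ _).trans (by linarith)
  have hpn : ∀ n, p n ≠ 0 → ‖p n‖ ≤ wt n + 1 := by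
    intro n hn
    have h1 := hA2 n
    have h2 := hB2 (σ n)
    have h3 := (abs_le.1 (hA4 n (hp0 n hn).1)).2
    have h4 : wt (σ n) ≤ wt n + 1 := by unfold wt; linarith
    rw [hp, norm_mul]
    nlinarith [sq_nonneg (‖m n‖ - ‖m' (σ n)‖), wt_pos n]
  clear_value p τ
  have hc : ∀ M n, cutComm (A * B) M g n =
      p n * (((cut M (τ n) - cut M n : ℝ) : ℂ) * g (τ n)) := by
    intro M n
    rw [cutComm, hAB, hAB]
    push_cast
    ring
  -- the dominating function
  obtain ⟨T, hT⟩ := bddOp_of_shift (A := ⟨⟨fun h n => (if p n = 0 then 0 else 1) * h (τ n),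
      fun x y => by ext n; simp [mul_add]⟩, fun c x => by ext n; simp [mul_left_comm]⟩)
    (m := fun n => if p n = 0 then 0 else 1) (σ := τ) (C := 1) (fun f n => rfl)
    (fun n => by split_ifs <;> simp) (hinj.mono fun n hn => by
      simp only [ne_eq, ite_eq_left_iff, not_forall] at hn
      exact hn.1)
  have hTn : ∀ n, (T g : OccB N → ℂ) n = (if p n = 0 then 0 else 1) * g (τ n) := by
    intro n; rw [hT]; rfl
  have hbound : ∀ M n, ‖(starRingEnd ℂ) (cutComm (A * B) M g n) * f n‖ ≤
      10 * ‖(starRingEnd ℂ) (T g n) * f n‖ := by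
    intro M n
    rw [hc, hTn]
    by_cases h0 : p n = 0
    · simp [h0]
    have hnorm : ∀ (r : ℝ) (z y x : ℂ), ‖(starRingEnd ℂ) (x * ((r : ℂ) * z)) * y‖ =
        ‖x‖ * |r| * ‖z‖ * ‖y‖ := by
      intro r z y x
      rw [norm_mul, RCLike.norm_conj, norm_mul x, norm_mul, Complex.norm_real, Real.norm_eq_abs]
      ring
    have hnorm' : ∀ z y : ℂ, (10 : ℝ) * ‖(starRingEnd ℂ) (1 * z) * y‖ = 10 * ‖z‖ * ‖y‖ := by
      intro z y
      rw [one_mul, norm_mul, RCLike.norm_conj, mul_assoc]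
    rw [if_neg h0]
    refine (hnorm _ _ _ _).trans_le ((hnorm' _ _).ge.trans' ?_)
    refine mul_le_mul_of_nonneg_right (mul_le_mul_of_nonneg_right ?_ (norm_nonneg _))
      (norm_nonneg _)
    have hM : (0 : ℝ) < (M : ℝ) + 1 := by positivity
    have h2 := hdeg n h0
    -- The product shifts the degree by at most 2, so beyond M + 3 both cutoff values vanish. Below
    -- it the coefficient is at most M + 5 and the cutoff difference at most 2/(M + 1); their
    -- product is at most 10, attained at M = 0.
    by_cases hd : deg n ≤ M + 3
    · have h1 := hpn n h0
      have h3 := abs_cut_sub_le M (τ n) n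
      have h4 : |cut M (τ n) - cut M n| ≤ 2 / (M + 1) := h3.trans (by gcongr)
      calc ‖p n‖ * |cut M (τ n) - cut M n| ≤ (M + 5) * (2 / (M + 1)) := by
            refine mul_le_mul ?_ h4 (abs_nonneg _) (by positivity)
            unfold wt at h1
            linarith
        _ ≤ 10 := by
            rw [mul_div_assoc', div_le_iff₀ hM]
            have : (0 : ℝ) ≤ M := Nat.cast_nonneg M
            linarith
    · have h5 := (abs_le.1 h2).1
      rw [cut_eq_zero (by linarith), cut_eq_zero (by linarith)]
      simp
  have hsum : Summable (fun n => 10 * ‖(starRingEnd ℂ) (T g n) * f n‖) :=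
    ((summable_mul_of_sq (summable_norm_sq (T g)) (summable_norm_sq f)).norm).mul_left 10
  refine ⟨fun M => Summable.of_norm_bounded hsum (hbound M), ?_⟩
  have h := tendsto_tsum_of_dominated_convergence (𝓕 := (atTop : Filter ℕ))
    (f := fun M n => (starRingEnd ℂ) (cutComm (A * B) M g n) * f n) (g := fun _ => (0 : ℂ)) hsum
    (fun n => ?_) (Eventually.of_forall hbound)
  · simpa using h
  · have h1 : Tendsto (fun M => cut M (τ n) - cut M n) atTop (𝓝 (1 - 1)) :=
      (tendsto_cut _).sub (tendsto_cut _)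
    rw [sub_self] at h1
    have h2 := ((Complex.continuous_ofReal.tendsto 0).comp h1)
    have h3 := (Complex.continuous_conj.tendsto _).comp ((h2.mul_const (g (τ n))).const_mul (p n))
    have h4 := h3.mul_const (f n)
    simp only [hc]
    simpa using h4

theorem hamB_mem_cutSub (R : RMat N) : hamB R ∈ cutSub N := by
  set L : Submodule ℂ (Op (OccB N)) := Submodule.span ℂ {A | IsLadder A} with hL
  have h1 : L * L ≤ cutSub N := by
    rw [hL, Submodule.span_mul_span, Submodule.span_le]
    rintro _ ⟨A, hA, B, hB, rfl⟩
    exact IsLadder.mul_mem_cutSub hA hB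
  have h2 : ∀ a, xiB a ∈ L := by
    rintro (i | i)
    · exact L.smul_mem _ (L.add_mem (Submodule.subset_span (isLadder_bCre i))
        (Submodule.subset_span (isLadder_bAnn i)))
    · exact L.smul_mem _ (L.sub_mem (Submodule.subset_span (isLadder_bCre i))
        (Submodule.subset_span (isLadder_bAnn i)))
  refine Submodule.smul_mem _ _ (Submodule.sum_mem _ fun a _ => Submodule.sum_mem _ fun b _ =>
    Submodule.smul_mem _ _ (h1 (Submodule.mul_mem_mul (h2 a) (h2 b))))

/-- For formal eigenvectors, symmetry of H could fail by a boundary term at infinite occupation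
number. Cutting off g makes the adjoint relation a finite sum; the error is the commutator of H with
the cutoff, which vanishes in the limit. What remains is (E' - E)⟨g, f⟩ = 0. -/
theorem eigenOrtho_hamB (R : RMat N) : EigenOrtho (hamB R) := by
  intro E E' g f hE hg hf
  obtain ⟨hs, ht⟩ := hamB_mem_cutSub R g f
  have hfin : ∀ M, (fun n => (cut M n : ℂ) * g n).support.Finite := by
    intro M
    refine (finite_deg_le N (M + 1)).subset fun n hn => ?_
    by_contra h
    exact hn (by simp [cut_eq_zero (not_le.1 h).le])
  have hcs : ∀ M, Summable (fun n => (cut M n : ℂ) * ((starRingEnd ℂ) (g n) * f n)) := by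
    intro M
    refine Summable.of_norm_bounded (hasSum_inner_coe g f).summable.norm fun n => ?_
    rw [norm_mul, Complex.norm_real, Real.norm_eq_abs, abs_of_nonneg (cut_nonneg M n)]
    exact mul_le_of_le_one_left (norm_nonneg _) (cut_le_one M n)
  have hlim : Tendsto (fun M => ∑' n, (cut M n : ℂ) * ((starRingEnd ℂ) (g n) * f n)) atTop
      (𝓝 (inner ℂ g f)) := by
    rw [← (hasSum_inner_coe g f).tsum_eq]
    refine tendsto_tsum_of_dominated_convergence (hasSum_inner_coe g f).summable.norm
      (fun n => ?_) (Eventually.of_forall fun M n => ?_)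
    · have := ((Complex.continuous_ofReal.tendsto 1).comp (tendsto_cut n)).mul_const
        ((starRingEnd ℂ) (g n) * f n)
      simpa using this
    · rw [norm_mul, Complex.norm_real, Real.norm_eq_abs, abs_of_nonneg (cut_nonneg M n)]
      exact mul_le_of_le_one_left (norm_nonneg _) (cut_le_one M n)
  have hid : ∀ M, ∑' n, (starRingEnd ℂ) (cutComm (hamB R) M g n) * f n =
      ((E' - E : ℝ) : ℂ) * ∑' n, (cut M n : ℂ) * ((starRingEnd ℂ) (g n) * f n) := by
    intro M
    have h1 := (finAdj_hamB R (fun n => (cut M n : ℂ) * g n) f (hfin M)).2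
    have h2 : ∀ n, (starRingEnd ℂ) (hamB R (fun n => (cut M n : ℂ) * g n) n) * f n =
        (starRingEnd ℂ) (cutComm (hamB R) M g n) * f n +
          (E : ℂ) * ((cut M n : ℂ) * ((starRingEnd ℂ) (g n) * f n)) := by
      intro n
      have : hamB R (fun n => (cut M n : ℂ) * g n) n =
          cutComm (hamB R) M g n + (cut M n : ℂ) * ((E : ℂ) * g n) := by
        rw [cutComm, hg]
        simp
      rw [this, map_add, map_mul, map_mul, Complex.conj_ofReal, Complex.conj_ofReal]
      ring
    rw [tsum_congr h2, (hs M).tsum_add ((hcs M).mul_left _), tsum_mul_left] at h1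
    have h3 : ∀ n, (starRingEnd ℂ) ((cut M n : ℂ) * g n) * hamB R f n =
        (E' : ℂ) * ((cut M n : ℂ) * ((starRingEnd ℂ) (g n) * f n)) := by
      intro n
      rw [hf, map_mul, Complex.conj_ofReal, Pi.smul_apply, smul_eq_mul]
      ring
    rw [tsum_congr h3, tsum_mul_left] at h1
    push_cast
    linear_combination -h1
  simp only [hid] at ht
  have h4 := tendsto_nhds_unique ht (hlim.const_mul _)
  have h5 : ((E' - E : ℝ) : ℂ) ≠ 0 := by
    exact_mod_cast sub_ne_zero.2 hE.symm
  exact (mul_eq_zero.1 h4.symm).resolve_left h5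

end Ortho

/-! ### The bosonic partition function -/

section Partition

variable {N : ℕ}

/-- The sum is a product of N geometric series: every finite set of labels lies in a box, and sums
over boxes factorize. -/
theorem summable_exp_deg {γ : ℝ} (hγ : 0 < γ) :
    Summable (fun n : OccB N => Real.exp (-(γ * deg n))) := by
  set r : ℝ := Real.exp (-γ) with hr
  have hr0 : 0 ≤ r := (Real.exp_pos _).le
  have hr1 : r < 1 := by rw [hr, Real.exp_lt_one_iff]; linarith
  have hprod : ∀ n : OccB N, Real.exp (-(γ * deg n)) = ∏ i, r ^ n i := by
    intro n
    rw [deg, Finset.mul_sum, ← Finset.sum_neg_distrib, Real.exp_sum]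
    refine Finset.prod_congr rfl fun i _ => ?_
    rw [hr, ← Real.exp_nat_mul]
    congr 1
    ring
  refine summable_of_sum_le (c := ∏ _i : Fin N, (1 - r)⁻¹) (fun n => (Real.exp_pos _).le)
    fun s => ?_
  have hs : s ⊆ Fintype.piFinset
      (fun _ : Fin N => Finset.range (s.sup (fun n => ∑ i, n i) + 1)) := by
    intro n hn
    rw [Fintype.mem_piFinset]
    intro i
    rw [Finset.mem_range, Nat.lt_succ_iff]
    exact (Finset.single_le_sum (f := n) (fun _ _ => Nat.zero_le _) (Finset.mem_univ i)).trans
      (Finset.le_sup (f := fun n : OccB N => ∑ i, n i) hn)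
  refine (Finset.sum_le_sum_of_subset_of_nonneg hs fun n _ _ => (Real.exp_pos _).le).trans ?_
  simp only [hprod]
  rw [← Finset.prod_univ_sum (fun _ : Fin N => Finset.range (s.sup (fun n => ∑ i, n i) + 1))
    (fun _ j => r ^ j)]
  refine Finset.prod_le_prod (fun i _ => Finset.sum_nonneg fun j _ => pow_nonneg hr0 j)
    fun i _ => ?_
  rw [← tsum_geometric_of_lt_one hr0 hr1]
  exact (summable_geometric_of_lt_one hr0 hr1).sum_le_tsum _ (fun j _ => pow_nonneg hr0 j)

/-- Jensen's inequality for the exponential function. -/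
theorem exp_neg_tsum_le {S : Type} {a w : S → ℝ} (γ : ℝ) (ha : ∀ s, 0 ≤ a s) (h1 : HasSum a 1)
    {W : ℝ} (hW : HasSum (fun s => w s * a s) W)
    (hs : Summable (fun s => a s * Real.exp (-(γ * w s)))) :
    Real.exp (-(γ * W)) ≤ ∑' s, a s * Real.exp (-(γ * w s)) := by
  -- The tangent line of the exponential at the mean W, averaged with the weights a; it lies below
  -- the exponential and its mean is the left-hand side.
  have h2 : HasSum (fun s => Real.exp (-(γ * W)) * ((1 + γ * W) * a s - γ * (w s * a s)))
      (Real.exp (-(γ * W)) * ((1 + γ * W) * 1 - γ * W)) :=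
    ((h1.mul_left _).sub (hW.mul_left _)).mul_left _
  rw [mul_one, add_sub_cancel_right, mul_one] at h2
  refine hasSum_le (fun s => ?_) h2 hs.hasSum
  have h3 := Real.add_one_le_exp (γ * W - γ * w s)
  have h4 : Real.exp (-(γ * w s)) = Real.exp (-(γ * W)) * Real.exp (γ * W - γ * w s) := by
    rw [← Real.exp_add]; congr 1; ring
  rw [h4]
  have h5 := mul_le_mul_of_nonneg_left h3 (mul_nonneg (ha s) (Real.exp_pos (-(γ * W))).le)
  linarith

/-- The trace of a non-negative diagonal operator is basis-independent: by Parseval, |b_k(s)|² sums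
over k to the squared norm of |s⟩, which is 1. -/
theorem summable_basis_prod {S ι : Type} [DecidableEq S] (b : HilbertBasis ι ℂ (Hilb S))
    {v : S → ℝ} (hv : ∀ s, 0 ≤ v s) (hs : Summable v) :
    Summable (fun x : ι × S => ‖b x.1 x.2‖ ^ 2 * v x.2) := by
  rw [← (Equiv.prodComm S ι).summable_iff]
  have h1 : ∀ s, HasSum (fun k => ‖b k s‖ ^ 2 * v s) (v s) := by
    intro s
    have h := (hasSum_parseval b (ket s)).mul_right (v s)
    have hn : ‖ket s‖ = 1 := by
      have := hasSum_norm_sq (ket s)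
      have h2 : HasSum (fun t => ‖ket s t‖ ^ 2) 1 := by
        refine (hasSum_congr fun t => ?_).1 (hasSum_ite_eq s (1 : ℝ))
        rw [ket_apply]
        split_ifs <;> simp
      have h3 := this.unique h2
      nlinarith [norm_nonneg (ket s)]
    rw [hn, one_pow, one_mul] at h
    refine (hasSum_congr fun k => ?_).1 h
    rw [inner_ket_right, RCLike.norm_conj]
  change Summable (fun x : S × ι => ‖b x.2 x.1‖ ^ 2 * v x.1)
  rw [summable_prod_of_nonneg (fun x => mul_nonneg (sq_nonneg _) (hv _))]
  refine ⟨fun s => (h1 s).summable, ?_⟩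
  simpa only [fun s => (h1 s).tsum_eq] using hs

/-- With γ = β/(2C) the energy bound makes γ times the mean weight at most βE + β/2. By Jensen,
e^{-βE_k} is then at most e^{β/2} times the mean of e^{-γ wt} in b_k, and these means sum to the
trace of e^{-γ wt}. -/
theorem summable_exp_of_weight {ι : Type} (b : HilbertBasis ι ℂ (Hilb (OccB N))) {E : ι → ℝ}
    {C : ℝ} (hC : 0 < C) (hb : ∀ k, Summable (fun n => wt n * ‖b k n‖ ^ 2) ∧
      ∑' n, wt n * ‖b k n‖ ^ 2 ≤ C * (2 * E k + 1)) {β : ℝ} (hβ : 0 < β) :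
    Summable (fun k => Real.exp (-(β * E k))) := by
  classical
  set γ : ℝ := β / (2 * C) with hγ
  have hγ0 : 0 < γ := by positivity
  have hv : Summable (fun n : OccB N => Real.exp (-(γ * wt n))) := by
    refine ((summable_exp_deg (N := N) hγ0).mul_left (Real.exp (-γ))).congr fun n => ?_
    rw [← Real.exp_add, wt]
    congr 1; ring
  have h1 := summable_basis_prod b (fun n => (Real.exp_pos _).le) hv
  refine Summable.of_nonneg_of_le (fun k => (Real.exp_pos _).le) (fun k => ?_)
    (h1.prod.mul_left (Real.exp (β / 2)))
  have h2 : HasSum (fun n => ‖b k n‖ ^ 2) 1 := by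
    have := hasSum_norm_sq (b k)
    rwa [b.orthonormal.1 k, one_pow] at this
  have h3 := exp_neg_tsum_le γ (fun n => sq_nonneg _) h2 (hb k).1.hasSum
    (h1.comp_injective (i := fun n : OccB N => ((k, n) : ι × OccB N))
      (fun s t h => (Prod.ext_iff.1 h).2))
  refine le_trans ?_ (mul_le_mul_of_nonneg_left h3 (Real.exp_pos _).le)
  rw [← Real.exp_add, Real.exp_le_exp]
  have h4 := mul_le_mul_of_nonneg_left (hb k).2 hγ0.le
  have h5 : γ * (C * (2 * E k + 1)) = β * E k + β / 2 := by
    rw [hγ]; field_simp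
  linarith

/-- The mean weight grows at most linearly in E. Half of the Boltzmann factor absorbs this growth,
and the other half is summable as the partition function at β/2. -/
theorem summable_exp_mul_weight {ι : Type} (b : HilbertBasis ι ℂ (Hilb (OccB N))) {E : ι → ℝ}
    {C : ℝ} (hC : 0 < C) (hb : ∀ k, Summable (fun n => wt n * ‖b k n‖ ^ 2) ∧
      ∑' n, wt n * ‖b k n‖ ^ 2 ≤ C * (2 * E k + 1)) {β : ℝ} (hβ : 0 < β) (Z : ℝ) (hZ : 0 < Z) :
    Summable (fun x : ι × OccB N =>
      Real.exp (-(β * E x.1)) / Z * (wt x.2 * ‖b x.1 x.2‖ ^ 2)) := by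
  rw [summable_prod_of_nonneg (fun x => mul_nonneg (by positivity)
    (mul_nonneg (wt_pos _).le (sq_nonneg _)))]
  refine ⟨fun k => Summable.mul_left (Real.exp (-(β * E k)) / Z) (hb k).1, ?_⟩
  simp only [tsum_mul_left]
  have h0 : 0 < β / 2 := by positivity
  refine Summable.of_nonneg_of_le (fun k => mul_nonneg (by positivity)
    (tsum_nonneg fun n => mul_nonneg (wt_pos _).le (sq_nonneg _))) (fun k => ?_)
    ((summable_exp_of_weight b hC hb h0).mul_left (C / Z * (4 / β * Real.exp (β / 4))))
  have h1 := Real.add_one_le_exp (β / 2 * E k + β / 4)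
  have h2 : Real.exp (β / 2 * E k + β / 4) = Real.exp (β / 2 * E k) * Real.exp (β / 4) :=
    Real.exp_add _ _
  -- The exponent βE/2 + β/4 is β/4 times 2E + 1, and e^x is at least 1 + x.
  have h3 : 2 * E k + 1 ≤ 4 / β * (Real.exp (β / 4) * Real.exp (β / 2 * E k)) := by
    rw [div_mul_eq_mul_div, le_div_iff₀ hβ]
    nlinarith
  have h4 : Real.exp (-(β * E k)) = Real.exp (-(β / 2 * E k)) * Real.exp (-(β / 2 * E k)) := by
    rw [← Real.exp_add]; congr 1; ring
  have h5 : Real.exp (β / 2 * E k) * Real.exp (-(β / 2 * E k)) = 1 := by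
    rw [← Real.exp_add]; simp
  have h6 : ∑' n, wt n * ‖b k n‖ ^ 2 ≤
      C * (4 / β * (Real.exp (β / 4) * Real.exp (β / 2 * E k))) :=
    (hb k).2.trans (mul_le_mul_of_nonneg_left h3 hC.le)
  refine (mul_le_mul_of_nonneg_left h6 (by positivity)).trans_eq ?_
  calc Real.exp (-(β * E k)) / Z * (C * (4 / β * (Real.exp (β / 4) * Real.exp (β / 2 * E k))))
      = (Real.exp (β / 2 * E k) * Real.exp (-(β / 2 * E k))) *
        (C / Z * (4 / β * Real.exp (β / 4)) * Real.exp (-(β / 2 * E k))) := by rw [h4]; ring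
    _ = _ := by rw [h5, one_mul]

end Partition

/-! ### Covariance matrices from the Kubo-Martin-Schwinger condition -/

section Covariance

variable {N : ℕ}

theorem HasTrace.add {S : Type} [DecidableEq S] {A B : Op S} {ρ : Hilb S →L[ℂ] Hilb S} {a b : ℂ}
    (hA : HasTrace A ρ a) (hB : HasTrace B ρ b) : HasTrace (A + B) ρ (a + b) :=
  HasSum.add hA hB

theorem HasTrace.sub {S : Type} [DecidableEq S] {A B : Op S} {ρ : Hilb S →L[ℂ] Hilb S} {a b : ℂ}
    (hA : HasTrace A ρ a) (hB : HasTrace B ρ b) : HasTrace (A - B) ρ (a - b) :=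
  HasSum.sub hA hB

theorem HasTrace.smul {S : Type} [DecidableEq S] {A : Op S} {ρ : Hilb S →L[ℂ] Hilb S} {a : ℂ}
    (c : ℂ) (hA : HasTrace A ρ a) : HasTrace (c • A) ρ (c * a) :=
  HasSum.mul_left c hA

theorem quad_smul {S : Type} (ξ : Idx N → Op S) (c : ℝ) (q : RMat N) :
    quad ξ (c • q) = (c : ℂ) • quad ξ q := by
  unfold quad
  simp only [Finset.smul_sum, smul_smul, Matrix.smul_apply, smul_eq_mul, Complex.ofReal_mul]

theorem ext_of_col {A B U : CMat N} (hU : IsUnit U.det) (h : ∀ a, A *ᵥ U.col a = B *ᵥ U.col a) :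
    A = B := by
  have h1 : A * U = B * U := by
    ext i a
    exact congrFun (h a) i
  have h2 := congrArg (fun X => X * U⁻¹) h1
  simpa only [Matrix.mul_assoc, Matrix.mul_nonsing_inv _ hU, Matrix.mul_one] using h2

theorem mulVec_col_of_diag {A U : CMat N} {d : Idx N → ℂ} (hU : IsUnit U.det)
    (hA : A = U * diagonal d * U⁻¹) (a : Idx N) : A *ᵥ U.col a = d a • U.col a := by
  have h1 : A * U = U * diagonal d := by
    rw [hA, Matrix.mul_assoc, Matrix.nonsing_inv_mul _ hU, Matrix.mul_one]
  ext i
  have := congrFun (congrFun h1 i) a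
  rw [Matrix.mul_diagonal] at this
  rw [Pi.smul_apply, smul_eq_mul, mul_comm]
  exact this

theorem eq_zero_of_col {m : Idx N → ℂ} {U : CMat N} (hU : IsUnit U.det)
    (h : ∀ a, ∑ i, U.col a i * m i = 0) (i : Idx N) : m i = 0 := by
  have h1 : m ᵥ* U = 0 := by
    ext a
    refine Eq.trans ?_ (h a)
    change ∑ i, m i * U i a = ∑ i, U i a * m i
    exact Finset.sum_congr rfl fun i _ => mul_comm (m i) (U i a)
  have h2 := congrArg (fun x => x ᵥ* U⁻¹) h1
  simp only [Matrix.vecMul_vecMul, Matrix.mul_nonsing_inv _ hU, Matrix.vecMul_one,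
    Matrix.zero_vecMul] at h2
  exact congrFun h2 i

theorem cot_half_eq {x : ℝ} :
    Complex.cot (I * (x : ℂ) / 2) = I * (((Real.exp (-x) : ℝ) : ℂ) + 1) /
      (((Real.exp (-x) : ℝ) : ℂ) - 1) := by
  rw [Complex.cot_eq_exp_ratio]
  have h1 : Complex.exp (2 * I * (I * (x : ℂ) / 2)) = ((Real.exp (-x) : ℝ) : ℂ) := by
    rw [Complex.ofReal_exp]
    congr 1
    push_cast
    linear_combination (x : ℂ) * Complex.I_mul_I
  rw [h1]
  set e : ℂ := ((Real.exp (-x) : ℝ) : ℂ)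
  -- For e = 1, that is x = 0, both sides are zero by the convention for division by zero.
  rcases eq_or_ne e 1 with he | he
  · simp [he]
  · have h2 : 1 - e ≠ 0 := sub_ne_zero.2 he.symm
    have h3 : e - 1 ≠ 0 := sub_ne_zero.2 he
    rw [div_eq_div_iff (mul_ne_zero Complex.I_ne_zero h2) h3]
    linear_combination (-(e + 1) * (1 - e)) * Complex.I_mul_I

theorem tan_half_eq {x : ℝ} :
    Complex.tan (I * (x : ℂ) / 2) = -I * (((Real.exp (-x) : ℝ) : ℂ) - 1) /
      (((Real.exp (-x) : ℝ) : ℂ) + 1) := by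
  rw [← Complex.cot_inv_eq_tan, cot_half_eq, inv_div, div_mul_eq_div_div_swap, Complex.div_I]
  ring

/-- The bosonic covariance matrix. -/
theorem boson_covariance {M J Ω V : CMat N} {ω : Idx N → ℝ} {β : ℝ} (hβ : β ≠ 0)
    (hω : ∀ a, ω a ≠ 0) (hΩ : Ω * Ω = -1) (hV : IsUnit V.det)
    (hJ : J = V * diagonal (fun a => -Complex.cot ((β : ℂ) * (I * (ω a : ℂ)) / 2)) * V⁻¹)
    (hM : M - M.transpose = I • Ω)
    (hkms : ∀ a, M *ᵥ (Ω * V).col a =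
      ((Real.exp (-(β * ω a)) : ℝ) : ℂ) • (M.transpose *ᵥ (Ω * V).col a)) :
    M + M.transpose = -(J * Ω) := by
  have hdΩ : IsUnit Ω.det := by
    refine Matrix.isUnit_det_of_left_inverse (B := -Ω) ?_
    rw [Matrix.neg_mul, hΩ, neg_neg]
  refine ext_of_col (U := Ω * V) (by rw [Matrix.det_mul]; exact hdΩ.mul hV) fun a => ?_
  have hcol : (Ω * V).col a = Ω *ᵥ V.col a := rfl
  have hMM : M = M.transpose + I • Ω := by rw [← hM]; abel
  have hk := hkms a
  set e : ℂ := ((Real.exp (-(β * ω a)) : ℝ) : ℂ) with he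
  have he1 : e - 1 ≠ 0 := by
    rw [sub_ne_zero, he]
    intro h
    have : Real.exp (-(β * ω a)) = 1 := by exact_mod_cast h
    rw [Real.exp_eq_one_iff] at this
    exact mul_ne_zero hβ (hω a) (neg_eq_zero.1 this)
  set x := M.transpose *ᵥ (Ω * V).col a with hx
  -- Write w for the column of V. The commutation relation gives x - iw for the action of M, and KMS
  -- gives ex. Hence x = iw/(1 - e), and the symmetric part acts as i(1 + e)/(1 - e), which is -cot.
  have h1 : M *ᵥ (Ω * V).col a = x - I • V.col a := by
    rw [hMM, Matrix.add_mulVec, ← hx, hcol, Matrix.smul_mulVec, Matrix.mulVec_mulVec, hΩ,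
      Matrix.neg_mulVec, Matrix.one_mulVec, smul_neg, sub_eq_add_neg]
  have h2 : (-(J * Ω)) *ᵥ (Ω * V).col a =
      (-Complex.cot ((β : ℂ) * (I * (ω a : ℂ)) / 2)) • V.col a := by
    rw [hcol, Matrix.neg_mulVec, Matrix.mulVec_mulVec, Matrix.mul_assoc, hΩ, Matrix.mul_neg,
      Matrix.mul_one, Matrix.neg_mulVec, neg_neg, mulVec_col_of_diag hV hJ]
  have h3 : (β : ℂ) * (I * (ω a : ℂ)) / 2 = I * ((β * ω a : ℝ) : ℂ) / 2 := by
    push_cast; ring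
  rw [Matrix.add_mulVec, ← hx, h2, h3, cot_half_eq, ← he, h1]
  rw [h1] at hk
  ext i
  have hi := congrFun hk i
  simp only [Pi.sub_apply, Pi.smul_apply, smul_eq_mul, Pi.add_apply] at hi ⊢
  rw [neg_mul, div_mul_eq_mul_div, ← neg_div, eq_div_iff he1]
  linear_combination (-2 : ℂ) * hi

/-- The fermionic covariance matrix. -/
theorem fermion_covariance {M J W : CMat N} {ω : Idx N → ℝ} {β : ℝ} (hW : IsUnit W.det)
    (hJ : J = W * diagonal (fun a => Complex.tan ((β : ℂ) * (I * (ω a : ℂ)) / 2)) * W⁻¹)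
    (hM : M + M.transpose = 1)
    (hkms : ∀ a, M *ᵥ W.col a =
      ((Real.exp (-(β * ω a)) : ℝ) : ℂ) • (M.transpose *ᵥ W.col a)) :
    (-I) • (M - M.transpose) = J := by
  refine ext_of_col hW fun a => ?_
  have hMM : M = 1 - M.transpose := by rw [← hM]; abel
  have hk := hkms a
  set e : ℂ := ((Real.exp (-(β * ω a)) : ℝ) : ℂ) with he
  have he1 : e + 1 ≠ 0 := by
    rw [he]
    exact_mod_cast (by positivity : Real.exp (-(β * ω a)) + 1 ≠ 0)
  set x := M.transpose *ᵥ W.col a with hx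
  -- Write w for the column of W. The anticommutation relation gives w - x and KMS gives ex, so x =
  -- w/(1 + e). The antisymmetric part, times -i, acts as -i(e - 1)/(e + 1), which is tan.
  have h1 : M *ᵥ W.col a = W.col a - x := by
    rw [hMM, Matrix.sub_mulVec, Matrix.one_mulVec, ← hx]
  have h3 : (β : ℂ) * (I * (ω a : ℂ)) / 2 = I * ((β * ω a : ℝ) : ℂ) / 2 := by
    push_cast; ring
  rw [Matrix.smul_mulVec, Matrix.sub_mulVec, ← hx, mulVec_col_of_diag hW hJ, h3, tan_half_eq, ← he,
    h1]
  rw [h1] at hk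
  ext i
  have hi := congrFun hk i
  simp only [Pi.sub_apply, Pi.smul_apply, smul_eq_mul] at hi ⊢
  rw [div_mul_eq_mul_div, eq_div_iff he1]
  linear_combination (-2 * I) * hi

end Covariance

/-! ### The bosonic thermal state -/

section BosonGaussian

variable {N : ℕ}

/-- An eigenbasis `b` of `H` with energies `E` for which `ρ = e^{-βH} / Z`. -/
structure GibbsData {S ι : Type} (β : ℝ) (H : Op S) (b : HilbertBasis ι ℂ (Hilb S)) (E : ι → ℝ)
    (Z : ℝ) (ρ : Hilb S →L[ℂ] Hilb S) : Prop where
  pos : 0 < Z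
  energy : ∀ k, H (b k : S → ℂ) = (E k : ℂ) • (b k : S → ℂ)
  total : HasSum (fun k => Real.exp (-(β * E k)) / Z) 1
  state : ∀ k, ρ (b k) = ((Real.exp (-(β * E k)) / Z : ℝ) : ℂ) • b k

theorem GibbsData.isThermal {S ι : Type} [DecidableEq S] {β : ℝ} {H : Op S}
    {b : HilbertBasis ι ℂ (Hilb S)} {E : ι → ℝ} {Z : ℝ} {ρ : Hilb S →L[ℂ] Hilb S}
    (h : GibbsData β H b E Z ρ) : IsThermal β H ρ :=
  isThermal_of_diag b h.energy h.pos h.total h.state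

/-- K_b lies in the symplectic Lie algebra. Thus Ω turns eigenvectors of K_b into eigenvectors of
its transpose with the opposite eigenvalue, the form needed for `commutator_of_eigenvector`. -/
theorem Kb_transpose_mul_Omega (R : RMat N) :
    (cx (Kb R)).transpose * cx (Omega N) = -(cx (Omega N) * cx (Kb R)) := by
  rw [← cx_transpose, ← cx_mul, ← cx_mul, ← cx_neg, Kb, Matrix.transpose_mul, Omega_transpose,
    (hB_isSymm R).eq, ← Matrix.mul_assoc (Omega N), Omega_mul_self, Matrix.mul_neg, Matrix.neg_mul,
    Matrix.mul_assoc, Omega_mul_self]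
  simp

theorem exists_gaussian_boson {R : RMat N} (hR : IsUnit R.det) {β : ℝ} (hβ : 0 < β) {J : RMat N}
    {V : CMat N} {ω : Idx N → ℝ} (hV : IsUnit V.det) (hω : ∀ a, ω a ≠ 0)
    (hK : cx (Kb R) = V * diagonal (fun a => I * (ω a : ℂ)) * V⁻¹)
    (hJ : cx J = V * diagonal (fun a => -Complex.cot ((β : ℂ) * (I * (ω a : ℂ)) / 2)) * V⁻¹) :
    ∃ (ι : Type) (b : HilbertBasis ι ℂ (Hilb (OccB N))) (E : ι → ℝ) (Z : ℝ)
      (ρ : Hilb (OccB N) →L[ℂ] Hilb (OccB N)),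
      GibbsData β (hamB R) b E Z ρ ∧ IsGaussianB ρ J := by
  obtain ⟨ι, b, E, C, hC, hE, hb⟩ := exists_eigenbasis_hamB hR
  obtain ⟨ρ, Z, hZ, h1, hρ⟩ := exists_gibbs b (summable_exp_of_weight b hC hb hβ)
  refine ⟨ι, b, E, Z, ρ, ⟨hZ, hE, h1, hρ⟩, ?_⟩
  obtain ⟨M, m, hM, hm, hkms⟩ := exists_moments b one_le_wt hE (eigenOrtho_hamB R) formAdj_xiB hZ
    (summable_exp_mul_weight b hC hb hβ Z hZ) hρ
  have hd : IsDensity ρ := (isThermal_of_diag b hE hZ h1 hρ).1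
  have hΩ : cx (Omega N) * cx (Omega N) = -1 := by
    rw [← cx_mul, Omega_mul_self, cx_neg, cx_one]
  have hu : ∀ a, (cx (Kb R)).transpose *ᵥ (cx (Omega N) * V).col a =
      (-(I * (ω a : ℂ))) • (cx (Omega N) * V).col a := by
    intro a
    have hcol : (cx (Omega N) * V).col a = cx (Omega N) *ᵥ V.col a := rfl
    rw [hcol, Matrix.mulVec_mulVec, Kb_transpose_mul_Omega, Matrix.neg_mulVec,
      ← Matrix.mulVec_mulVec, mulVec_col_of_diag hV hK, Matrix.mulVec_smul, neg_smul]
  have hk := fun a => hkms ((cx (Omega N) * V).col a) (ω a)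
    (commutator_of_eigenvector (xiB_commutator_hamB R) (hu a))
  have hMM : M - M.transpose = I • cx (Omega N) := by
    ext i j
    have h2 := (hM i j).sub (hM j i)
    rw [xiB_comm] at h2
    have h3 := h2.unique (hd.trace_one.smul (I * (Omega N i j : ℂ)))
    rw [mul_one] at h3
    exact h3
  have hcov := boson_covariance hβ.ne' hω hΩ hV hJ hMM (fun a => (hk a).1)
  -- The exponent is βH + log Z, and H carries a factor 1/2 in front of h^b.
  refine ⟨hd, ⟨(β / 2) • hB R, Real.log Z, ?_, ?_⟩, ?_, ?_⟩
  · rw [Matrix.IsSymm, Matrix.transpose_smul, (hB_isSymm R).eq]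
  · refine isExpNeg_of_diag b hE hZ hρ ?_
    rw [quad_smul, hamB, smul_smul]
    congr 2
    push_cast
    ring
  · intro a
    have h2 : m a = 0 := by
      refine eq_zero_of_col (U := cx (Omega N) * V) ?_ (fun c => (hk c).2 (hω c)) a
      rw [Matrix.det_mul]
      exact (isUnit_cx_det isUnit_det_Omega).mul hV
    rw [← h2]
    exact hm a
  · intro a c
    have h2 := (hM a c).add (hM c a)
    have h3 : M a c + M c a = ((-(J * Omega N) : RMat N) a c : ℂ) := by
      have := congrFun (congrFun hcov a) c
      rw [← cx_mul, ← cx_neg] at this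
      exact this
    rwa [h3] at h2

end BosonGaussian

/-! ### The fermionic thermal state -/

section FermionGaussian

variable {N : ℕ}

theorem norm_opF_sq_le (A : Op (OccF N)) (f : OccF N → ℂ) (m : OccF N) :
    ‖A f m‖ ^ 2 ≤ (∑ m', ‖f m'‖ ^ 2) * ∑ m', ‖A (Pi.single m' 1) m‖ ^ 2 := by
  rw [opF_apply]
  refine le_trans ?_ (Finset.sum_mul_sq_le_sq_mul_sq Finset.univ (fun m' => ‖f m'‖)
    (fun m' => ‖A (Pi.single m' 1) m‖))
  refine pow_le_pow_left₀ (norm_nonneg _) ((norm_sum_le _ _).trans_eq ?_) 2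
  exact Finset.sum_congr rfl fun m' _ => norm_mul _ _

theorem summable_opF {ι : Type} (A : Op (OccF N)) {F : ι → OccF N → ℂ}
    (hF : Summable (fun x : ι × OccF N => ‖F x.1 x.2‖ ^ 2)) :
    Summable (fun x : ι × OccF N => ‖A (F x.1) x.2‖ ^ 2) := by
  rw [summable_prod_of_nonneg (fun x => sq_nonneg _)]
  refine ⟨fun k => (hasSum_fintype _).summable, ?_⟩
  simp only [tsum_fintype]
  have h1 := hF.prod
  simp only [tsum_fintype] at h1
  refine Summable.of_nonneg_of_le (fun k => Finset.sum_nonneg fun m _ => sq_nonneg _) (fun k => ?_)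
    (h1.mul_right (∑ m, ∑ m', ‖A (Pi.single m' 1) m‖ ^ 2))
  rw [Finset.mul_sum]
  exact Finset.sum_le_sum fun m _ => norm_opF_sq_le A (F k) m

/-- Adjointness is stable under amplification in finite dimension. -/
theorem formAdj_of_finAdj {A B : Op (OccF N)} (h : FinAdj A B) : FormAdj (fun _ => 1) A B := by
  refine ⟨LinearMap.continuous_of_finiteDimensional A, fun F hF => ?_, fun F G hF hG => ?_⟩
  · simp only [one_mul] at hF
    exact summable_opF B hF
  · simp only [one_mul] at hF
    have h1 := summable_mul_of_sq hF (summable_opF A hG)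
    have h2 := summable_mul_of_sq (summable_opF B hF) hG
    have h3 : ∑' x : _ × OccF N, (starRingEnd ℂ) (B (F x.1) x.2) * G x.1 x.2 =
        ∑' x : _ × OccF N, (starRingEnd ℂ) (F x.1 x.2) * A (G x.1) x.2 := by
      rw [h1.tsum_prod, h2.tsum_prod]
      exact tsum_congr fun k => (h (F k) (G k) (Set.toFinite _)).2.symm
    rw [h3]
    exact h1.hasSum

theorem conj_fSign (i : Fin N) (m : OccF N) : (starRingEnd ℂ) (fSign i m) = fSign i m := by
  rw [fSign, map_prod]
  refine Finset.prod_congr rfl fun j _ => ?_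
  split_ifs <;> simp

theorem sum_flip (i : Fin N) (f : OccF N → ℂ) :
    ∑ m : OccF N, f (Function.update m i (!m i)) = ∑ m, f m := by
  have hinv : Function.Involutive (fun m : OccF N => Function.update m i (!m i)) := by
    intro m
    simp
  exact Equiv.sum_comp hinv.toPerm f

theorem finAdj_cAnn (i : Fin N) : FinAdj (cAnn i) (cCre i) := by
  intro g f _
  refine ⟨Set.toFinite _, ?_⟩
  rw [tsum_fintype, tsum_fintype, ← sum_flip i]
  refine Finset.sum_congr rfl fun m _ => ?_
  rw [cAnn_apply, cCre_apply]
  by_cases h : m i = true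
  · have h1 : Function.update m i true = m := by rw [← h, Function.update_eq_self]
    simp [h, fSign_update, conj_fSign, h1]
    ring
  · simp [h]

theorem finAdj_cCre (i : Fin N) : FinAdj (cCre i) (cAnn i) := by
  intro g f _
  refine ⟨Set.toFinite _, ?_⟩
  rw [tsum_fintype, tsum_fintype, ← sum_flip i]
  refine Finset.sum_congr rfl fun m _ => ?_
  rw [cAnn_apply, cCre_apply]
  by_cases h : m i = true
  · simp [h]
  · have h0 : m i = false := by simpa using h
    have h1 : Function.update m i false = m := by rw [← h0, Function.update_eq_self]
    simp [h0, fSign_update, conj_fSign, h1]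
    ring

theorem finAdj_xiF (a : Idx N) : FinAdj (xiF a) (xiF a) := by
  rcases a with i | i
  · have h := ((finAdj_cCre i).add (finAdj_cAnn i)).smul ((1 / Real.sqrt 2 : ℝ) : ℂ)
    rw [Complex.conj_ofReal, add_comm (cAnn i)] at h
    exact h
  · have h := ((finAdj_cCre i).add ((finAdj_cAnn i).smul (-1))).smul
      (Complex.I * ((1 / Real.sqrt 2 : ℝ) : ℂ))
    have h1 : (Complex.I * ((1 / Real.sqrt 2 : ℝ) : ℂ)) • (cCre i + (-1 : ℂ) • cAnn i) =
        xiF (Sum.inr i) := by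
      rw [xiF]; module
    have h2 : (starRingEnd ℂ) (Complex.I * ((1 / Real.sqrt 2 : ℝ) : ℂ)) •
        (cAnn i + (starRingEnd ℂ) (-1) • cCre i) = xiF (Sum.inr i) := by
      rw [xiF, map_mul, Complex.conj_ofReal, Complex.conj_I, map_neg, map_one]; module
    rwa [h1, h2] at h

/-- Taking the adjoint reverses the product and conjugates the factor i; antisymmetry of h undoes
both signs at once, which makes the fermionic Hamiltonian self-adjoint. -/
theorem antisymm_quad_swap {A : Type*} [Ring A] [Algebra ℂ A] (ξ : Idx N → A) {h : RMat N}
    (hh : h.transpose = -h) :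
    (-(I / 2)) • ∑ a, ∑ b, (h a b : ℂ) • (ξ b * ξ a) =
      (I / 2) • ∑ a, ∑ b, (h a b : ℂ) • (ξ a * ξ b) := by
  rw [Finset.sum_comm, neg_smul, ← smul_neg, ← Finset.sum_neg_distrib]
  congr 1
  refine Finset.sum_congr rfl fun a _ => ?_
  rw [← Finset.sum_neg_distrib]
  refine Finset.sum_congr rfl fun b _ => ?_
  have h1 := congrFun (congrFun hh a) b
  rw [Matrix.transpose_apply, Matrix.neg_apply] at h1
  rw [h1, ← neg_smul]
  push_cast
  rw [neg_neg]

theorem finAdj_hamF (R : RMat N) : FinAdj (hamF R) (hamF R) := by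
  have h1 := (FinAdj.sum Finset.univ fun a => FinAdj.sum Finset.univ fun b =>
    ((finAdj_xiF (N := N) a).mul (finAdj_xiF b)).smul (hF R a b : ℂ)).smul (I / 2)
  have h2 : (starRingEnd ℂ) (I / 2) = -(I / 2) := by
    rw [map_div₀, Complex.conj_I, map_ofNat, neg_div]
  simp only [Complex.conj_ofReal] at h1
  rw [h2, antisymm_quad_swap xiF (hF_transpose R)] at h1
  exact h1

theorem eigenOrtho_of_finAdj {S : Type} [Finite S] {H : Op S} (h : FinAdj H H) :
    EigenOrtho H := by
  intro E E' f g hE hf hg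
  have h1 := (h f g (Set.toFinite _)).2
  have h2 := (hasSum_inner_coe f g).tsum_eq
  have h3 : ∀ s, (starRingEnd ℂ) (f s) * H g s =
      (E' : ℂ) * ((starRingEnd ℂ) (f s) * g s) := by
    intro s
    rw [hg, Pi.smul_apply, smul_eq_mul]; ring
  have h4 : ∀ s, (starRingEnd ℂ) (H f s) * g s =
      (E : ℂ) * ((starRingEnd ℂ) (f s) * g s) := by
    intro s
    rw [hf, Pi.smul_apply, smul_eq_mul, map_mul, Complex.conj_ofReal]; ring
  rw [tsum_congr h3, tsum_congr h4, tsum_mul_left, tsum_mul_left, h2] at h1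
  have h5 : (E : ℂ) - E' ≠ 0 := by
    rw [sub_ne_zero]; exact_mod_cast hE
  have h6 : ((E : ℂ) - E') * inner ℂ f g = 0 := by rw [sub_mul, h1, sub_self]
  exact (mul_eq_zero.1 h6).resolve_left h5

theorem bddOp_opF (A : Op (OccF N)) : BddOp A := by
  have hmem : ∀ m : OccF N, Memℓp (A (Pi.single m 1)) 2 := fun m => by
    rw [mem2_iff]
    exact (hasSum_fintype _).summable
  refine ⟨∑ m, (ContinuousLinearMap.toSpanSingleton ℂ (⟨_, hmem m⟩ : Hilb (OccF N))) ∘L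
    (innerSL ℂ (ket m)), fun f => ?_⟩
  simp only [_root_.sum_apply, ContinuousLinearMap.comp_apply, innerSL_apply_apply, inner_ket_left,
    ContinuousLinearMap.toSpanSingleton_apply]
  rw [lp.coeFn_sum]
  funext s
  rw [Finset.sum_apply, opF_apply]
  rfl

/-- In finite dimension the identity is compact, so the compact spectral theorem applies to the
Hamiltonian itself. Its operator norm bounds the energies from below. -/
theorem exists_eigenbasis_hamF (R : RMat N) :
    ∃ (ι : Type) (b : HilbertBasis ι ℂ (Hilb (OccF N))) (E : ι → ℝ) (C : ℝ),
      (∀ k, hamF R (b k) = (E k : ℂ) • (b k : OccF N → ℂ)) ∧ ∀ k, -C ≤ E k := by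
  obtain ⟨T, hT⟩ := bddOp_opF (hamF R)
  have hsymm : T.IsSymmetric := by
    intro f g
    have h1 := (finAdj_hamF R f g (Set.toFinite _)).2
    have h2 := (hasSum_inner_coe f (T g)).tsum_eq
    have h3 := (hasSum_inner_coe (T f) g).tsum_eq
    rw [hT] at h2 h3
    exact h3.symm.trans (h1.symm.trans h2)
  have hid : IsCompactOperator (ContinuousLinearMap.id ℂ (Hilb (OccF N))) :=
    isCompactOperator_mul (v := fun _ => 1) (fun f s => (one_mul _).symm)
      (fun ε _ => Set.toFinite _)
  obtain ⟨ι, b, E, hE⟩ := exists_eigenbasis (hid.clm_comp T) hsymm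
  refine ⟨ι, b, E, ‖T‖, fun k => ?_, fun k => ?_⟩
  · rw [← hT, hE]
    rfl
  · have h1 := T.le_opNorm (b k)
    rw [hE, norm_smul, b.orthonormal.1 k, mul_one, mul_one, Complex.norm_real] at h1
    exact (abs_le.1 h1).1

/-- The index type of the basis is not assumed finite; summability of the constant 1 over it comes
from the trace of the identity on the finite set of fermionic labels. -/
theorem summable_exp_hamF {ι : Type} (b : HilbertBasis ι ℂ (Hilb (OccF N))) {E : ι → ℝ} {C : ℝ}
    (hE : ∀ k, -C ≤ E k) {β : ℝ} (hβ : 0 < β) : Summable (fun k => Real.exp (-(β * E k))) := by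
  have h1 := (summable_basis_prod b (v := fun _ => 1) (fun _ => zero_le_one)
    (hasSum_fintype _).summable).prod
  simp only [mul_one] at h1
  simp only [fun k => (hasSum_norm_sq (b k)).tsum_eq, b.orthonormal.1, one_pow] at h1
  refine Summable.of_nonneg_of_le (fun k => (Real.exp_pos _).le) (fun k => ?_)
    (h1.mul_left (Real.exp (β * C)))
  rw [mul_one, Real.exp_le_exp]
  nlinarith [hE k]

theorem exists_gaussian_fermion {R : RMat N} {β : ℝ} (hβ : 0 < β) {J : RMat N}
    {W : CMat N} {ω : Idx N → ℝ} (hW : IsUnit W.det) (hω : ∀ a, ω a ≠ 0)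
    (hK : cx (Kf R) = W * diagonal (fun a => I * (ω a : ℂ)) * W⁻¹)
    (hJ : cx J = W * diagonal (fun a => Complex.tan ((β : ℂ) * (I * (ω a : ℂ)) / 2)) * W⁻¹) :
    ∃ (ι : Type) (b : HilbertBasis ι ℂ (Hilb (OccF N))) (E : ι → ℝ) (Z : ℝ)
      (ρ : Hilb (OccF N) →L[ℂ] Hilb (OccF N)),
      GibbsData β (hamF R) b E Z ρ ∧ IsGaussianF ρ J := by
  obtain ⟨ι, b, E, C, hE, hC⟩ := exists_eigenbasis_hamF R
  obtain ⟨ρ, Z, hZ, h1, hρ⟩ := exists_gibbs b (summable_exp_hamF b hC hβ)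
  refine ⟨ι, b, E, Z, ρ, ⟨hZ, hE, h1, hρ⟩, ?_⟩
  have hreg : Summable (fun x : ι × OccF N =>
      Real.exp (-(β * E x.1)) / Z * (1 * ‖b x.1 x.2‖ ^ 2)) := by
    simp only [one_mul]
    exact (hasSum_basis_prod b (fun k => by positivity) h1).summable
  obtain ⟨M, m, hM, hm, hkms⟩ := exists_moments b (w := fun _ => 1) (fun _ => le_rfl) hE
    (eigenOrtho_of_finAdj (finAdj_hamF R)) (fun a => formAdj_of_finAdj (finAdj_xiF a)) hZ hreg hρ
  have hd : IsDensity ρ := (isThermal_of_diag b hE hZ h1 hρ).1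
  -- K_f is antisymmetric, so its own eigenvectors serve and no factor Ω appears.
  have hu : ∀ a, (cx (Kf R)).transpose *ᵥ W.col a = (-(I * (ω a : ℂ))) • W.col a := by
    intro a
    rw [← cx_transpose, Kf_transpose, cx_neg, Matrix.neg_mulVec, mulVec_col_of_diag hW hK, neg_smul]
  have hk := fun a => hkms (W.col a) (ω a)
    (commutator_of_eigenvector (xiF_commutator_hamF R) (hu a))
  have hMM : M + M.transpose = 1 := by
    ext i j
    have h2 := (hM i j).add (hM j i)
    rw [xiF_anticomm] at h2
    have h3 := h2.unique (hd.trace_one.smul ((metric N i j : ℝ) : ℂ))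
    rw [mul_one] at h3
    refine h3.trans ?_
    rw [metric, Matrix.one_apply, Matrix.one_apply]
    split_ifs <;> simp
  have hcov := fermion_covariance hW hJ hMM (fun a => (hk a).1)
  refine ⟨hd, ⟨(β / 2) • hF R, Real.log Z, ?_, ?_⟩, ?_, ?_⟩
  · rw [Matrix.transpose_smul, hF_transpose, smul_neg]
  · refine isExpNeg_of_diag b hE hZ hρ ?_
    rw [quad_smul, hamF, smul_smul, smul_smul]
    congr 2
    push_cast
    ring
  · intro a
    rw [← eq_zero_of_col hW (fun c => (hk c).2 (hω c)) a]
    exact hm a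
  · intro a c
    have h2 := ((hM a c).sub (hM c a)).smul (-I)
    have h3 : -I * (M a c - M c a) = ((J * metric N : RMat N) a c : ℂ) := by
      rw [metric, Matrix.mul_one]
      exact congrFun (congrFun hcov a) c
    rwa [h3] at h2

end FermionGaussian

/-! ### Tensor products -/

section Tensor

variable {S T : Type}

theorem exists_tmul (f : Hilb S) (g : Hilb T) :
    ∃ v : Hilb (S × T), ∀ s t, (v : S × T → ℂ) (s, t) = f s * g t := by
  refine ⟨⟨fun x => f x.1 * g x.2, ?_⟩, fun _ _ => rfl⟩
  refine mem2_iff.2 ?_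
  refine ((summable_norm_sq f).mul_of_nonneg (summable_norm_sq g) (fun _ => sq_nonneg _)
    (fun _ => sq_nonneg _)).congr fun x => ?_
  rw [norm_mul, mul_pow]

/-- The tensor product of two vectors. -/
def tmul (f : Hilb S) (g : Hilb T) : Hilb (S × T) := (exists_tmul f g).choose

theorem tmul_apply (f : Hilb S) (g : Hilb T) (s : S) (t : T) :
    (tmul f g : S × T → ℂ) (s, t) = f s * g t := (exists_tmul f g).choose_spec s t

theorem exists_slice (v : Hilb (S × T)) (s : S) :
    ∃ w : Hilb T, ∀ t, (w : T → ℂ) t = (v : S × T → ℂ) (s, t) := by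
  refine ⟨⟨fun t => v (s, t), ?_⟩, fun _ => rfl⟩
  refine mem2_iff.2 ?_
  exact (summable_norm_sq v).prod_factor s

/-- The slice of a vector of the tensor product at a basis label of the first factor. -/
def slice (v : Hilb (S × T)) (s : S) : Hilb T := (exists_slice v s).choose

theorem slice_apply (v : Hilb (S × T)) (s : S) (t : T) :
    (slice v s : T → ℂ) t = (v : S × T → ℂ) (s, t) := (exists_slice v s).choose_spec t

theorem summable_norm_slice (v : Hilb (S × T)) : Summable (fun s => ‖slice v s‖ ^ 2) := by
  refine (summable_norm_sq v).prod.congr fun s => ?_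
  rw [← (hasSum_norm_sq (slice v s)).tsum_eq]
  simp only [slice_apply]

theorem exists_contract (g : Hilb T) (v : Hilb (S × T)) :
    ∃ w : Hilb S, ∀ s, (w : S → ℂ) s = inner ℂ g (slice v s) := by
  refine ⟨⟨fun s => inner ℂ g (slice v s), ?_⟩, fun _ => rfl⟩
  refine mem2_iff.2 ?_
  refine Summable.of_nonneg_of_le (fun _ => sq_nonneg _) (fun s => ?_)
    ((summable_norm_slice v).mul_left (‖g‖ ^ 2))
  rw [← mul_pow]
  exact pow_le_pow_left₀ (norm_nonneg _) (norm_inner_le_norm _ _) 2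

/-- The contraction of a vector of the tensor product with a vector of the second factor. -/
def contract (g : Hilb T) (v : Hilb (S × T)) : Hilb S := (exists_contract g v).choose

theorem contract_apply (g : Hilb T) (v : Hilb (S × T)) (s : S) :
    (contract g v : S → ℂ) s = inner ℂ g (slice v s) := (exists_contract g v).choose_spec s

/-- Contraction with g is the adjoint of f ↦ f ⊗ g: sum over the second label first. -/
theorem inner_tmul (f : Hilb S) (g : Hilb T) (v : Hilb (S × T)) :
    inner ℂ (tmul f g) v = inner ℂ f (contract g v) := by
  have h1 := hasSum_inner_coe (tmul f g) v
  refine (h1.prod_fiberwise fun s => ?_).unique (hasSum_inner_coe f (contract g v))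
  have h2 := (hasSum_inner_coe g (slice v s)).mul_left ((starRingEnd ℂ) (f s))
  rw [contract_apply]
  refine (hasSum_congr fun t => ?_).1 h2
  rw [tmul_apply, slice_apply, map_mul, mul_assoc]

theorem contract_tmul (g g' : Hilb T) (f : Hilb S) :
    contract g (tmul f g') = inner ℂ g g' • f := by
  ext s
  have h : slice (tmul f g') s = f s • g' := by
    ext t
    rw [slice_apply, tmul_apply]
    rfl
  rw [contract_apply, h, inner_smul_right, mul_comm]
  rfl

/-- For completeness, a vector orthogonal to all products has zero contraction with every c_l, by
completeness of b; then every slice vanishes, by completeness of c. -/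
theorem exists_tensor_basis {ι κ : Type} (b : HilbertBasis ι ℂ (Hilb S))
    (c : HilbertBasis κ ℂ (Hilb T)) :
    ∃ e : HilbertBasis (ι × κ) ℂ (Hilb (S × T)), ∀ x, e x = tmul (b x.1) (c x.2) := by
  classical
  have hon : Orthonormal ℂ (fun x : ι × κ => tmul (b x.1) (c x.2)) := by
    rw [orthonormal_iff_ite]
    rintro ⟨k, l⟩ ⟨k', l'⟩
    rw [inner_tmul, contract_tmul, inner_smul_right, orthonormal_iff_ite.1 b.orthonormal,
      orthonormal_iff_ite.1 c.orthonormal]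
    by_cases hk : k = k' <;> by_cases hl : l = l' <;> simp [hk, hl]
  have hz : ∀ {X κ : Type} (c : HilbertBasis κ ℂ (Hilb X)) (v : Hilb X),
      (∀ l, inner ℂ (c l) v = 0) → v = 0 := by
    intro X κ c v h
    refine (c.hasSum_repr v).unique ((hasSum_congr fun l => ?_).1 hasSum_zero)
    rw [c.repr_apply_apply, h, zero_smul]
  have hbot : (Submodule.span ℂ (Set.range (fun x : ι × κ => tmul (b x.1) (c x.2))))ᗮ = ⊥ := by
    rw [eq_bot_iff]
    intro v hv
    rw [Submodule.mem_orthogonal] at hv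
    have h1 : ∀ l, contract (c l) v = 0 := fun l => hz b _ fun k => by
      rw [← inner_tmul]
      exact hv _ (Submodule.subset_span ⟨(k, l), rfl⟩)
    have h2 : ∀ s, slice v s = 0 := fun s => hz c _ fun l => by
      rw [← contract_apply, h1]
      rfl
    rw [Submodule.mem_bot]
    ext ⟨s, t⟩
    rw [← slice_apply, h2]
    rfl
  exact ⟨HilbertBasis.mkOfOrthogonalEqBot hon hbot, fun x => by
    rw [HilbertBasis.coe_mkOfOrthogonalEqBot]⟩

end Tensor

/-! ### Eigenvectors and Gibbs states of the combined system. -/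

section Product

variable {N : ℕ}

theorem eq_mul_of_hasSum {ι κ : Type} {f : ι → ℂ} {g : κ → ℂ} {a b c : ℂ} (hf : HasSum f a)
    (hg : HasSum g b) (hc : HasSum (fun x : ι × κ => f x.1 * g x.2) c) : c = a * b :=
  hc.unique (hf.mul hg hc.summable)

theorem mul_mul_mul_rearrange (p q x y z w : ℂ) :
    p * q * (x * y * (z * w)) = p * (x * z) * (q * (y * w)) := by ring

theorem onB_tmul (A : Op (OccB N)) (f : Hilb (OccB N)) (g : Hilb (OccF N)) (n : OccB N)
    (m : OccF N) : onB A (tmul f g) (n, m) = A f n * g m := by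
  have h : (fun n => (tmul f g : Occ N → ℂ) (n, m)) = g m • (f : OccB N → ℂ) := by
    funext n
    rw [tmul_apply, mul_comm]
    rfl
  change A (fun n => (tmul f g : Occ N → ℂ) (n, m)) n = _
  rw [h, map_smul, Pi.smul_apply, smul_eq_mul, mul_comm]

theorem onF_tmul (A : Op (OccF N)) (f : Hilb (OccB N)) (g : Hilb (OccF N)) (n : OccB N)
    (m : OccF N) : onF A (tmul f g) (n, m) = f n * A g m := by
  have h : (fun m => (tmul f g : Occ N → ℂ) (n, m)) = f n • (g : OccF N → ℂ) := by
    funext m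
    rw [tmul_apply]
    rfl
  change A (fun m => (tmul f g : Occ N → ℂ) (n, m)) m = _
  rw [h, map_smul, Pi.smul_apply, smul_eq_mul]

theorem hamiltonian_tmul (R : RMat N) {f : Hilb (OccB N)} {g : Hilb (OccF N)} {E F : ℝ}
    (hf : hamB R f = (E : ℂ) • (f : OccB N → ℂ)) (hg : hamF R g = (F : ℂ) • (g : OccF N → ℂ)) :
    hamiltonian R (tmul f g) = ((E + F : ℝ) : ℂ) • (tmul f g : Occ N → ℂ) := by
  funext x
  obtain ⟨n, m⟩ := x
  rw [hamiltonian_eq, LinearMap.add_apply, Pi.add_apply, onB_tmul, onF_tmul, hf, hg,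
    Pi.smul_apply, Pi.smul_apply, Pi.smul_apply, tmul_apply]
  simp only [smul_eq_mul]
  push_cast
  ring

theorem contract_apply_sum (g : Hilb (OccF N)) (v : Hilb (Occ N)) (n : OccB N) :
    (contract g v : OccB N → ℂ) n = ∑ m, (starRingEnd ℂ) (g m) * (v : Occ N → ℂ) (n, m) := by
  rw [contract_apply, ← (hasSum_inner_coe g (slice v n)).tsum_eq, tsum_fintype]
  simp only [slice_apply]

/-- Contraction with a fermionic eigenvector converts the fermionic part of H into the number F,
since adjointness of that part involves only finite sums. The outcome is a formal bosonic
eigenvector, to which the maximal-domain orthogonality applies. -/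
theorem hamB_contract (R : RMat N) {v : Hilb (Occ N)} {g : Hilb (OccF N)} {E F : ℝ}
    (hv : hamiltonian R v = (E : ℂ) • (v : Occ N → ℂ))
    (hg : hamF R g = (F : ℂ) • (g : OccF N → ℂ)) :
    hamB R (contract g v) = ((E - F : ℝ) : ℂ) • (contract g v : OccB N → ℂ) := by
  have h1 : (contract g v : OccB N → ℂ) =
      ∑ m, (starRingEnd ℂ) (g m) • (fun n => (v : Occ N → ℂ) (n, m)) := by
    funext n
    rw [contract_apply_sum, Finset.sum_apply]
    rfl
  have h2 : ∀ n m, hamB R (fun n => (v : Occ N → ℂ) (n, m)) n +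
      hamF R (fun m => (v : Occ N → ℂ) (n, m)) m = (E : ℂ) * (v : Occ N → ℂ) (n, m) := by
    intro n m
    have := congrFun hv (n, m)
    rw [hamiltonian_eq] at this
    exact this
  funext n
  have h3 := (finAdj_hamF R g (fun m => (v : Occ N → ℂ) (n, m)) (Set.toFinite _)).2
  rw [tsum_fintype, tsum_fintype] at h3
  rw [Pi.smul_apply, contract_apply_sum, h1, map_sum, Finset.sum_apply]
  simp only [map_smul, Pi.smul_apply, smul_eq_mul]
  have h4 : ∀ m, (starRingEnd ℂ) (hamF R g m) * (v : Occ N → ℂ) (n, m) =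
      (F : ℂ) * ((starRingEnd ℂ) (g m) * (v : Occ N → ℂ) (n, m)) := by
    intro m
    rw [hg, Pi.smul_apply, smul_eq_mul, map_mul, Complex.conj_ofReal, mul_assoc]
  simp only [h4] at h3
  have h5 : ∀ m, (starRingEnd ℂ) (g m) * hamB R (fun n => (v : Occ N → ℂ) (n, m)) n =
      (E : ℂ) * ((starRingEnd ℂ) (g m) * (v : Occ N → ℂ) (n, m)) -
        (starRingEnd ℂ) (g m) * hamF R (fun m => (v : Occ N → ℂ) (n, m)) m := by
    intro m
    linear_combination (starRingEnd ℂ) (g m) * h2 n m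
  simp only [h5]
  rw [Finset.sum_sub_distrib, h3, ← Finset.mul_sum, ← Finset.mul_sum]
  push_cast
  ring

/-- A formal eigenvector of energy G has components only along product vectors of total energy G.
Eigenvectors of different energies therefore have disjoint expansions. -/
theorem eigenOrtho_hamiltonian (R : RMat N) {ι κ : Type} {b : HilbertBasis ι ℂ (Hilb (OccB N))}
    {c : HilbertBasis κ ℂ (Hilb (OccF N))} {E : ι → ℝ} {F : κ → ℝ}
    (hb : ∀ k, hamB R (b k) = (E k : ℂ) • (b k : OccB N → ℂ))
    (hc : ∀ l, hamF R (c l) = (F l : ℂ) • (c l : OccF N → ℂ)) : EigenOrtho (hamiltonian R) := by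
  obtain ⟨e, he⟩ := exists_tensor_basis b c
  have key : ∀ {v : Hilb (Occ N)} {G : ℝ}, hamiltonian R v = (G : ℂ) • (v : Occ N → ℂ) →
      ∀ x, E x.1 + F x.2 ≠ G → inner ℂ (e x) v = 0 := by
    intro v G hv x hx
    rw [he, inner_tmul]
    exact eigenOrtho_hamB R _ _ _ _ (fun h => hx (by rw [h]; ring)) (hb x.1)
      (hamB_contract R hv (hc x.2))
  intro G G' v w hG hv hw
  refine (e.hasSum_inner_mul_inner v w).unique ((hasSum_congr fun x => ?_).1 hasSum_zero)
  by_cases hx : E x.1 + F x.2 = G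
  · rw [key hw x (fun h => hG (hx.symm.trans h)), mul_zero]
  · rw [← inner_conj_symm, key hv x hx, map_zero, zero_mul]

/-- The Gibbs state of the supersymmetric Hamiltonian is the product of the bosonic and the
fermionic one. -/
theorem GibbsData.tensor {R : RMat N} {β : ℝ} {ι κ : Type}
    {b : HilbertBasis ι ℂ (Hilb (OccB N))} {c : HilbertBasis κ ℂ (Hilb (OccF N))} {E : ι → ℝ}
    {F : κ → ℝ} {Zb Zf : ℝ} {ρb : Hilb (OccB N) →L[ℂ] Hilb (OccB N)}
    {ρf : Hilb (OccF N) →L[ℂ] Hilb (OccF N)} (hb : GibbsData β (hamB R) b E Zb ρb)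
    (hc : GibbsData β (hamF R) c F Zf ρf) :
    ∃ ρ : Hilb (Occ N) →L[ℂ] Hilb (Occ N), IsThermal β (hamiltonian R) ρ ∧ IsTensor ρ ρb ρf := by
  obtain ⟨e, he⟩ := exists_tensor_basis b c
  set p : ι → ℝ := fun k => Real.exp (-(β * E k)) / Zb with hp
  set q : κ → ℝ := fun l => Real.exp (-(β * F l)) / Zf with hq
  have hp0 : ∀ k, 0 ≤ p k := fun k => div_nonneg (Real.exp_pos _).le hb.pos.le
  have hq0 : ∀ l, 0 ≤ q l := fun l => div_nonneg (Real.exp_pos _).le hc.pos.le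
  have hpq : ∀ x : ι × κ, Real.exp (-(β * (E x.1 + F x.2))) / (Zb * Zf) = p x.1 * q x.2 := by
    intro x
    rw [hp, hq, div_mul_div_comm, ← Real.exp_add]
    congr 2
    ring
  have htot : HasSum (fun x : ι × κ => p x.1 * q x.2) 1 := by
    have := hb.total.mul hc.total (hb.total.summable.mul_of_nonneg hc.total.summable hp0 hq0)
    rwa [mul_one] at this
  obtain ⟨ρ, hρ⟩ := exists_diag_op e (p := fun x => p x.1 * q x.2) (C := 1) (fun x => by
    rw [abs_of_nonneg (mul_nonneg (hp0 _) (hq0 _))]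
    exact le_hasSum htot x fun y _ => mul_nonneg (hp0 _) (hq0 _))
  refine ⟨ρ, ?_, ?_⟩
  · refine isThermal_of_diag e (E := fun x => E x.1 + F x.2) (fun x => ?_)
      (mul_pos hb.pos hc.pos) ?_ (fun x => ?_)
    · rw [he]
      exact hamiltonian_tmul R (hb.energy _) (hc.energy _)
    · simpa only [hpq] using htot
    · rw [hpq, hρ]
  · intro n n' m m'
    have h1 := hasSum_op_diag e hρ (A := 1) continuous_id (n, m) (n', m')
    have h2 := hasSum_op_diag b hb.state (A := 1) continuous_id n n'
    have h3 := hasSum_op_diag c hc.state (A := 1) continuous_id m m'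
    simp only [Module.End.one_apply] at h1 h2 h3
    refine eq_mul_of_hasSum h2 h3 ((hasSum_congr fun x => ?_).1 h1)
    rw [he, tmul_apply, tmul_apply, map_mul, Complex.ofReal_mul]
    exact mul_mul_mul_rearrange _ _ _ _ _ _

end Product

/-! ### The complex structures -/

section Structures

theorem tan_half_eq_tanh (β ω : ℝ) :
    Complex.tan ((β : ℂ) * (I * (ω : ℂ)) / 2) = I * ((Real.tanh (β * ω / 2) : ℝ) : ℂ) := by
  have h : (β : ℂ) * (I * (ω : ℂ)) / 2 = ((β * ω / 2 : ℝ) : ℂ) * I := by push_cast; ring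
  rw [h, Complex.tan_mul_I, Complex.ofReal_tanh, mul_comm]

theorem neg_cot_half_eq_coth (β ω : ℝ) :
    -Complex.cot ((β : ℂ) * (I * (ω : ℂ)) / 2) = I * ((1 / Real.tanh (β * ω / 2) : ℝ) : ℂ) := by
  rw [← Complex.tan_inv_eq_cot, tan_half_eq_tanh, mul_inv, Complex.inv_I, one_div,
    Complex.ofReal_inv]
  ring

theorem tanh_pos {x : ℝ} (hx : 0 < x) : 0 < Real.tanh x := by
  rw [Real.tanh_eq_sinh_div_cosh]
  exact div_pos (Real.sinh_pos_iff.2 hx) (Real.cosh_pos x)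

theorem tanh_ne_zero {x : ℝ} (hx : x ≠ 0) : Real.tanh x ≠ 0 := by
  rw [← Real.tanh_zero]
  exact fun h => hx (Real.tanh_injective h)

variable {N : ℕ}

/-- The duality between the complex structures, for every identification of the generators. -/
theorem complex_structure_duality {R Jb Jf : RMat N} {β : ℝ} (hβ : β ≠ 0) {W : CMat N}
    {ω : Idx N → ℝ} (hW : IsUnit W.det) (hω : ∀ a, ω a ≠ 0)
    (hK : cx (Kf R) = W * diagonal (fun a => I * (ω a : ℂ)) * W⁻¹)
    (hb : IsMatFun (fun z => -Complex.cot ((β : ℂ) * z / 2)) (cx (Kb R)) (cx Jb))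
    (hf : IsMatFun (fun z => Complex.tan ((β : ℂ) * z / 2)) (cx (Kf R)) (cx Jf)) :
    IsUnit Jf.det ∧ ∀ L : RMat N, IsIdentification R L → L * Jb * L⁻¹ = -Jf⁻¹ := by
  -- The comparison matrix is the bosonic function evaluated at the fermionic generator: every
  -- identification L conjugates J_b into it, whatever L is. It multiplies J_f to -1, as tan does
  -- not vanish at the spectral points.
  have hB := isMatFun_of_diag (f := fun z => -Complex.cot ((β : ℂ) * z / 2)) hW hK
  set B : CMat N := W * diagonal (fun a => -Complex.cot ((β : ℂ) * (I * (ω a : ℂ)) / 2)) * W⁻¹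
  have h1 : B * cx Jf = (-1 : ℂ) • 1 := by
    refine (hB.comp_mul (k := fun _ => -1) hf hW hK fun a => ?_).eq_const hW hK (-1)
      fun _ => rfl
    have h0 : ((Real.tanh (β * ω a / 2) : ℝ) : ℂ) ≠ 0 :=
      Complex.ofReal_ne_zero.2 (tanh_ne_zero (div_ne_zero (mul_ne_zero hβ (hω a)) two_ne_zero))
    rw [neg_cot_half_eq_coth, tan_half_eq_tanh, one_div, Complex.ofReal_inv]
    field_simp
    exact Complex.I_sq
  rw [neg_smul, one_smul] at h1
  have h2 : -B * cx Jf = 1 := by rw [Matrix.neg_mul, h1, neg_neg]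
  have h3 : IsUnit Jf.det := by
    have h := Matrix.isUnit_det_of_left_inverse h2
    rw [cx_det, isUnit_iff_ne_zero, Complex.ofReal_ne_zero] at h
    exact isUnit_iff_ne_zero.2 h
  refine ⟨h3, fun L hL => cx_injective ?_⟩
  have h4 : cx L * cx Jb = B * cx L :=
    hb.intertwine hB (by rw [← cx_mul, hL.2, cx_mul])
  rw [cx_mul, cx_mul, h4, cx_inv hL.1, Matrix.mul_assoc,
    Matrix.mul_nonsing_inv _ (isUnit_cx_det hL.1), Matrix.mul_one, cx_neg, cx_inv h3,
    Matrix.inv_eq_left_inv h2, neg_neg]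

end Structures

end

end SUSY

/-! ### The thermal state duality. -/

theorem proposition2 (N : ℕ) (R : SUSY.RMat N) (hR : IsUnit R.det) (β : ℝ) (hβ : 0 < β) :
    -- the Hamiltonian splits into a bosonic and a fermionic part
    SUSY.hamiltonian R = SUSY.onB (SUSY.hamB R) + SUSY.onF (SUSY.hamF R) ∧
    -- the thermal state exists and is unique
    (∃! ρ : SUSY.Hilb (SUSY.Occ N) →L[ℂ] SUSY.Hilb (SUSY.Occ N),
      SUSY.IsThermal β (SUSY.hamiltonian R) ρ) ∧
    -- the supersymmetric identification maps exist (as real maps); they identify the generators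
    -- and the Kähler structures
    (∃ L₁ L₂ : SUSY.RMat N, SUSY.IsL1 R L₁ ∧ SUSY.IsL2 R L₂ ∧
      SUSY.IsIdentification R L₁ ∧ SUSY.PreservesKahler R L₁ ∧
      SUSY.IsIdentification R L₂⁻¹ ∧ SUSY.PreservesKahler R L₂⁻¹) ∧
    ∀ ρ : SUSY.Hilb (SUSY.Occ N) →L[ℂ] SUSY.Hilb (SUSY.Occ N),
      SUSY.IsThermal β (SUSY.hamiltonian R) ρ →
      ∃ (ρb : SUSY.Hilb (SUSY.OccB N) →L[ℂ] SUSY.Hilb (SUSY.OccB N))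
        (ρf : SUSY.Hilb (SUSY.OccF N) →L[ℂ] SUSY.Hilb (SUSY.OccF N))
        (Jb Jf : SUSY.RMat N),
        -- the thermal state is a product of Gaussian (thermal) states
        SUSY.IsTensor ρ ρb ρf ∧
        SUSY.IsThermal β (SUSY.hamB R) ρb ∧ SUSY.IsThermal β (SUSY.hamF R) ρf ∧
        SUSY.IsGaussianB ρb Jb ∧ SUSY.IsGaussianF ρf Jf ∧
        -- the complex structures in terms of the generators of `β H`
        SUSY.IsMatFun (fun z => -Complex.cot (z / 2)) (SUSY.cx (β • SUSY.Kb R)) (SUSY.cx Jb) ∧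
        SUSY.IsMatFun (fun z => Complex.tan (z / 2)) (SUSY.cx (β • SUSY.Kf R)) (SUSY.cx Jf) ∧
        -- the duality, under every identification of the phase spaces as above
        IsUnit Jf.det ∧
        (∀ L : SUSY.RMat N, SUSY.IsIdentification R L → L * Jb * L⁻¹ = -Jf⁻¹) ∧
        -- the eigenvalues
        ∃ lb lf : Fin N → ℝ, SUSY.HasEigenPairs Jb lb ∧ SUSY.HasEigenPairs Jf lf ∧
          ∀ i, 0 < lf i ∧ lb i = 1 / lf i := by
  -- This single diagonalization, transported to K_b by R⁻¹, supplies both complex structures, all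
  -- ladder combinations and the paired eigenvalues.
  obtain ⟨W, ω, μ, hW, hK, hω, hμ, hmult⟩ :=
    SUSY.exists_diag_antisymm (SUSY.Kf R) (SUSY.Kf_transpose R) (SUSY.isUnit_det_Kf hR)
  obtain ⟨hV, hKb⟩ := SUSY.diag_Kb hR hW hK
  obtain ⟨Jb, hJb⟩ := SUSY.exists_real_matFun (f := fun z => -Complex.cot ((β : ℂ) * z / 2))
    (fun z => by
      rw [map_neg, ← Complex.cot_conj, map_div₀, map_mul, Complex.conj_ofReal, map_ofNat]) hV hKb
  obtain ⟨Jf, hJf⟩ := SUSY.exists_real_matFun (f := fun z => Complex.tan ((β : ℂ) * z / 2))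
    (fun z => by
      rw [← Complex.tan_conj, map_div₀, map_mul, Complex.conj_ofReal, map_ofNat]) hW hK
  have hJb' := hJb.unique (SUSY.isMatFun_of_diag hV hKb)
  have hJf' := hJf.unique (SUSY.isMatFun_of_diag hW hK)
  obtain ⟨ι, b, E, Zb, ρb, hb, hGb⟩ := SUSY.exists_gaussian_boson hR hβ hV hω hKb hJb'
  obtain ⟨κ, c, F, Zf, ρf, hf, hGf⟩ := SUSY.exists_gaussian_fermion hβ hW hω hK hJf'
  obtain ⟨ρ, hρ, hρt⟩ := hb.tensor hf
  have huniq : ∀ ρ', SUSY.IsThermal β (SUSY.hamiltonian R) ρ' → ρ' = ρ := fun ρ' h' =>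
    SUSY.isThermal_unique (SUSY.eigenOrtho_hamiltonian R hb.energy hf.energy) hβ h' hρ
  obtain ⟨hdet, hdual⟩ := SUSY.complex_structure_duality hβ.ne' hW hω hK hJb hJf
  refine ⟨SUSY.hamiltonian_eq R, ⟨ρ, hρ, huniq⟩, SUSY.exists_identifications hR, fun ρ' h' => ?_⟩
  -- By uniqueness, only the product state constructed above needs to be examined.
  rw [huniq ρ' h']
  refine ⟨ρb, ρf, Jb, Jf, hρt, hb.isThermal, hf.isThermal, hGb, hGf, ?_, ?_, hdet, hdual,
    fun i => 1 / Real.tanh (β * μ i / 2), fun i => Real.tanh (β * μ i / 2), ?_, ?_,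
    fun i => ⟨SUSY.tanh_pos (half_pos (mul_pos hβ (hμ i))), rfl⟩⟩
  · rw [SUSY.cx_smul]
    exact hJb.smul_arg (f := fun z => -Complex.cot (z / 2)) (β : ℂ)
  · rw [SUSY.cx_smul]
    exact hJf.smul_arg (f := fun z => Complex.tan (z / 2)) (β : ℂ)
  · refine SUSY.hasEigenPairs_of_diag hV (fun x => 1 / Real.tanh (β * x / 2)) (fun x => ?_) ?_ hmult
    · rw [mul_neg, neg_div, Real.tanh_neg, div_neg]
    · simpa only [SUSY.neg_cot_half_eq_coth] using hJb'
  · refine SUSY.hasEigenPairs_of_diag hW (fun x => Real.tanh (β * x / 2)) (fun x => ?_) ?_ hmult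
    · rw [mul_neg, neg_div, Real.tanh_neg]
    · simpa only [SUSY.tan_half_eq_tanh] using hJf'
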